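/- Let $r\ge 2$ be an integer and let $F$ be a finite simple graph. **Games.** Let $r\mid n$ and generate a binomial random graph $G(n,p)$, $p=p(n)\in[0,1]$, on $\{v_1,\dots,v_n\}$, hidden from the player. In step $i=1,\dots,n/r$ the vertices $v_{(i-1)r+1},\dots,v_{ir}$ are revealed, together with all edges induced by $v_1,\dots,v_{ir}$. In the *vertex balanced Ramsey game* the player immediately assigns each of $r$ colors to exactly one of the $r$ new vertices, and wins if after the last step there is no monochromatic copy of $F$. In the *vertex Achlioptas game* she immediately selects exactly one of the $r$ new vertices, and wins if after the last step the subgraph induced by the selected vertices contains no copy of $F$. (Copies need not be induced.) A function $p_0=p_0(n)$, positive for all large $n$ with $r\mid n$, is a *threshold* of such a game if (all asymptotics being for $n\to\infty$ along multiples of $r$) (i) whenever $p=o(p_0)$, there is a strategy with which the player wins with probability tending to $1$, and (ii) whenever $p_0=o(p)$, the player fails with probability tending to $1$ whatever strategy she uses. **Exponents.** For an ordering $\pi=(u_1,\dots,u_h)$ of the vertices of a graph $H$ and a subgraph $J\subseteq H$, let $\pi|_J$ be the induced ordering; $J\setminus\{u_1,\dots,u_i\}$ denotes $J$ with the vertices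 $u_1,\dots,u_i$ and their incident edges removed; $e(\cdot)$ and $v(\cdot)$ count edges and vertices. For $h\ge1$, $H_1=H$ and subgraphs $H_2,\dots,H_h$ with $u_i\in H_i\subseteq H_1\setminus\{u_1,\dots,u_{i-1}\}$, put $c_1:=r$ and $c_i:=(r-1)\sum_{j<i,\ u_i\in H_j}c_j$ for $2\le i\le h$, and define $$d^{r*}(H_1,\pi):=\max_{H_2,\dots,H_h}\frac{\sum_{i=1}^h c_i\,e(H_i)}{1+\sum_{i=1}^h c_i\,(v(H_i)-1)},\qquad m^{r*}(F):=\min_{\pi}\ \max_{H_1\subseteq F,\ v(H_1)\ge 1} d^{r*}(H_1,\pi|_{H_1}),$$ where $\pi$ ranges over all orderings of $V(F)$. For $0\le\theta\le2$ let $\lambda_{r,\theta}(H,\pi):=0$ if $v(H)=0$, and otherwise $$\lambda_{r,\theta}(H,\pi):=1+\bigl(\lambda_{r,\theta}(H\setminus u_1,\pi|_{H\setminus u_1})-\theta\deg_H(u_1)\bigr)+(r-1)\min_{J\subseteq H,\ u_1\in J}\bigl(\lambda_{r,\theta}(J\setminus u_1,\pi|_{J\setminus u_1})-\theta\deg_J(u_1)\bigr),$$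 and let $\Lambda_{r,\theta}(F):=\max_{\pi}\min_{H\subseteq F,\ v(H)\ge1}\lambda_{r,\theta}(H,\pi|_H)$. **Theorem.** The vertex balanced Ramsey game and the vertex Achlioptas game with parameters $F$ and $r$ have the same threshold: a function $p_0(n)$ is a threshold of one game if and only if it is a threshold of the other. If moreover $F$ has at least one edge, then the equation $\Lambda_{r,\theta}(F)=0$ has a unique solution $\theta^*=\theta^*(F,r)$ in $[0,2]$, it satisfies $\theta^*>0$ and $m^{r*}(F)=1/\theta^*$, and $$p_0(n)=n^{-1/m^{r*}(F)}=n^{-\theta^*(F,r)}$$ is a threshold of both games. -/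

import Mathlib

open Filter Topology Asymptotics MeasureTheory

noncomputable section

namespace VertexGame

/-! ### The two vertex games

The board has `n = N * r` vertices, revealed in `N` rounds of `r` vertices each. The vertex set is
`Fin N × Fin r`: the pair `(i, j)` is the `j`-th of the `r` vertices revealed in round `i`. -/

/-- The set of vertices that have been revealed once round `i` has begun. -/
def revealed {N r : ℕ} (i : Fin N) : Set (Fin N × Fin r) := {v | v.1 ≤ i}

/-- A player strategy for `N` rounds with `r` vertices per round and set of moves `M`: in round `i`
the move depends on the graph induced by all vertices revealed so far. (The player's own earlier
moves are determined by the strategy and by this graph.) -/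
abbrev Strategy (N r : ℕ) (M : Type) : Type :=
  (i : Fin N) → SimpleGraph (revealed i : Set (Fin N × Fin r)) → M

/-- The move that the strategy `s` makes in round `i` if the hidden graph is `G`. -/
def move {N r : ℕ} {M : Type} (s : Strategy N r M) (G : SimpleGraph (Fin N × Fin r)) (i : Fin N) :
    M :=
  s i (G.induce (revealed i))

/-- The vertices selected in the vertex Achlioptas game: a move is the index of the one vertex of
the current `r` vertices that is kept. -/
def chosen {N r : ℕ} (s : Strategy N r (Fin r)) (G : SimpleGraph (Fin N × Fin r)) :
    Set (Fin N × Fin r) :=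
  {v | v.2 = move s G v.1}

/-- The player wins the vertex Achlioptas game on `G`: the graph induced by the selected vertices
contains no copy of `F`. -/
def AchlioptasWin {V : Type*} (F : SimpleGraph V) {N r : ℕ} (s : Strategy N r (Fin r))
    (G : SimpleGraph (Fin N × Fin r)) : Prop :=
  ¬ F.IsContained (G.induce (chosen s G))

/-- The vertices that get colour `c` in the vertex balanced Ramsey game: a move is a bijection from
the current `r` vertices to the `r` colours. -/
def colorClass {N r : ℕ} (s : Strategy N r (Equiv.Perm (Fin r))) (G : SimpleGraph (Fin N × Fin r))
    (c : Fin r) : Set (Fin N × Fin r) :=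
  {v | move s G v.1 v.2 = c}

/-- The player wins the vertex balanced Ramsey game on `G`: there is no monochromatic copy of `F`
in any of the `r` colours. -/
def RamseyWin {V : Type*} (F : SimpleGraph V) {N r : ℕ} (s : Strategy N r (Equiv.Perm (Fin r)))
    (G : SimpleGraph (Fin N × Fin r)) : Prop :=
  ∀ c : Fin r, ¬ F.IsContained (G.induce (colorClass s G c))

/-- `p₀` is a threshold function for a vertex game with `r` vertices per round, set of moves `M` and
winning condition `Win`, played on the binomial random graph `G(n, p)` with `n = N * r` and
`N → ∞`: if `p ≪ p₀` then some strategy wins a.a.s., and if `p ≫ p₀` then every strategy fails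
a.a.s. -/
def IsThreshold (r : ℕ) (M : Type)
    (Win : ∀ N : ℕ, Strategy N r M → SimpleGraph (Fin N × Fin r) → Prop) (p₀ : ℕ → ℝ) : Prop :=
  (∀ᶠ N : ℕ in atTop, 0 < p₀ (N * r)) ∧
  (∀ p : ℕ → unitInterval,
    (fun N : ℕ => (p (N * r) : ℝ)) =o[atTop] (fun N : ℕ => p₀ (N * r)) →
      ∃ s : ∀ N : ℕ, Strategy N r M,
        Tendsto (fun N : ℕ =>
          (SimpleGraph.binomialRandom (Fin N × Fin r) (p (N * r))).real {G | Win N (s N) G})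
          atTop (𝓝 1)) ∧
  (∀ p : ℕ → unitInterval,
    (fun N : ℕ => p₀ (N * r)) =o[atTop] (fun N : ℕ => (p (N * r) : ℝ)) →
      ∀ s : ∀ N : ℕ, Strategy N r M,
        Tendsto (fun N : ℕ =>
          (SimpleGraph.binomialRandom (Fin N × Fin r) (p (N * r))).real {G | ¬ Win N (s N) G})
          atTop (𝓝 1))

/-- `p₀` is a threshold function for the vertex Achlioptas game with parameters `F` and `r`. -/
def IsAchlioptasThreshold {V : Type*} (F : SimpleGraph V) (r : ℕ) (p₀ : ℕ → ℝ) : Prop :=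
  IsThreshold r (Fin r) (fun _ s G => AchlioptasWin F s G) p₀

/-- `p₀` is a threshold function for the vertex balanced Ramsey game with parameters `F`
and `r`. -/
def IsRamseyThreshold {V : Type*} (F : SimpleGraph V) (r : ℕ) (p₀ : ℕ → ℝ) : Prop :=
  IsThreshold r (Equiv.Perm (Fin r)) (fun _ s G => RamseyWin F s G) p₀

/-! ### Ordered graphs and the two threshold exponents

An ordering of the vertices of `F` is a bijection `π : V ≃ Fin (Fintype.card V)`; the vertex with
the smallest value is the youngest one. The induced ordering on a subgraph is given by comparing
values of `π`. All minima and maxima below range over finite nonempty sets, so that `⨅` and `⨆`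
of real numbers are minima and maxima. -/

variable {V : Type*} [Fintype V] {F : SimpleGraph V}

/-- `u` is the youngest vertex `u₁` of the ordered graph `(H, π|_H)`. -/
def IsYoungest (π : V ≃ Fin (Fintype.card V)) (H : F.Subgraph) (u : V) : Prop :=
  u ∈ H.verts ∧ ∀ w ∈ H.verts, π u ≤ π w

theorem exists_isYoungest (π : V ≃ Fin (Fintype.card V)) (H : F.Subgraph)
    (h : H.verts.Nonempty) : ∃ u, IsYoungest π H u := by
  obtain ⟨u, hu, hmin⟩ := Set.exists_min_image H.verts π H.verts.toFinite h
  exact ⟨u, hu, hmin⟩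

/-- The youngest vertex `u₁` of a nonempty ordered graph `(H, π|_H)`. -/
def youngest (π : V ≃ Fin (Fintype.card V)) (H : F.Subgraph) (h : H.verts.Nonempty) : V :=
  (exists_isYoungest π H h).choose

theorem youngest_mem (π : V ≃ Fin (Fintype.card V)) (H : F.Subgraph) (h : H.verts.Nonempty) :
    youngest π H h ∈ H.verts :=
  (exists_isYoungest π H h).choose_spec.1

theorem ncard_deleteVerts_lt {H J : F.Subgraph} {u : V} (hJ : J ≤ H) (hu : u ∈ J.verts) :
    (J.deleteVerts {u}).verts.ncard < H.verts.ncard := by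
  have h1 : (J.deleteVerts {u}).verts.ncard < J.verts.ncard := by
    rw [SimpleGraph.Subgraph.deleteVerts_verts]
    exact Set.ncard_sdiff_singleton_lt_of_mem hu J.verts.toFinite
  exact h1.trans_le (Set.ncard_le_ncard hJ.1 H.verts.toFinite)

open Classical in
/-- The quantity `λ_{r,θ}(H, π|_H)`: it is `0` if `H` has no vertices, and otherwise
`1 + (λ(H ∖ u₁) - θ deg_H(u₁)) + (r - 1) min_J (λ(J ∖ u₁) - θ deg_J(u₁))`, where `u₁` is the
youngest vertex of `H` and the minimum is over all subgraphs `J ⊆ H` that contain `u₁`. -/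
def lam (r : ℕ) (θ : ℝ) (π : V ≃ Fin (Fintype.card V)) (H : F.Subgraph) : ℝ :=
  if h : H.verts.Nonempty then
    1 + (lam r θ π (H.deleteVerts {youngest π H h})
          - θ * ((H.neighborSet (youngest π H h)).ncard : ℝ))
      + ((r : ℝ) - 1) * ⨅ J : {J : F.Subgraph // J ≤ H ∧ youngest π H h ∈ J.verts},
          (lam r θ π (J.1.deleteVerts {youngest π H h})
            - θ * ((J.1.neighborSet (youngest π H h)).ncard : ℝ))
  else 0
termination_by H.verts.ncard
decreasing_by
  · exact ncard_deleteVerts_lt le_rfl (youngest_mem π H h)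
  · exact ncard_deleteVerts_lt J.2.1 J.2.2

/-- `Λ_{r,θ}(F) = max_π min_H λ_{r,θ}(H, π|_H)`, with `H` ranging over the subgraphs of `F` that
have at least one vertex. -/
def Lam (F : SimpleGraph V) (r : ℕ) (θ : ℝ) : ℝ :=
  ⨆ π : V ≃ Fin (Fintype.card V), ⨅ H : {H : F.Subgraph // H.verts.Nonempty}, lam r θ π H.1

/-- A sequence of subgraphs `H₁, H₂, …, H_h` as in the definition of `d^{r*}(H₁, π|_{H₁})`,
indexed by the vertices `u₁, …, u_h` of `H₁` (from youngest to oldest): `K u_i` is `H_i`. Thus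
`K u₁ = H₁`, `H_i ⊆ H₁ ∖ {u₁, …, u_{i-1}}` and `u_i ∈ H_i`. Values of `K` at vertices outside
`H₁` are irrelevant. -/
def Admissible (π : V ≃ Fin (Fintype.card V)) (H₁ : F.Subgraph) (K : V → F.Subgraph) : Prop :=
  (∀ u, IsYoungest π H₁ u → K u = H₁) ∧
  ∀ u ∈ H₁.verts, K u ≤ H₁.deleteVerts {w | π w < π u} ∧ u ∈ (K u).verts

open Classical in
/-- The coefficients `c_i` (indexed by the vertex `u = u_i` of `H₁`): `c₁ = r` and
`c_i = (r - 1) ∑_{j < i} c_j 1[u_i ∈ H_j]` for `i ≥ 2`. -/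
def coeff (r : ℕ) (π : V ≃ Fin (Fintype.card V)) (H₁ : F.Subgraph) (K : V → F.Subgraph) (u : V) :
    ℝ :=
  if IsYoungest π H₁ u then (r : ℝ)
  else ((r : ℝ) - 1) * ∑ w : {w : V // w ∈ H₁.verts ∧ π w < π u},
    coeff r π H₁ K w.1 * (if u ∈ (K w.1).verts then 1 else 0)
termination_by π u
decreasing_by exact w.2.2

open Classical in
/-- `d^{r*}(H₁, π|_{H₁})`, the maximum over all admissible sequences of
`(∑ c_i e(H_i)) / (1 + ∑ c_i (v(H_i) - 1))`. -/
def dStar (r : ℕ) (π : V ≃ Fin (Fintype.card V)) (H₁ : F.Subgraph) : ℝ :=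
  ⨆ K : {K : V → F.Subgraph // Admissible π H₁ K},
    (∑ u : H₁.verts, coeff r π H₁ K.1 u.1 * ((K.1 u.1).edgeSet.ncard : ℝ)) /
      (1 + ∑ u : H₁.verts, coeff r π H₁ K.1 u.1 * (((K.1 u.1).verts.ncard : ℝ) - 1))

/-- `m^{r*}(F) = min_π max_{H₁ ⊆ F} d^{r*}(H₁, π|_{H₁})`, with `H₁` ranging over the subgraphs
of `F` that have at least one vertex. -/
def mStar (F : SimpleGraph V) (r : ℕ) : ℝ :=
  ⨅ π : V ≃ Fin (Fintype.card V), ⨆ H₁ : {H : F.Subgraph // H.verts.Nonempty}, dStar r π H₁.1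

end VertexGame

end

/-! Both games are governed by one function on vertex sets. Fix an ordering `π` of the vertices of
`F`. Going from old to young, give every vertex `u` the weight
`1 + (r - 1) * min_J (cost J - θ * deg_J u)`, where `J` ranges over the sets of vertices older than
`u` and `cost X` is the total weight of `X` minus `θ` times the number of edges inside `X`. For
`p = n ^ (-θ)`, `cost X` is the exponent of the number of copies of `X` in the selected graph when
every round of the copy is blocked: each of the other `r - 1` vertices of the round completes the
rarest structure that may be attached to it. The player loses for some `π` if all costs are
nonnegative, and wins if every `π` has a nonempty set of cost at most `0`.

*Exponents.* In `lam` the inner minima are over the subgraphs of `H`, in `cost` over all older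
vertices, so `cost ≤ lam` (`cost_le_lam`). The cost function is submodular (`cost_submodular`), and
this forces the inner minima to be attained inside a set of minimum cost (`IsClosedAt`). Hence
`min_H lam H = min_X cost X` (`iInf_lam_eq_minCost`). For `mStar` the recursion that defines `coeff`
is dual to the recursion for the weights (`sum_coeff_mul`): the denominator minus `θ` times the
numerator of `dStar` is at least `1 + r * minThreat u₁`, with equality if all `H_i` are minimisers,
and `1 + r * minThreat u₁` is the least cost of a set with youngest vertex `u₁`. So the sign of the
minimum cost decides whether `dStar` exceeds `1 / θ`. The cost of a nonempty set is continuous in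
`θ`, and where it is not positive it decreases strictly (`cost_lt_cost`). At `θ = 0` it is positive,
and at `θ = 2` every ordering has a set of negative cost if `F` has an edge. This gives the unique
root `θ` of `Lam` in `[0, 2]`, which is positive, and `mStar = 1 / θ` (`exists_Lam_eq_zero`,
`mStar_eq`).

*Above the threshold.* Take `π` without sets of negative cost, and consider the complete `r`-ary
tree of rounds in which each of the `r` vertices of a round is joined to the partial copy that was
forced in the corresponding subtree, so that the choice made at the root decides which of the
partial copies is extended. Which pairs have to be edges depends on the strategy, but only through
the past, and their number does not; hence each placement of the tree is present with the same
probability whatever the strategy (`real_inter_forced`). Nonnegative costs imply that all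
substructures have nonnegative exponent (`cost_centreIn_le`), so the second moment method bounds the
probability of a copy from below by a constant (`real_le_mul_real_inter_forced`). Applying this in
many disjoint intervals of rounds makes every strategy for the Achlioptas game fail with probability
tending to one (`tendsto_not_achlioptasWin`). A Ramsey strategy contains an Achlioptas strategy for
each colour, so it fails as well.

*Below the threshold.* It suffices to win the Ramsey game. For a constant `θ'` slightly smaller
than `θ`, the danger of a colour for a vertex is the exponent of the rarest bounded structure in the
past to which this vertex is joined in this colour. In each round the player picks an assignment
of colours in which no exchange of two colours improves matters (`exists_perm_swap`). If a
monochromatic copy of `F` appears, then every other vertex of each of its rounds accounts for a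
vertex-colour pair that is as dangerous as the one in the copy, and submodularity turns the union
of these structures into a bounded set of rounds of exponent at most the cost of a set for the
ordering `π` in which the copy was created (`exists_witness`). As some cost is at most `0`,
this contradicts the absence of bounded structures of nonpositive exponent, which holds with
probability tending to one (`tendsto_sparse`).

*Equality of all thresholds.* A threshold of a game that tends to zero determines all of its
thresholds up to constant factors (`IsThreshold.iff`), so the two games, which share the threshold
`n ^ (-θ)`, share all of them. If `F` has no edges, then the player always loses and neither game
has a threshold. -/

noncomputable section

namespace VertexGame

open scoped Classical

/-! ### Edge probabilities in the binomial random graph -/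

section EdgeProbability

variable {W : Type*} [Finite W]

instance : MeasurableSingletonClass (SimpleGraph W) where
  measurableSet_singleton G := by
    have h : ({G} : Set (SimpleGraph W)) =
        ⋂ x : W, ⋂ y : W, {G' | G'.Adj x y ↔ G.Adj x y} := by
      ext G'
      simp only [Set.mem_singleton_iff, Set.mem_iInter, Set.mem_ofPred_eq, SimpleGraph.ext_iff,
        funext_iff, eq_iff_iff]
    rw [h]
    refine MeasurableSet.iInter fun x => MeasurableSet.iInter fun y => ?_
    have hm : Measurable fun G' : SimpleGraph W => G'.Adj x y :=
      SimpleGraph.measurable_iff_adj.1 measurable_id x y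
    exact measurableSet_setOfPred.2 (hm.iff measurable_const)

/-- Resampling a single edge: an event that does not depend on the edge `xy` is independent of the
presence of that edge. -/
theorem real_inter_adj (p : unitInterval) {x y : W} (hxy : x ≠ y) (Q : Set (SimpleGraph W))
    (hQ : ∀ G : SimpleGraph W, ¬ G.Adj x y → (G ∈ Q ↔ G ⊔ SimpleGraph.edge x y ∈ Q)) :
    (SimpleGraph.binomialRandom W p).real (Q ∩ {G | G.Adj x y}) =
      p * (SimpleGraph.binomialRandom W p).real Q := by
  have := Fintype.ofFinite W
  set μ := SimpleGraph.binomialRandom W p with hμ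
  have hfin : ∀ A : Set (SimpleGraph W), μ.real A = ∑ G ∈ A.toFinite.toFinset, μ.real {G} := by
    intro A
    rw [sum_measureReal_singleton, Set.Finite.coe_toFinset]
  have hsingle : ∀ G : SimpleGraph W, ¬ G.Adj x y →
      (1 - (p : ℝ)) * μ.real {G ⊔ SimpleGraph.edge x y} = p * μ.real {G} := by
    intro G hG
    have hcard : (G ⊔ SimpleGraph.edge x y).edgeSet.ncard = G.edgeSet.ncard + 1 := by
      rw [SimpleGraph.edgeSet_sup, SimpleGraph.edgeSet_edge_of_ne hxy, Set.union_comm,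
        Set.singleton_union, Set.ncard_insert_of_notMem (by simpa using hG) (Set.toFinite _)]
    have hle : G.edgeSet.ncard + 1 ≤ (Nat.card W).choose 2 := by
      rw [← hcard]
      rw [← SimpleGraph.coe_edgeFinset, Set.ncard_coe_finset, Nat.card_eq_fintype_card]
      exact SimpleGraph.card_edgeFinset_le_card_choose_two
    simp only [hμ, measureReal_def, SimpleGraph.binomialRandom_singleton, hcard]
    obtain ⟨d, hd⟩ := Nat.exists_eq_add_of_le hle
    have h1 : (Nat.card W).choose 2 - (G.edgeSet.ncard + 1) = d := by omega
    have h2 : (Nat.card W).choose 2 - G.edgeSet.ncard = d + 1 := by omega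
    rw [h1, h2]
    simp [pow_succ]
    ring
  have hbij : ∑ G ∈ (Q ∩ {G | G.Adj x y}).toFinite.toFinset, μ.real {G} =
      ∑ G ∈ (Q ∩ {G | ¬ G.Adj x y}).toFinite.toFinset, μ.real {G ⊔ SimpleGraph.edge x y} := by
    symm
    refine Finset.sum_bij' (fun G _ => G ⊔ SimpleGraph.edge x y)
      (fun G _ => G.deleteEdges {s(x, y)}) ?_ ?_ ?_ ?_ ?_
    · intro G hG
      simp only [Set.Finite.mem_toFinset, Set.mem_inter_iff, Set.mem_ofPred_eq] at hG ⊢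
      exact ⟨(hQ G hG.2).1 hG.1, Or.inr (by simp [SimpleGraph.edge_adj, hxy])⟩
    · intro G hG
      simp only [Set.Finite.mem_toFinset, Set.mem_inter_iff, Set.mem_ofPred_eq] at hG ⊢
      have hn : ¬ (G.deleteEdges {s(x, y)}).Adj x y := by simp
      refine ⟨(hQ _ hn).2 ?_, hn⟩
      convert hG.1
      ext a b
      simp only [SimpleGraph.sup_adj, SimpleGraph.deleteEdges_adj, Set.mem_singleton_iff,
        SimpleGraph.edge_adj, Sym2.eq_iff]
      have := hG.2
      have := hG.2.symm
      grind
    · intro G hG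
      simp only [Set.Finite.mem_toFinset, Set.mem_inter_iff, Set.mem_ofPred_eq] at hG
      ext a b
      simp only [SimpleGraph.sup_adj, SimpleGraph.deleteEdges_adj, Set.mem_singleton_iff,
        SimpleGraph.edge_adj, Sym2.eq_iff]
      have := hG.2
      have h3 : ¬ G.Adj y x := fun h => hG.2 h.symm
      grind
    · intro G hG
      simp only [Set.Finite.mem_toFinset, Set.mem_inter_iff, Set.mem_ofPred_eq] at hG
      ext a b
      simp only [SimpleGraph.sup_adj, SimpleGraph.deleteEdges_adj, Set.mem_singleton_iff,
        SimpleGraph.edge_adj, Sym2.eq_iff]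
      have := hG.2
      have := hG.2.symm
      grind
    · intro G hG
      rfl
  have hsplit : μ.real Q = μ.real (Q ∩ {G | G.Adj x y}) + μ.real (Q ∩ {G | ¬ G.Adj x y}) := by
    have := measureReal_inter_add_sdiff (μ := μ) (s := Q)
      (Set.toFinite {G : SimpleGraph W | G.Adj x y}).measurableSet
    rw [← this]
    rfl
  have key : (1 - (p : ℝ)) * μ.real (Q ∩ {G | G.Adj x y}) =
      p * μ.real (Q ∩ {G | ¬ G.Adj x y}) := by
    rw [hfin (Q ∩ {G | G.Adj x y}), hfin (Q ∩ {G | ¬ G.Adj x y}), hbij, Finset.mul_sum,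
      Finset.mul_sum]
    refine Finset.sum_congr rfl fun G hG => hsingle G ?_
    simp only [Set.Finite.mem_toFinset, Set.mem_inter_iff, Set.mem_ofPred_eq] at hG
    exact hG.2
  rw [hsplit]
  linarith

end EdgeProbability

section Board

variable {N r : ℕ}

/-- The event `Q` is determined by the graph induced by the vertices of the rounds before `T`. -/
def DependsBelow (T : ℕ) (Q : Set (SimpleGraph (Fin N × Fin r))) : Prop :=
  ∀ G G' : SimpleGraph (Fin N × Fin r),
    (∀ x y : Fin N × Fin r, x.1.val < T → y.1.val < T → (G.Adj x y ↔ G'.Adj x y)) →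
      (G ∈ Q ↔ G' ∈ Q)

/-- All pairs in `D` are edges. -/
def present (D : Finset ((Fin N × Fin r) × (Fin N × Fin r))) :
    Set (SimpleGraph (Fin N × Fin r)) :=
  {G | ∀ e ∈ D, G.Adj e.1 e.2}

theorem DependsBelow.mono {T T' : ℕ} {Q : Set (SimpleGraph (Fin N × Fin r))}
    (h : DependsBelow T Q) (hT : T ≤ T') : DependsBelow T' Q :=
  fun G G' hG => h G G' fun x y hx hy => hG x y (hx.trans_le hT) (hy.trans_le hT)

theorem DependsBelow.inter {T : ℕ} {Q Q' : Set (SimpleGraph (Fin N × Fin r))}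
    (h : DependsBelow T Q) (h' : DependsBelow T Q') : DependsBelow T (Q ∩ Q') :=
  fun G G' hG => and_congr (h G G' hG) (h' G G' hG)

/-- Edges with a later endpoint outside the rounds before `T` are independent of the events that
are determined by these rounds. -/
theorem real_inter_present (p : unitInterval) {T : ℕ} {Q : Set (SimpleGraph (Fin N × Fin r))}
    (hQ : DependsBelow T Q) (D : Finset ((Fin N × Fin r) × (Fin N × Fin r)))
    (hD : ∀ e ∈ D, T ≤ e.1.1.val ∧ e.2.1 < e.1.1) :
    (SimpleGraph.binomialRandom (Fin N × Fin r) p).real (Q ∩ present D) =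
      (p : ℝ) ^ D.card * (SimpleGraph.binomialRandom (Fin N × Fin r) p).real Q := by
  induction D using Finset.induction_on with
  | empty => simp [present]
  | insert e D he ih =>
    have hne : e.1 ≠ e.2 := by
      intro h
      have := (hD e (Finset.mem_insert_self _ _)).2
      rw [h] at this
      exact lt_irrefl _ this
    have hset : Q ∩ present (insert e D) = (Q ∩ present D) ∩ {G | G.Adj e.1 e.2} := by
      ext G
      simp only [present, Set.mem_inter_iff, Set.mem_ofPred_eq, Finset.mem_insert,
        forall_eq_or_imp]
      tauto
    have he' := hD e (Finset.mem_insert_self _ _)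
    rw [hset, real_inter_adj p hne, ih fun e' h' => hD e' (Finset.mem_insert_of_mem h'),
      Finset.card_insert_of_notMem he, pow_succ]
    · ring
    · intro G hG
      refine and_congr (hQ _ _ ?_) (forall₂_congr ?_)
      · intro x y hx hy
        simp only [SimpleGraph.sup_adj, SimpleGraph.edge_adj]
        have h1 : ¬ (e.1 = x ∧ e.2 = y ∨ e.1 = y ∧ e.2 = x) := by
          rintro (⟨rfl, rfl⟩ | ⟨rfl, rfl⟩) <;> omega
        grind
      · intro e' h'
        have h2 := hD e' (Finset.mem_insert_of_mem h')
        simp only [SimpleGraph.sup_adj, SimpleGraph.edge_adj]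
        have h1 : ¬ (e.1 = e'.1 ∧ e.2 = e'.2 ∨ e.1 = e'.2 ∧ e.2 = e'.1) := by
          rintro (⟨h3, h4⟩ | ⟨h3, h4⟩)
          · exact he (by rwa [Prod.ext h3 h4])
          · rw [h3, h4] at he'
            exact absurd he'.2 (not_lt.2 h2.2.le)
        grind

/-- Edges that are queried adaptively: if the set `D i G` of pairs that is queried in round `i`
only depends on the graph of the earlier rounds, and has a fixed size `k i`, then all queried pairs
are edges with probability `∏ p ^ k i`. -/
theorem real_inter_adaptive (p : unitInterval) {T : ℕ} {Q : Set (SimpleGraph (Fin N × Fin r))}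
    (hQ : DependsBelow T Q)
    (D : Fin N → SimpleGraph (Fin N × Fin r) → Finset ((Fin N × Fin r) × (Fin N × Fin r)))
    (k : Fin N → ℕ) (hk : ∀ i G, (D i G).card = k i)
    (hD : ∀ i G, ∀ e ∈ D i G, e.1.1 = i ∧ e.2.1 < i)
    (hdep : ∀ i S, DependsBelow i.val {G | D i G = S})
    (hT : ∀ i, i.val < T → k i = 0) :
    (SimpleGraph.binomialRandom (Fin N × Fin r) p).real (Q ∩ {G | ∀ i, G ∈ present (D i G)}) =
      (p : ℝ) ^ (∑ i, k i) * (SimpleGraph.binomialRandom (Fin N × Fin r) p).real Q := by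
  set μ := SimpleGraph.binomialRandom (Fin N × Fin r) p
  have hempty : ∀ i G, i.val < T → D i G = ∅ := fun i G hi => by
    rw [← Finset.card_eq_zero, hk, hT i hi]
  have key : ∀ T' ≤ N, T ≤ T' →
      μ.real (Q ∩ {G | ∀ i : Fin N, i.val < T' → G ∈ present (D i G)}) =
      (p : ℝ) ^ (∑ i with i.val < T', k i) * μ.real Q := by
    intro T' hN hTT'
    induction T', hTT' using Nat.le_induction with
    | base =>
      have h1 : {G | ∀ i : Fin N, i.val < T → G ∈ present (D i G)} = Set.univ := by
        ext G
        simp only [Set.mem_ofPred_eq, Set.mem_univ, iff_true]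
        intro i hi
        simp [present, hempty i G hi]
      have h2 : ∑ i with i.val < T, k i = 0 :=
        Finset.sum_eq_zero fun i hi => hT i (by simpa using hi)
      rw [h1, h2]
      simp
    | succ T' hTT' ih =>
      set i₀ : Fin N := ⟨T', hN⟩
      set R := Q ∩ {G | ∀ i : Fin N, i.val < T' → G ∈ present (D i G)} with hR
      have hRdep : DependsBelow T' R := by
        refine (hQ.mono hTT').inter fun G G' hG => ?_
        refine forall₂_congr fun i hi => ?_
        have h1 : D i G = D i G' := by
          have := (hdep i (D i G')) G G' fun x y hx hy => hG x y (hx.trans hi) (hy.trans hi)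
          exact this.2 rfl
        rw [h1]
        refine forall₂_congr fun e he => ?_
        have := hD i G' e he
        exact hG _ _ (by rw [this.1]; exact hi) (lt_trans this.2 hi)
      have hset : Q ∩ {G | ∀ i : Fin N, i.val < T' + 1 → G ∈ present (D i G)} =
          ⋃ S ∈ (Finset.univ : Finset (Finset ((Fin N × Fin r) × (Fin N × Fin r)))),
            (R ∩ {G | D i₀ G = S}) ∩ present S := by
        ext G
        simp only [hR, Set.mem_inter_iff, Set.mem_ofPred_eq, Set.mem_iUnion, Finset.mem_univ,
          exists_prop, true_and]
        constructor
        · rintro ⟨h1, h2⟩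
          exact ⟨D i₀ G, ⟨⟨h1, fun i hi => h2 i (by omega)⟩, rfl⟩, h2 i₀ (by simp [i₀])⟩
        · rintro ⟨S, ⟨⟨h1, h2⟩, h3⟩, h4⟩
          refine ⟨h1, fun i hi => ?_⟩
          rcases Nat.lt_succ_iff_lt_or_eq.1 hi with h | h
          · exact h2 i h
          · have : i = i₀ := Fin.ext h
            rw [this, h3]
            exact h4
      have hset' : R = ⋃ S ∈ (Finset.univ : Finset (Finset ((Fin N × Fin r) × (Fin N × Fin r)))),
            (R ∩ {G | D i₀ G = S}) := by
        ext G
        simp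
      have hsum : ∑ i with i.val < T' + 1, k i = ∑ i with i.val < T', k i + k i₀ := by
        have : (Finset.univ.filter fun i : Fin N => i.val < T' + 1) =
            insert i₀ (Finset.univ.filter fun i : Fin N => i.val < T') := by
          ext i
          simp only [Finset.mem_filter, Finset.mem_univ, true_and, Finset.mem_insert, Fin.ext_iff,
            i₀]
          omega
        rw [this, Finset.sum_insert (by simp [i₀]), add_comm]
      have hmeas : ∀ A : Set (SimpleGraph (Fin N × Fin r)), MeasurableSet A :=
        fun A => A.toFinite.measurableSet
      rw [hset, measureReal_biUnion_finset _ (fun _ _ => hmeas _), hsum, pow_add, mul_right_comm,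
        ← ih (by omega)]
      · conv_rhs => rw [hset', measureReal_biUnion_finset
          (fun S _ S' _ hS => Set.disjoint_left.2 fun G h1 h2 => hS (h1.2.symm.trans h2.2))
          (fun _ _ => hmeas _)]
        rw [Finset.sum_mul]
        refine Finset.sum_congr rfl fun S _ => ?_
        by_cases hS : ∃ G, D i₀ G = S
        · obtain ⟨G₀, hG₀⟩ := hS
          rw [real_inter_present p (hRdep.inter (hdep i₀ S)), ← hG₀, hk, mul_comm]
          intro e he
          rw [← hG₀] at he
          have := hD i₀ G₀ e he
          rw [this.1]
          exact ⟨le_rfl, this.2⟩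
        · have h1 : {G | D i₀ G = S} = ∅ := by
            ext G
            simp only [Set.mem_ofPred_eq, Set.mem_empty_iff_false, iff_false]
            exact fun h => hS ⟨G, h⟩
          simp [h1]
      · exact fun S _ S' _ hS => Set.disjoint_left.2 fun G h1 h2 =>
          hS (h1.1.2.symm.trans h2.1.2)
  rcases le_or_gt T N with hTN | hTN
  · have := key N le_rfl hTN
    simpa using this
  · have h1 : {G | ∀ i : Fin N, G ∈ present (D i G)} = Set.univ := by
      ext G
      simp only [Set.mem_ofPred_eq, Set.mem_univ, iff_true]
      intro i
      simp [present, hempty i G (by omega)]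
    have h2 : ∑ i, k i = 0 := Finset.sum_eq_zero fun i _ => hT i (by omega)
    rw [h1, h2]
    simp

end Board

/-! ### Vertex weights and the cost function -/

section Cost

variable {V : Type*} (F : SimpleGraph V)

/-- The number of neighbours of `u` in `X`. -/
def degIn (u : V) (X : Finset V) : ℕ := (X.filter (F.Adj u)).card

@[simp] theorem degIn_empty (u : V) : degIn F u ∅ = 0 := by simp [degIn]

theorem degIn_mono (u : V) {X Y : Finset V} (h : X ⊆ Y) : degIn F u X ≤ degIn F u Y :=
  Finset.card_le_card (Finset.filter_subset_filter _ h)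

variable [Fintype V] (r : ℕ) (θ : ℝ)
  (π : V ≃ Fin (Fintype.card V))

/-- The vertices that are older than `u`, i.e. that come after `u` in the ordering `π`. -/
def older (u : V) : Finset V := Finset.univ.filter fun w => π u < π w

@[simp] theorem mem_older {u w : V} : w ∈ older π u ↔ π u < π w := by simp [older]

theorem notMem_of_subset_older {u : V} {J : Finset V} (hJ : J ⊆ older π u) : u ∉ J :=
  fun h => lt_irrefl _ ((mem_older π).1 (hJ h))

/-- The edges of `F` inside `X`, each directed from its younger to its older endpoint. -/
def innerEdges (X : Finset V) : Finset (V × V) :=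
  (X ×ˢ X).filter fun e => F.Adj e.1 e.2 ∧ π e.1 < π e.2

/-- The weight of a vertex `u`: with `p = n ^ (-θ)`, the exponent of the number of rounds in which
all vertices except one complete the rarest structure that may be attached to `u`. The minimum is
over all sets `J` of vertices older than `u`. -/
def weight (u : V) : ℝ :=
  1 + ((r : ℝ) - 1) * ⨅ J : {J : Finset V // J ⊆ older π u},
    (∑ w : J.1, weight w.1 - θ * ((innerEdges F π J.1).card : ℝ) - θ * (degIn F u J.1 : ℝ))
termination_by Fintype.card V - (π u).val
decreasing_by
  exact Nat.sub_lt_sub_left (π u).isLt ((mem_older π).1 (J.2 w.2))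

/-- The exponent of the vertex set `X`: the sum of the weights of its vertices minus `θ` times the
number of edges inside `X`. In contrast to `lam`, all minima that enter its definition are over all
older vertices and not only over those in `X`. -/
def cost (X : Finset V) : ℝ :=
  ∑ u ∈ X, weight F r θ π u - θ * ((innerEdges F π X).card : ℝ)

/-- The exponent of the expected number of copies of `J` that are joined to a new vertex in the
role of `u`. -/
def threat (u : V) (J : Finset V) : ℝ := cost F r θ π J - θ * (degIn F u J : ℝ)

/-- The exponent of the rarest structure that may be attached to a vertex in the role of `u`. -/
def minThreat (u : V) : ℝ :=
  (older π u).powerset.inf' (Finset.powerset_nonempty _) (threat F r θ π u)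

theorem weight_eq (u : V) : weight F r θ π u = 1 + ((r : ℝ) - 1) * minThreat F r θ π u := by
  rw [weight, minThreat, Finset.inf'_eq_csInf_image]
  congr 2
  rw [iInf]
  congr 1
  ext x
  simp only [Set.mem_range, Subtype.exists, threat, cost, Set.mem_image, Finset.coe_powerset,
    Set.mem_preimage, Set.mem_powerset_iff, Finset.coe_subset]
  simp only [Finset.univ_eq_attach, exists_prop]
  refine exists_congr fun J => and_congr Iff.rfl ?_
  rw [Finset.sum_attach J (fun w => weight F r θ π w)]

theorem minThreat_le {u : V} {J : Finset V} (hJ : J ⊆ older π u) :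
    minThreat F r θ π u ≤ threat F r θ π u J :=
  Finset.inf'_le _ (Finset.mem_powerset.2 hJ)

theorem exists_minThreat (u : V) :
    ∃ J ⊆ older π u, threat F r θ π u J = minThreat F r θ π u := by
  obtain ⟨J, hJ, h⟩ := Finset.exists_mem_eq_inf' (s := (older π u).powerset)
    (Finset.powerset_nonempty _) (threat F r θ π u)
  exact ⟨J, Finset.mem_powerset.1 hJ, h.symm⟩

@[simp] theorem cost_empty : cost F r θ π ∅ = 0 := by simp [cost, innerEdges]

theorem minThreat_nonpos (u : V) : minThreat F r θ π u ≤ 0 := by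
  simpa [threat] using minThreat_le F r θ π (Finset.empty_subset (older π u))

theorem weight_le_one (hr : 1 ≤ r) (u : V) : weight F r θ π u ≤ 1 := by
  rw [weight_eq]
  have h1 : (1 : ℝ) ≤ r := by exact_mod_cast hr
  nlinarith [minThreat_nonpos F r θ π u]

theorem card_innerEdges_insert {u : V} {J : Finset V} (hJ : J ⊆ older π u) :
    (innerEdges F π (insert u J)).card = (innerEdges F π J).card + degIn F u J := by
  have h : innerEdges F π (insert u J) =
      innerEdges F π J ∪ (J.filter (F.Adj u)).image fun w => (u, w) := by
    ext ⟨x, y⟩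
    simp only [innerEdges, Finset.mem_filter, Finset.mem_product, Finset.mem_insert,
      Finset.mem_union, Finset.mem_image, Prod.mk.injEq]
    constructor
    · rintro ⟨⟨hx, hy⟩, hadj, hlt⟩
      rcases hx with rfl | hx
      · rcases hy with rfl | hy
        · exact absurd hlt (lt_irrefl _)
        · exact Or.inr ⟨y, ⟨hy, hadj⟩, rfl, rfl⟩
      · rcases hy with rfl | hy
        · exact absurd (hlt.trans ((mem_older π).1 (hJ hx))) (lt_irrefl _)
        · exact Or.inl ⟨⟨hx, hy⟩, hadj, hlt⟩
    · rintro (⟨⟨hx, hy⟩, hadj, hlt⟩ | ⟨w, ⟨hw, hadj⟩, rfl, rfl⟩)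
      · exact ⟨⟨Or.inr hx, Or.inr hy⟩, hadj, hlt⟩
      · exact ⟨⟨Or.inl rfl, Or.inr hw⟩, hadj, (mem_older π).1 (hJ hw)⟩
  rw [h, Finset.card_union_of_disjoint, Finset.card_image_of_injective _
    (Prod.mk_right_injective u), degIn]
  rw [Finset.disjoint_left]
  rintro ⟨x, y⟩ h1 h2
  simp only [innerEdges, Finset.mem_filter, Finset.mem_product, Finset.mem_image,
    Prod.mk.injEq] at h1 h2
  obtain ⟨w, _, rfl, _⟩ := h2
  exact notMem_of_subset_older π hJ h1.1.1

theorem cost_insert {u : V} {J : Finset V} (hJ : J ⊆ older π u) :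
    cost F r θ π (insert u J) = weight F r θ π u + threat F r θ π u J := by
  rw [threat, cost, cost, card_innerEdges_insert F π hJ,
    Finset.sum_insert (notMem_of_subset_older π hJ)]
  push_cast
  ring

/-- The cost function is submodular. -/
theorem cost_submodular (hθ : 0 ≤ θ) (X Y : Finset V) :
    cost F r θ π (X ∩ Y) + cost F r θ π (X ∪ Y) ≤ cost F r θ π X + cost F r θ π Y := by
  have h1 := Finset.sum_union_inter (s₁ := X) (s₂ := Y) (f := weight F r θ π)
  have h2 : (innerEdges F π X).card + (innerEdges F π Y).card ≤
      (innerEdges F π (X ∪ Y)).card + (innerEdges F π (X ∩ Y)).card := by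
    rw [← Finset.card_union_add_card_inter]
    refine Nat.add_le_add (Finset.card_le_card ?_) (Finset.card_le_card ?_)
    · intro e
      simp only [innerEdges, Finset.mem_filter, Finset.mem_product, Finset.mem_union]
      tauto
    · intro e
      simp only [innerEdges, Finset.mem_filter, Finset.mem_product, Finset.mem_inter]
      tauto
  have h3 : ((innerEdges F π X).card : ℝ) + (innerEdges F π Y).card ≤
      (innerEdges F π (X ∪ Y)).card + (innerEdges F π (X ∩ Y)).card := by exact_mod_cast h2
  simp only [cost]
  nlinarith

/-- `X` consists of `u` and older vertices, contains `u`, and adding further vertices that are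
older than `u` does not decrease its cost. -/
structure IsClosedAt (u : V) (X : Finset V) : Prop where
  mem : u ∈ X
  le : ∀ w ∈ X, π u ≤ π w
  cost_le : ∀ Y, X ⊆ Y → (∀ w ∈ Y, π u ≤ π w) → cost F r θ π X ≤ cost F r θ π Y

variable {F r θ π}

/-- If `X` is closed, then the minimum that defines `minThreat` at a vertex of `X` is attained
inside `X`: by submodularity, a minimiser may be intersected with `X`. -/
theorem IsClosedAt.exists_subset {u : V} {X : Finset V} (hX : IsClosedAt F r θ π u X)
    (hθ : 0 ≤ θ) {w : V} (hw : w ∈ X) :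
    ∃ J ⊆ older π w, J ⊆ X ∧ threat F r θ π w J = minThreat F r θ π w := by
  obtain ⟨J, hJ, hmin⟩ := exists_minThreat F r θ π w
  have hJX : J ∩ X ⊆ older π w := Finset.inter_subset_left.trans hJ
  refine ⟨J ∩ X, hJX, Finset.inter_subset_right, le_antisymm ?_ (minThreat_le F r θ π hJX)⟩
  rw [← hmin]
  have h1 := cost_submodular F r θ π hθ (insert w J) X
  have h2 : insert w J ∩ X = insert w (J ∩ X) := Finset.insert_inter_of_mem hw
  have h3 : cost F r θ π X ≤ cost F r θ π (insert w J ∪ X) := by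
    refine hX.cost_le _ Finset.subset_union_right fun z hz => ?_
    rcases Finset.mem_union.1 hz with hz | hz
    · rcases Finset.mem_insert.1 hz with rfl | hz
      · exact hX.le _ hw
      · exact (hX.le _ hw).trans ((mem_older π).1 (hJ hz)).le
    · exact hX.le _ hz
  rw [h2, cost_insert F r θ π hJ, cost_insert F r θ π hJX] at h1
  linarith

/-- A minimiser of `threat` is closed. -/
theorem isClosedAt_insert_of_minThreat {u : V} {J : Finset V} (hJ : J ⊆ older π u)
    (h : threat F r θ π u J = minThreat F r θ π u) : IsClosedAt F r θ π u (insert u J) where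
  mem := Finset.mem_insert_self _ _
  le w hw := by
    rcases Finset.mem_insert.1 hw with rfl | hw
    · exact le_rfl
    · exact ((mem_older π).1 (hJ hw)).le
  cost_le Y hY hYu := by
    have huY : u ∈ Y := hY (Finset.mem_insert_self _ _)
    have hY' : Y.erase u ⊆ older π u := fun w hw => by
      rw [Finset.mem_erase] at hw
      exact (mem_older π).2 (lt_of_le_of_ne (hYu w hw.2) fun h => hw.1 (π.injective h).symm)
    rw [← Finset.insert_erase huY, cost_insert F r θ π hJ, cost_insert F r θ π hY', h]
    exact add_le_add_right (minThreat_le F r θ π hY') _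

end Cost

/-! ### The exponent `lam` and the cost function -/

section Lam

variable {V : Type*} [Fintype V] {F : SimpleGraph V} {r : ℕ} {θ : ℝ}
  {π : V ≃ Fin (Fintype.card V)}

instance : Finite F.Subgraph := by
  refine Finite.of_injective (fun H : F.Subgraph => (H.verts, H.Adj)) fun H H' h => ?_
  rw [Prod.mk.injEq] at h
  exact SimpleGraph.Subgraph.ext h.1 h.2

theorem bddBelow_range_of_finite {ι : Sort*} [Finite ι] (f : ι → ℝ) : BddBelow (Set.range f) :=
  (Set.finite_range f).bddBelow

theorem bddAbove_range_of_finite {ι : Sort*} [Finite ι] (f : ι → ℝ) : BddAbove (Set.range f) :=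
  (Set.finite_range f).bddAbove

theorem toFinset_deleteVerts (J : F.Subgraph) (u : V) :
    (J.deleteVerts {u}).verts.toFinset = J.verts.toFinset.erase u := by
  ext w
  simp [and_comm]

theorem erase_subset_older {H J : F.Subgraph} {u : V} (hu : IsYoungest π H u) (hJ : J ≤ H) :
    J.verts.toFinset.erase u ⊆ older π u := by
  intro w hw
  rw [Finset.mem_erase, Set.mem_toFinset] at hw
  exact (mem_older π).2 (lt_of_le_of_ne (hu.2 w (hJ.1 hw.2)) fun h => hw.1 (π.injective h).symm)

theorem ncard_neighborSet_le (J : F.Subgraph) (u : V) :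
    (J.neighborSet u).ncard ≤ degIn F u (J.verts.toFinset.erase u) := by
  rw [degIn, ← Set.ncard_coe_finset]
  refine Set.ncard_le_ncard (fun w hw => ?_) (Set.toFinite _)
  have hw' : J.Adj u w := hw
  simp [hw'.adj_sub, hw'.snd_mem, hw'.ne.symm]

theorem cost_le_lam (hr : 1 ≤ r) (hθ : 0 ≤ θ) (H : F.Subgraph) :
    cost F r θ π H.verts.toFinset ≤ lam r θ π H := by
  induction hn : H.verts.ncard using Nat.strong_induction_on generalizing H with
  | _ n ih =>
  by_cases h : H.verts.Nonempty
  · set u := youngest π H h with hu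
    have hyu : IsYoungest π H u := (exists_isYoungest π H h).choose_spec
    have hstep : ∀ J : F.Subgraph, J ≤ H → u ∈ J.verts →
        threat F r θ π u (J.verts.toFinset.erase u) ≤
          lam r θ π (J.deleteVerts {u}) - θ * ((J.neighborSet u).ncard : ℝ) := by
      intro J hJ huJ
      have h1 := ih _ (hn ▸ ncard_deleteVerts_lt hJ huJ) (J.deleteVerts {u}) rfl
      rw [toFinset_deleteVerts] at h1
      have h2 : ((J.neighborSet u).ncard : ℝ) ≤ degIn F u (J.verts.toFinset.erase u) := by
        exact_mod_cast ncard_neighborSet_le J u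
      rw [threat]
      nlinarith
    have hH := hstep H le_rfl hyu.1
    have hins : insert u (H.verts.toFinset.erase u) = H.verts.toFinset :=
      Finset.insert_erase (by simpa using hyu.1)
    have hinf : minThreat F r θ π u ≤
        ⨅ J : {J : F.Subgraph // J ≤ H ∧ u ∈ J.verts},
          (lam r θ π (J.1.deleteVerts {u}) - θ * ((J.1.neighborSet u).ncard : ℝ)) := by
      have : Nonempty {J : F.Subgraph // J ≤ H ∧ u ∈ J.verts} := ⟨⟨H, le_rfl, hyu.1⟩⟩
      refine le_ciInf fun J => ?_
      exact (minThreat_le F r θ π (erase_subset_older hyu J.2.1)).trans (hstep J.1 J.2.1 J.2.2)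
    rw [lam, dif_pos h, ← hins, cost_insert F r θ π (erase_subset_older hyu le_rfl), weight_eq]
    have h1 : (1 : ℝ) ≤ r := by exact_mod_cast hr
    nlinarith
  · rw [lam, dif_neg h]
    rw [Set.not_nonempty_iff_eq_empty] at h
    simp [h]

/-- The subgraph of `F` induced by `X`. -/
abbrev induced (F : SimpleGraph V) (X : Finset V) : F.Subgraph :=
  (⊤ : F.Subgraph).induce (X : Set V)

omit [Fintype V] in
theorem induced_deleteVerts (X : Finset V) (u : V) :
    (induced F X).deleteVerts {u} = induced F (X.erase u) := by
  ext a b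
  · simp [and_comm]
  · simp only [SimpleGraph.Subgraph.induce_adj,
      SimpleGraph.Subgraph.induce_verts, SimpleGraph.Subgraph.top_adj, Finset.mem_coe,
      Finset.coe_erase, Set.mem_sdiff, Set.mem_singleton_iff]
    tauto

omit [Fintype V] in
theorem ncard_neighborSet_induced {X : Finset V} {u : V} (hu : u ∈ X) :
    ((induced F X).neighborSet u).ncard = degIn F u (X.erase u) := by
  rw [degIn, ← Set.ncard_coe_finset]
  congr 1
  ext w
  simp only [SimpleGraph.Subgraph.mem_neighborSet, SimpleGraph.Subgraph.induce_adj,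
    Finset.mem_coe, hu, true_and, SimpleGraph.Subgraph.top_adj, Finset.coe_filter,
    Finset.mem_erase, Set.mem_ofPred_eq]
  constructor
  · rintro ⟨h1, h2⟩
    exact ⟨⟨h2.ne.symm, h1⟩, h2⟩
  · rintro ⟨⟨_, h1⟩, h2⟩
    exact ⟨h1, h2⟩

theorem IsClosedAt.isYoungest {u : V} {X : Finset V} (hX : IsClosedAt F r θ π u X) :
    IsYoungest π (induced F X) u :=
  ⟨by simpa using hX.mem, fun w hw => hX.le w (by simpa using hw)⟩

theorem IsClosedAt.erase_subset_older {u : V} {X : Finset V} (hX : IsClosedAt F r θ π u X) :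
    X.erase u ⊆ older π u := fun w hw => by
  rw [Finset.mem_erase] at hw
  exact (mem_older π).2 (lt_of_le_of_ne (hX.le w hw.2) fun h => hw.1 (π.injective h).symm)

theorem IsClosedAt.erase {u : V} {X : Finset V} (hX : IsClosedAt F r θ π u X) (hθ : 0 ≤ θ)
    (hne : (X.erase u).Nonempty) : ∃ w, IsClosedAt F r θ π w (X.erase u) := by
  obtain ⟨w, hw, hmin⟩ := Finset.exists_min_image (X.erase u) π hne
  refine ⟨w, hw, hmin, fun Y hY hYw => ?_⟩
  have hwu : π u < π w := (mem_older π).1 (hX.erase_subset_older hw)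
  have hYu : Y ⊆ older π u := fun z hz => (mem_older π).2 (hwu.trans_le (hYw z hz))
  have h1 := hX.cost_le (insert u Y)
    (by rw [← Finset.insert_erase hX.mem]; exact Finset.insert_subset_insert _ hY)
    (fun z hz => by
      rcases Finset.mem_insert.1 hz with rfl | hz
      · exact le_rfl
      · exact ((mem_older π).1 (hYu hz)).le)
  rw [← Finset.insert_erase hX.mem, cost_insert F r θ π hX.erase_subset_older,
    cost_insert F r θ π hYu, threat, threat] at h1
  have h2 : (degIn F u (X.erase u) : ℝ) ≤ degIn F u Y := by exact_mod_cast degIn_mono F u hY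
  nlinarith

/-- On closed sets the cost is an upper bound for `lam`, as all minima are attained inside. -/
theorem IsClosedAt.lam_le {u : V} {X : Finset V} (hX : IsClosedAt F r θ π u X) (hr : 1 ≤ r)
    (hθ : 0 ≤ θ) : lam r θ π (induced F X) ≤ cost F r θ π X := by
  induction hn : X.card using Nat.strong_induction_on generalizing X u with
  | _ n ih =>
  have hrec : ∀ (Y : Finset V) (v : V), Y.card ≤ n → IsClosedAt F r θ π v Y →
      lam r θ π (induced F (Y.erase v)) ≤ cost F r θ π (Y.erase v) := by
    intro Y v hYn hY
    rcases (Y.erase v).eq_empty_or_nonempty with h | h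
    · rw [h, lam, dif_neg (by simp)]
      simp
    · obtain ⟨w, hw⟩ := hY.erase hθ h
      exact ih _ ((Finset.card_erase_lt_of_mem hY.mem).trans_le hYn) hw rfl
  have hyu := hX.isYoungest
  have hne : (induced F X).verts.Nonempty := ⟨u, hyu.1⟩
  have hyoung : youngest π (induced F X) hne = u := by
    have h1 : IsYoungest π (induced F X) (youngest π (induced F X) hne) :=
      (exists_isYoungest π _ hne).choose_spec
    exact π.injective (le_antisymm (h1.2 _ hyu.1) (hyu.2 _ h1.1))
  subst hyoung
  set u := youngest π (induced F X) hne
  obtain ⟨J, hJ, hJX, hmin⟩ := hX.exists_subset hθ hX.mem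
  have huJ : u ∉ J := notMem_of_subset_older π hJ
  have hle : induced F (insert u J) ≤ induced F X := by
    refine SimpleGraph.Subgraph.induce_mono_right ?_
    exact_mod_cast Finset.insert_subset hX.mem hJX
  have hinf : (⨅ J : {J : F.Subgraph // J ≤ induced F X ∧ u ∈ J.verts},
      (lam r θ π (J.1.deleteVerts {u}) - θ * ((J.1.neighborSet u).ncard : ℝ))) ≤
        minThreat F r θ π u := by
    refine (ciInf_le (bddBelow_range_of_finite _)
      ⟨induced F (insert u J), hle, by simp⟩).trans ?_
    have hcard : (insert u J).card ≤ n := by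
      rw [← hn]
      exact Finset.card_le_card (Finset.insert_subset hX.mem hJX)
    have h1 := hrec _ _ hcard (isClosedAt_insert_of_minThreat hJ hmin)
    rw [induced_deleteVerts, ncard_neighborSet_induced (Finset.mem_insert_self _ _), ← hmin,
      threat]
    rw [Finset.erase_insert huJ] at h1 ⊢
    linarith
  have h1 := hrec X u hn.le hX
  rw [lam, dif_pos hne]
  rw [induced_deleteVerts, ncard_neighborSet_induced hX.mem]
  have h2 := cost_insert F r θ π hX.erase_subset_older
  rw [Finset.insert_erase hX.mem, weight_eq, threat] at h2
  have h3 : (0 : ℝ) ≤ (r : ℝ) - 1 := sub_nonneg.2 (by exact_mod_cast hr)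
  rw [h2]
  refine (add_le_add_right (mul_le_mul_of_nonneg_left hinf h3) _).trans ?_
  linarith

/-- A nonempty set of minimum cost is closed at its youngest vertex. -/
theorem exists_isClosedAt_of_minimal {X : Finset V} (hne : X.Nonempty)
    (hmin : ∀ Y : Finset V, Y.Nonempty → cost F r θ π X ≤ cost F r θ π Y) :
    ∃ u, IsClosedAt F r θ π u X := by
  obtain ⟨u, hu, h⟩ := Finset.exists_min_image X π hne
  exact ⟨u, hu, h, fun Y hY _ => hmin Y (hne.mono hY)⟩

variable (F r θ π)

theorem exists_minimal_cost [Nonempty V] :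
    ∃ X : Finset V, X.Nonempty ∧
      ∀ Y : Finset V, Y.Nonempty → cost F r θ π X ≤ cost F r θ π Y := by
  obtain ⟨X, hX, h⟩ := Finset.exists_min_image
    (Finset.univ.filter fun X : Finset V => X.Nonempty) (cost F r θ π)
    ⟨Finset.univ, by simp [Finset.univ_nonempty]⟩
  exact ⟨X, by simpa using hX, fun Y hY => h Y (by simpa using hY)⟩

/-- The minimum of the cost function over all nonempty sets of vertices. -/
def minCost : ℝ := ⨅ X : {X : Finset V // X.Nonempty}, cost F r θ π X.1

theorem iInf_lam_eq_minCost [Nonempty V] (hr : 1 ≤ r) (hθ : 0 ≤ θ) :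
    (⨅ H : {H : F.Subgraph // H.verts.Nonempty}, lam r θ π H.1) = minCost F r θ π := by
  obtain ⟨X, hX, hmin⟩ := exists_minimal_cost F r θ π
  have h0 : Nonempty {X : Finset V // X.Nonempty} := ⟨⟨X, hX⟩⟩
  have h1 : minCost F r θ π = cost F r θ π X :=
    le_antisymm (ciInf_le (bddBelow_range_of_finite _) (⟨X, hX⟩ : {X : Finset V // X.Nonempty}))
      (le_ciInf fun Y => hmin Y.1 Y.2)
  have h2 : Nonempty {H : F.Subgraph // H.verts.Nonempty} :=
    ⟨⟨induced F X, by simpa using hX⟩⟩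
  rw [h1]
  refine le_antisymm ?_ (le_ciInf fun H => ?_)
  · obtain ⟨u, hu⟩ := exists_isClosedAt_of_minimal hX hmin
    exact (ciInf_le (bddBelow_range_of_finite _) (⟨induced F X, by simpa using hX⟩ :
      {H : F.Subgraph // H.verts.Nonempty})).trans (hu.lam_le hr hθ)
  · exact (hmin _ (by simpa using H.2)).trans (cost_le_lam hr hθ H.1)

end Lam

/-! ### The exponent `mStar` and the cost function -/

section MStar

variable {V : Type*} [Fintype V] {F : SimpleGraph V} {r : ℕ} {θ : ℝ}
  {π : V ≃ Fin (Fintype.card V)}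

theorem ncard_edgeSet_eq (H : F.Subgraph) :
    H.edgeSet.ncard =
      (Finset.univ.filter fun e : V × V => H.Adj e.1 e.2 ∧ π e.1 < π e.2).card := by
  rw [← Set.ncard_coe_finset]
  symm
  refine Set.ncard_congr (fun e _ => s(e.1, e.2)) ?_ ?_ ?_
  · intro e he
    simp only [Finset.coe_filter, Finset.mem_univ, true_and, Set.mem_ofPred_eq] at he
    exact he.1
  · intro e e' he he' h
    simp only [Finset.coe_filter, Finset.mem_univ, true_and, Set.mem_ofPred_eq] at he he'
    rcases Sym2.eq_iff.1 h with h | h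
    · exact Prod.ext h.1 h.2
    · rw [h.1, h.2] at he
      exact absurd he.2 he'.2.asymm
  · intro e he
    induction e using Sym2.ind with
    | _ x y =>
    have hadj : H.Adj x y := he
    rcases lt_or_gt_of_ne (fun h => hadj.ne (π.injective h) : π x ≠ π y) with h | h
    · exact ⟨(x, y), by simpa using ⟨hadj, h⟩, rfl⟩
    · exact ⟨(y, x), by simpa using ⟨hadj.symm, h⟩, Sym2.eq_swap⟩

theorem ncard_edgeSet_le (H : F.Subgraph) :
    H.edgeSet.ncard ≤ (innerEdges F π H.verts.toFinset).card := by
  rw [ncard_edgeSet_eq (π := π)]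
  refine Finset.card_le_card fun e he => ?_
  simp only [Finset.mem_filter, Finset.mem_univ, true_and] at he
  simp [innerEdges, he.1.fst_mem, he.1.snd_mem, he.1.adj_sub, he.2]

theorem ncard_edgeSet_induced (X : Finset V) :
    (induced F X).edgeSet.ncard = (innerEdges F π X).card := by
  rw [ncard_edgeSet_eq (π := π)]
  congr 1
  ext e
  simp only [innerEdges, Finset.mem_filter, Finset.mem_univ, true_and, Finset.mem_product,
    SimpleGraph.Subgraph.induce_adj, Finset.mem_coe, SimpleGraph.Subgraph.top_adj]
  tauto

theorem coeff_nonneg (hr : 1 ≤ r) (H₁ : F.Subgraph) (K : V → F.Subgraph) (u : V) :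
    0 ≤ coeff r π H₁ K u := by
  induction hn : (π u).val using Nat.strong_induction_on generalizing u with
  | _ n ih =>
  rw [coeff]
  split_ifs with h
  · positivity
  · refine mul_nonneg (sub_nonneg.2 (by exact_mod_cast hr)) (Finset.sum_nonneg fun w _ => ?_)
    refine mul_nonneg (ih _ (hn ▸ w.2.2) _ rfl) ?_
    split_ifs <;> norm_num

theorem sum_coe_verts (H₁ : F.Subgraph) (f : V → ℝ) :
    ∑ u : H₁.verts, f u.1 = ∑ u ∈ H₁.verts.toFinset, f u :=
  (Finset.sum_subtype _ (fun _ => Set.mem_toFinset) f).symm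

theorem coeff_eq {H₁ : F.Subgraph} {u : V} (hu : IsYoungest π H₁ u) (K : V → F.Subgraph) {w : V}
    (hw : w ≠ u) :
    coeff r π H₁ K w = ((r : ℝ) - 1) * ∑ v ∈ H₁.verts.toFinset with π v < π w,
      coeff r π H₁ K v * (if w ∈ (K v).verts then 1 else 0) := by
  rw [coeff, if_neg]
  · congr 1
    exact (Finset.sum_subtype _ (fun v => by simp)
      (fun v => coeff r π H₁ K v * (if w ∈ (K v).verts then 1 else 0))).symm
  · intro h
    by_cases hwu : w ∈ H₁.verts
    · exact hw (π.injective (le_antisymm (h.2 _ hu.1) (hu.2 _ hwu)))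
    · exact hwu h.1

theorem Admissible.erase_subset {H₁ : F.Subgraph} {K : V → F.Subgraph}
    (hK : Admissible π H₁ K) {v : V} (hv : v ∈ H₁.verts) {w : V} :
    w ∈ (K v).verts.toFinset.erase v ↔ w ∈ H₁.verts ∧ π v < π w ∧ w ∈ (K v).verts := by
  simp only [Finset.mem_erase, Set.mem_toFinset]
  constructor
  · rintro ⟨h1, h2⟩
    have h3 := (hK.2 v hv).1.1 h2
    simp only [SimpleGraph.Subgraph.deleteVerts_verts, Set.mem_sdiff, Set.mem_ofPred_eq,
      not_lt] at h3
    exact ⟨h3.1, lt_of_le_of_ne h3.2 fun h => h1 (π.injective h).symm, h2⟩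
  · rintro ⟨_, h1, h2⟩
    exact ⟨fun h => lt_irrefl _ (h ▸ h1), h2⟩

/-- The recursion for the coefficients is dual to the recursion for the weights. -/
theorem sum_coeff_mul {H₁ : F.Subgraph} {u : V} (hu : IsYoungest π H₁ u) {K : V → F.Subgraph}
    (hK : Admissible π H₁ K) (m : V → ℝ) :
    ∑ v ∈ H₁.verts.toFinset, coeff r π H₁ K v *
      (m v - ((r : ℝ) - 1) * ∑ w ∈ (K v).verts.toFinset.erase v, m w) = r * m u := by
  have huX : u ∈ H₁.verts.toFinset := by simpa using hu.1
  have h1 : ∀ v ∈ H₁.verts.toFinset, ∑ w ∈ (K v).verts.toFinset.erase v, m w =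
      ∑ w ∈ H₁.verts.toFinset,
        if π v < π w then (if w ∈ (K v).verts then m w else 0) else 0 := by
    intro v hv
    rw [Set.mem_toFinset] at hv
    simp only [← ite_and]
    rw [← Finset.sum_filter]
    refine Finset.sum_congr ?_ fun _ _ => rfl
    ext w
    rw [hK.erase_subset hv, Finset.mem_filter, Set.mem_toFinset]
  calc _ = ∑ v ∈ H₁.verts.toFinset, coeff r π H₁ K v * m v -
        ∑ v ∈ H₁.verts.toFinset, ∑ w ∈ H₁.verts.toFinset, ((r : ℝ) - 1) * coeff r π H₁ K v *
          (if π v < π w then (if w ∈ (K v).verts then m w else 0) else 0) := by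
        rw [← Finset.sum_sub_distrib]
        refine Finset.sum_congr rfl fun v hv => ?_
        rw [h1 v hv, ← Finset.mul_sum]
        ring
    _ = ∑ w ∈ H₁.verts.toFinset, m w * (coeff r π H₁ K w -
          ((r : ℝ) - 1) * ∑ v ∈ H₁.verts.toFinset with π v < π w,
            coeff r π H₁ K v * (if w ∈ (K v).verts then 1 else 0)) := by
        rw [Finset.sum_comm, ← Finset.sum_sub_distrib]
        refine Finset.sum_congr rfl fun w hw => ?_
        rw [Finset.sum_filter, mul_sub, mul_comm (m w) (coeff r π H₁ K w), Finset.mul_sum,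
          Finset.mul_sum]
        congr 1
        refine Finset.sum_congr rfl fun v hv => ?_
        split_ifs <;> ring
    _ = m u * (r - ((r : ℝ) - 1) * 0) := by
        rw [Finset.sum_eq_single_of_mem u huX]
        · congr 2
          · rw [coeff, if_pos hu]
          · congr 1
            refine Finset.sum_eq_zero fun v hv => ?_
            rw [Finset.mem_filter, Set.mem_toFinset] at hv
            exact absurd hv.2 (not_lt.2 (hu.2 v hv.1))
        · intro w _ hwu
          rw [coeff_eq hu K hwu]
          ring
    _ = r * m u := by ring

/-- The numerator in the definition of `dStar`. -/
def dStarNum (r : ℕ) (π : V ≃ Fin (Fintype.card V)) (H₁ : F.Subgraph) (K : V → F.Subgraph) : ℝ :=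
  ∑ u : H₁.verts, coeff r π H₁ K u.1 * ((K u.1).edgeSet.ncard : ℝ)

/-- The denominator in the definition of `dStar`. -/
def dStarDen (r : ℕ) (π : V ≃ Fin (Fintype.card V)) (H₁ : F.Subgraph) (K : V → F.Subgraph) : ℝ :=
  1 + ∑ u : H₁.verts, coeff r π H₁ K u.1 * (((K u.1).verts.ncard : ℝ) - 1)

theorem dStarDen_pos (hr : 1 ≤ r) {H₁ : F.Subgraph} {K : V → F.Subgraph}
    (hK : Admissible π H₁ K) : 0 < dStarDen r π H₁ K := by
  refine add_pos_of_pos_of_nonneg one_pos (Finset.sum_nonneg fun u _ => ?_)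
  refine mul_nonneg (coeff_nonneg hr _ _ _) (sub_nonneg.2 ?_)
  exact_mod_cast (Set.ncard_pos (Set.toFinite _)).2 ⟨_, (hK.2 u.1 u.2).2⟩

theorem dStarDen_sub (H₁ : F.Subgraph) (K : V → F.Subgraph) :
    dStarDen r π H₁ K - θ * dStarNum r π H₁ K =
      1 + ∑ v ∈ H₁.verts.toFinset, coeff r π H₁ K v *
        (((K v).verts.ncard : ℝ) - 1 - θ * ((K v).edgeSet.ncard : ℝ)) := by
  rw [dStarDen, dStarNum, sum_coe_verts H₁ (fun v => coeff r π H₁ K v *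
      ((K v).edgeSet.ncard : ℝ)), sum_coe_verts H₁ (fun v => coeff r π H₁ K v *
      (((K v).verts.ncard : ℝ) - 1)), add_sub_assoc, Finset.mul_sum, ← Finset.sum_sub_distrib]
  congr 1
  exact Finset.sum_congr rfl fun v _ => by ring

theorem threat_sub_sum_weight {v : V} {J : Finset V} (hJ : J ⊆ older π v) :
    threat F r θ π v J - ((r : ℝ) - 1) * ∑ w ∈ J, minThreat F r θ π w =
      ((insert v J).card : ℝ) - 1 - θ * ((innerEdges F π (insert v J)).card : ℝ) := by
  have h1 : ∑ w ∈ J, weight F r θ π w =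
      (J.card : ℝ) + ((r : ℝ) - 1) * ∑ w ∈ J, minThreat F r θ π w := by
    simp only [weight_eq, Finset.sum_add_distrib, Finset.mul_sum]
    simp
  rw [threat, cost, h1, Finset.card_insert_of_notMem (notMem_of_subset_older π hJ),
    card_innerEdges_insert F π hJ]
  push_cast
  ring

/-- The bound is an equality if every `K v` is an induced subgraph that attains `minThreat v`. -/
theorem le_dStarDen_sub (hr : 1 ≤ r) (hθ : 0 ≤ θ) {H₁ : F.Subgraph} {u : V}
    (hu : IsYoungest π H₁ u) {K : V → F.Subgraph} (hK : Admissible π H₁ K) :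
    1 + r * minThreat F r θ π u ≤ dStarDen r π H₁ K - θ * dStarNum r π H₁ K := by
  rw [dStarDen_sub, ← sum_coeff_mul hu hK]
  refine add_le_add_right (Finset.sum_le_sum fun v hv => ?_) _
  rw [Set.mem_toFinset] at hv
  refine mul_le_mul_of_nonneg_left ?_ (coeff_nonneg hr _ _ _)
  have hJ : (K v).verts.toFinset.erase v ⊆ older π v := fun w hw =>
    (mem_older π).2 ((hK.erase_subset hv).1 hw).2.1
  have h1 := threat_sub_sum_weight (F := F) (r := r) (θ := θ) hJ
  rw [Finset.insert_erase (by simpa using (hK.2 v hv).2)] at h1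
  have h2 := minThreat_le F r θ π hJ
  have h3 : ((K v).edgeSet.ncard : ℝ) ≤ (innerEdges F π (K v).verts.toFinset).card := by
    exact_mod_cast ncard_edgeSet_le (K v)
  rw [Set.ncard_eq_toFinset_card']
  nlinarith

theorem dStar_le (hr : 1 ≤ r) (hθ : 0 < θ)
    (h : ∀ X : Finset V, X.Nonempty → 0 ≤ cost F r θ π X) (H₁ : F.Subgraph)
    (hne : H₁.verts.Nonempty) : dStar r π H₁ ≤ 1 / θ := by
  refine Real.iSup_le (fun K => ?_) (by positivity)
  obtain ⟨u, hu⟩ := exists_isYoungest π H₁ hne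
  have h1 := le_dStarDen_sub hr hθ.le hu K.2
  obtain ⟨J, hJ, hmin⟩ := exists_minThreat F r θ π u
  have h2 := h (insert u J) (Finset.insert_nonempty _ _)
  rw [cost_insert F r θ π hJ, hmin, weight_eq] at h2
  change dStarNum r π H₁ K.1 / dStarDen r π H₁ K.1 ≤ 1 / θ
  rw [div_le_div_iff₀ (dStarDen_pos hr K.2) hθ]
  linarith

/-- If some set has negative cost, then there is a closed one, and the minimisers inside it form an
admissible sequence that shows that `dStar` is large. -/
theorem exists_lt_dStar (hr : 1 ≤ r) (hθ : 0 < θ)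
    (h : ∃ X : Finset V, X.Nonempty ∧ cost F r θ π X < 0) :
    ∃ H₁ : F.Subgraph, H₁.verts.Nonempty ∧ 1 / θ < dStar r π H₁ := by
  obtain ⟨X, hX, hneg⟩ := h
  obtain ⟨u, huX, hmin⟩ := Finset.exists_min_image X π hX
  have hX' : X.erase u ⊆ older π u := fun w hw => by
    rw [Finset.mem_erase] at hw
    exact (mem_older π).2 (lt_of_le_of_ne (hmin w hw.2) fun h => hw.1 (π.injective h).symm)
  have hneg' : 1 + r * minThreat F r θ π u < 0 := by
    rw [← Finset.insert_erase huX, cost_insert F r θ π hX', weight_eq] at hneg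
    have := minThreat_le F r θ π hX'
    linarith
  obtain ⟨J, hJ, hJmin⟩ := exists_minThreat F r θ π u
  have hcl := isClosedAt_insert_of_minThreat hJ hJmin
  set X₁ := insert u J with hX₁
  have hch : ∀ w : V, ∃ J' : Finset V, w ∈ X₁ → (J' ⊆ older π w ∧ J' ⊆ X₁ ∧
      threat F r θ π w J' = minThreat F r θ π w) := by
    intro w
    by_cases hw : w ∈ X₁
    · obtain ⟨J', h1, h2, h3⟩ := hcl.exists_subset hθ.le hw
      exact ⟨J', fun _ => ⟨h1, h2, h3⟩⟩
    · exact ⟨∅, fun h => absurd h hw⟩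
  choose J' hJ' using hch
  set J'' : V → Finset V := fun w => if w = u then J else J' w with hJ''
  have hJ''s : ∀ w ∈ X₁, J'' w ⊆ older π w ∧ J'' w ⊆ X₁ ∧
      threat F r θ π w (J'' w) = minThreat F r θ π w := by
    intro w hw
    by_cases hwu : w = u
    · subst hwu
      simp only [hJ'', if_pos]
      exact ⟨hJ, Finset.subset_insert _ _, hJmin⟩
    · simp only [hJ'', if_neg hwu]
      exact hJ' w hw
  set K : V → F.Subgraph := fun w => induced F (insert w (J'' w)) with hK
  have hyu := hcl.isYoungest
  have hmem : ∀ w, w ∈ (induced F X₁).verts ↔ w ∈ X₁ := fun w => by simp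
  have hadm : Admissible π (induced F X₁) K := by
    refine ⟨fun w hw => ?_, fun w hw => ⟨?_, by simp [hK]⟩⟩
    · have : w = u := π.injective (le_antisymm (hw.2 _ hyu.1) (hyu.2 _ hw.1))
      simp [hK, hJ'', this, hX₁]
    · rw [hmem] at hw
      obtain ⟨h1, h2, -⟩ := hJ''s w hw
      have h3 : (induced F X₁).deleteVerts {z | π z < π w} =
          induced F (X₁.filter fun z => π w ≤ π z) := by
        ext a b
        · simp
        · simp only [SimpleGraph.Subgraph.induce_adj,
            SimpleGraph.Subgraph.induce_verts, SimpleGraph.Subgraph.top_adj, Finset.mem_coe,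
            Set.mem_sdiff, Set.mem_ofPred_eq, Finset.mem_filter, not_lt]
          tauto
      rw [h3]
      refine SimpleGraph.Subgraph.induce_mono_right ?_
      intro z hz
      rw [Finset.mem_coe, Finset.mem_insert] at hz
      rw [Finset.mem_coe, Finset.mem_filter]
      rcases hz with rfl | hz
      · exact ⟨hw, le_rfl⟩
      · exact ⟨h2 hz, ((mem_older π).1 (h1 hz)).le⟩
  have heq : dStarDen r π (induced F X₁) K - θ * dStarNum r π (induced F X₁) K =
      1 + r * minThreat F r θ π u := by
    rw [dStarDen_sub, ← sum_coeff_mul hyu hadm]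
    congr 1
    refine Finset.sum_congr rfl fun w hw => ?_
    rw [Set.mem_toFinset, hmem] at hw
    obtain ⟨h1, h2, h3⟩ := hJ''s w hw
    have h4 : (K w).verts.toFinset = insert w (J'' w) := by
      ext z
      simp [hK]
    rw [h4, Finset.erase_insert (notMem_of_subset_older π h1), ← h3,
      threat_sub_sum_weight h1, ncard_edgeSet_induced (π := π), Set.ncard_eq_toFinset_card', h4]
  refine ⟨induced F X₁, ⟨u, hyu.1⟩, ?_⟩
  have hlt : 1 / θ < dStarNum r π (induced F X₁) K / dStarDen r π (induced F X₁) K := by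
    rw [div_lt_div_iff₀ hθ (dStarDen_pos hr hadm)]
    linarith
  exact hlt.trans_le (le_ciSup (f := fun K : {K : V → F.Subgraph // Admissible π (induced F X₁) K} =>
    dStarNum r π (induced F X₁) K.1 / dStarDen r π (induced F X₁) K.1)
    (bddAbove_range_of_finite _) ⟨K, hadm⟩)

theorem mStar_le (hr : 1 ≤ r) (hθ : 0 < θ)
    (h : ∃ π, ∀ X : Finset V, X.Nonempty → 0 ≤ cost F r θ π X) : mStar F r ≤ 1 / θ := by
  obtain ⟨π, h⟩ := h
  refine (ciInf_le (bddBelow_range_of_finite _) π).trans ?_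
  exact Real.iSup_le (fun H => dStar_le hr hθ h H.1 H.2) (by positivity)

theorem le_mStar (hr : 1 ≤ r) (hθ : 0 < θ)
    (h : ∀ π, ∃ X : Finset V, X.Nonempty ∧ cost F r θ π X < 0) : 1 / θ ≤ mStar F r := by
  have : Nonempty (V ≃ Fin (Fintype.card V)) := ⟨Fintype.equivFin V⟩
  refine le_ciInf fun π => ?_
  obtain ⟨H₁, hne, hlt⟩ := exists_lt_dStar hr hθ (h π)
  exact hlt.le.trans (le_ciSup (f := fun H : {H : F.Subgraph // H.verts.Nonempty} =>
    dStar r π H.1) (bddAbove_range_of_finite _) ⟨H₁, hne⟩)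

end MStar

/-! ### Dependence on `θ` -/

section Theta

variable {V : Type*} [Fintype V] {F : SimpleGraph V} {r : ℕ} {θ θ' : ℝ}
  {π : V ≃ Fin (Fintype.card V)}

/-- Induction from the older to the younger vertices. -/
theorem older_induction (π : V ≃ Fin (Fintype.card V)) {P : V → Prop}
    (h : ∀ u, (∀ w ∈ older π u, P w) → P u) (u : V) : P u := by
  induction hn : Fintype.card V - (π u).val using Nat.strong_induction_on generalizing u with
  | _ n ih =>
  refine h u fun w hw => ih _ ?_ w rfl
  rw [← hn]
  exact Nat.sub_lt_sub_left (π u).isLt ((mem_older π).1 hw)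

theorem lipschitz_finset_sum {ι : Type*} (s : Finset ι) {f : ι → ℝ → ℝ}
    (h : ∀ i ∈ s, ∃ K, LipschitzWith K (f i)) : ∃ K, LipschitzWith K fun t => ∑ i ∈ s, f i t := by
  induction s using Finset.induction_on with
  | empty => exact ⟨0, by simp⟩
  | insert i s hi ih =>
    obtain ⟨K, hK⟩ := ih fun j hj => h j (Finset.mem_insert_of_mem hj)
    obtain ⟨K', hK'⟩ := h i (Finset.mem_insert_self _ _)
    refine ⟨K' + K, ?_⟩
    simp only [Finset.sum_insert hi]
    exact hK'.add hK

theorem lipschitz_finset_inf' {ι : Type*} {s : Finset ι} (hs : s.Nonempty) {f : ι → ℝ → ℝ}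
    (h : ∀ i ∈ s, ∃ K, LipschitzWith K (f i)) :
    ∃ K, LipschitzWith K fun t => s.inf' hs fun i => f i t := by
  induction hs using Finset.Nonempty.cons_induction with
  | singleton i => simpa using h i (by simp)
  | cons i s hi hs ih =>
    obtain ⟨K, hK⟩ := ih fun j hj => h j (by simp [hj])
    obtain ⟨K', hK'⟩ := h i (by simp)
    refine ⟨max K' K, ?_⟩
    simp only [Finset.inf'_cons hs]
    exact hK'.min hK

theorem lipschitz_sub_mul {f : ℝ → ℝ} (h : ∃ K, LipschitzWith K f) (c : ℝ) :
    ∃ K, LipschitzWith K fun t => f t - t * c := by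
  obtain ⟨K, hK⟩ := h
  refine ⟨K + ‖c‖₊, hK.sub ?_⟩
  have := lipschitzWith_smul (α := ℝ) (β := ℝ) c
  simpa [mul_comm] using this

theorem lipschitz_weight (F : SimpleGraph V) (r : ℕ) (π : V ≃ Fin (Fintype.card V)) (u : V) :
    ∃ K, LipschitzWith K fun θ => weight F r θ π u := by
  induction u using older_induction π with
  | h u ih =>
  simp only [weight_eq, minThreat]
  obtain ⟨K, hK⟩ := lipschitz_finset_inf' (Finset.powerset_nonempty (older π u))
    (f := fun J θ => threat F r θ π u J) fun J hJ =>
      lipschitz_sub_mul (lipschitz_sub_mul (lipschitz_finset_sum J fun w hw =>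
        ih w (Finset.mem_powerset.1 hJ hw)) _) _
  refine ⟨0 + ‖(r : ℝ) - 1‖₊ * K, (LipschitzWith.const 1).add ?_⟩
  exact (lipschitzWith_smul (α := ℝ) (β := ℝ) ((r : ℝ) - 1)).comp hK

theorem lipschitz_cost (F : SimpleGraph V) (r : ℕ) (π : V ≃ Fin (Fintype.card V))
    (X : Finset V) : ∃ K, LipschitzWith K fun θ => cost F r θ π X :=
  lipschitz_sub_mul (lipschitz_finset_sum X fun u _ => lipschitz_weight F r π u) _

/-- A Lipschitz constant for the cost function that serves for all orderings and all sets. -/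
theorem exists_abs_cost_sub_le (F : SimpleGraph V) (r : ℕ) :
    ∃ L : ℝ, 0 < L ∧ ∀ (π : V ≃ Fin (Fintype.card V)) (X : Finset V) (θ θ' : ℝ),
      |cost F r θ π X - cost F r θ' π X| ≤ L * |θ - θ'| := by
  choose K hK using fun (q : (V ≃ Fin (Fintype.card V)) × Finset V) => lipschitz_cost F r q.1 q.2
  refine ⟨1 + ∑ q, (K q : ℝ), by positivity, fun π X θ θ' => ?_⟩
  have h1 := (hK (π, X)).dist_le_mul θ θ'
  rw [Real.dist_eq, Real.dist_eq] at h1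
  refine h1.trans (mul_le_mul_of_nonneg_right ?_ (abs_nonneg _))
  have h2 : (K (π, X) : ℝ) ≤ ∑ q, (K q : ℝ) :=
    Finset.single_le_sum (f := fun q => (K q : ℝ)) (fun _ _ => NNReal.coe_nonneg _)
      (Finset.mem_univ (π, X))
  linarith

theorem continuous_minCost [Nonempty V] (F : SimpleGraph V) (r : ℕ)
    (π : V ≃ Fin (Fintype.card V)) : Continuous fun θ => minCost F r θ π := by
  have : Nonempty {X : Finset V // X.Nonempty} := ⟨⟨Finset.univ, Finset.univ_nonempty⟩⟩
  simp only [minCost, ← Finset.inf'_univ_eq_ciInf]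
  refine Continuous.finset_inf'_apply _ fun X _ => ?_
  obtain ⟨K, hK⟩ := lipschitz_cost F r π X.1
  exact hK.continuous

omit [Fintype V] in
/-- The common step of the strict monotonicity of weights and costs: a nonempty sum of weights
minus `θ k` that is not positive has `k > 0` or a weight that is less than one. -/
theorem sum_sub_lt_sum_sub {J : Finset V} (hJ : J.Nonempty) {f g : V → ℝ}
    (h : ∀ w ∈ J, g w ≤ f w ∧ (f w < 1 → g w < f w)) (k : ℕ) (hθ : θ < θ')
    (hneg : ∑ w ∈ J, f w - θ * k ≤ 0) :
    ∑ w ∈ J, g w - θ' * k < ∑ w ∈ J, f w - θ * k := by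
  have hle : ∑ w ∈ J, g w ≤ ∑ w ∈ J, f w := Finset.sum_le_sum fun w hw => (h w hw).1
  rcases Nat.eq_zero_or_pos k with rfl | hk
  · obtain ⟨w, hw, hw0⟩ : ∃ w ∈ J, f w ≤ 0 := by
      by_contra! hcon
      have := Finset.sum_pos hcon hJ
      simp at hneg
      linarith
    have := Finset.sum_lt_sum (fun w hw => (h w hw).1) ⟨w, hw, (h w hw).2 (by linarith)⟩
    simpa using this
  · have : (0 : ℝ) < k := by exact_mod_cast hk
    nlinarith

theorem weight_strict (hr : 2 ≤ r) (hθ : θ < θ') (u : V) :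
    weight F r θ' π u ≤ weight F r θ π u ∧
      (weight F r θ π u < 1 → weight F r θ' π u < weight F r θ π u) := by
  induction u using older_induction π with
  | h u ih =>
  have hr' : (0 : ℝ) < (r : ℝ) - 1 := by
    have : (2 : ℝ) ≤ r := by exact_mod_cast hr
    linarith
  obtain ⟨J, hJ, hmin⟩ := exists_minThreat F r θ π u
  have hk : ∀ t : ℝ, threat F r t π u J = ∑ w ∈ J, weight F r t π w -
      t * ((innerEdges F π J).card + degIn F u J : ℕ) := fun t => by
    rw [threat, cost]
    push_cast
    ring
  have h1 := minThreat_le F r θ' π hJ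
  rw [weight_eq, weight_eq]
  rcases J.eq_empty_or_nonempty with rfl | hne
  · have h2 : minThreat F r θ π u = 0 := by rw [← hmin]; simp [threat]
    have h3 := minThreat_nonpos F r θ' π u
    rw [h2]
    constructor
    · nlinarith
    · intro h; linarith
  · have h3 := minThreat_nonpos F r θ π u
    rw [← hmin, hk] at h3
    have h4 := sum_sub_lt_sum_sub hne (fun w hw => ih w (hJ hw)) _ hθ h3
    rw [← hk, ← hk, hmin] at h4
    have h5 := mul_lt_mul_of_pos_left (h1.trans_lt h4) hr'
    exact ⟨by linarith, fun _ => by linarith⟩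

theorem cost_lt_cost (hr : 2 ≤ r) (hθ : θ < θ') {X : Finset V} (hX : X.Nonempty)
    (h : cost F r θ π X ≤ 0) : cost F r θ' π X < cost F r θ π X :=
  sum_sub_lt_sum_sub hX (fun w _ => weight_strict hr hθ w) _ hθ h

theorem weight_zero (u : V) : weight F r 0 π u = 1 := by
  induction u using older_induction π with
  | h u ih =>
  obtain ⟨J, hJ, hmin⟩ := exists_minThreat F r 0 π u
  have h0 : minThreat F r 0 π u = 0 := by
    refine le_antisymm (minThreat_nonpos F r 0 π u) ?_
    rw [← hmin, threat, cost, Finset.sum_congr rfl fun w hw => ih w (hJ hw)]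
    simp
  rw [weight_eq, h0]
  ring

theorem exists_cost_two_neg (hr : 2 ≤ r) (hF : F.edgeSet.Nonempty)
    (π : V ≃ Fin (Fintype.card V)) : ∃ X : Finset V, X.Nonempty ∧ cost F r 2 π X < 0 := by
  obtain ⟨u, v, hadj, huv⟩ : ∃ u v, F.Adj u v ∧ π u < π v := by
    obtain ⟨e, he⟩ := hF
    induction e using Sym2.ind with
    | _ x y =>
    have hadj : F.Adj x y := he
    rcases lt_or_gt_of_ne (fun h => hadj.ne (π.injective h) : π x ≠ π y) with h | h
    · exact ⟨x, y, hadj, h⟩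
    · exact ⟨y, x, hadj.symm, h⟩
  have hJ : ({v} : Finset V) ⊆ older π u := by simpa using huv
  have h1 : threat F r 2 π u {v} ≤ -1 := by
    have h2 : degIn F u {v} = 1 := by simp [degIn, Finset.filter_singleton, hadj]
    have h3 : (innerEdges F π {v}).card = 0 := by
      simp [innerEdges]
    rw [threat, cost, h2, h3]
    have := weight_le_one F r 2 π (by omega) v
    simp
    linarith
  have h2 := minThreat_le F r 2 π hJ
  refine ⟨insert u {v}, Finset.insert_nonempty _ _, ?_⟩
  have h3 : (2 : ℝ) ≤ r := by exact_mod_cast hr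
  rw [cost_insert F r 2 π hJ, weight_eq]
  nlinarith

theorem Lam_eq [Nonempty V] (hr : 1 ≤ r) (hθ : 0 ≤ θ) :
    Lam F r θ = ⨆ π : V ≃ Fin (Fintype.card V), minCost F r θ π := by
  rw [Lam]
  exact iSup_congr fun π => iInf_lam_eq_minCost F r θ π hr hθ

theorem le_Lam [Nonempty V] (hr : 1 ≤ r) (hθ : 0 ≤ θ) (π : V ≃ Fin (Fintype.card V)) :
    minCost F r θ π ≤ Lam F r θ := by
  rw [Lam_eq hr hθ]
  exact le_ciSup (bddAbove_range_of_finite _) π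

theorem exists_eq_Lam [Nonempty V] (hr : 1 ≤ r) (hθ : 0 ≤ θ) :
    ∃ π : V ≃ Fin (Fintype.card V), minCost F r θ π = Lam F r θ := by
  have : Nonempty (V ≃ Fin (Fintype.card V)) := ⟨Fintype.equivFin V⟩
  rw [Lam_eq hr hθ]
  exact exists_eq_ciSup_of_finite

theorem exists_cost_eq_minCost [Nonempty V] (π : V ≃ Fin (Fintype.card V)) :
    ∃ X : Finset V, X.Nonempty ∧ cost F r θ π X = minCost F r θ π := by
  have : Nonempty {X : Finset V // X.Nonempty} := ⟨⟨Finset.univ, Finset.univ_nonempty⟩⟩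
  obtain ⟨X, hX⟩ := exists_eq_ciInf_of_finite
    (f := fun X : {X : Finset V // X.Nonempty} => cost F r θ π X.1)
  exact ⟨X.1, X.2, hX⟩

theorem minCost_le {X : Finset V} (hX : X.Nonempty) : minCost F r θ π ≤ cost F r θ π X :=
  ciInf_le (bddBelow_range_of_finite _) (⟨X, hX⟩ : {X : Finset V // X.Nonempty})

theorem Lam_lt_zero [Nonempty V] (hr : 2 ≤ r) (hθ0 : 0 ≤ θ) (hθ : θ < θ')
    (h : Lam F r θ ≤ 0) : Lam F r θ' < 0 := by
  obtain ⟨π, hπ⟩ := exists_eq_Lam (F := F) (r := r) (by omega) (hθ0.trans hθ.le)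
  obtain ⟨X, hX, hcost⟩ := exists_cost_eq_minCost (F := F) (r := r) (θ := θ) π
  have h1 : cost F r θ π X ≤ 0 := by
    rw [hcost]
    exact (le_Lam (by omega) hθ0 π).trans h
  rw [← hπ]
  exact ((minCost_le hX).trans_lt (cost_lt_cost hr hθ hX h1)).trans_le h1

theorem continuousOn_Lam [Nonempty V] (F : SimpleGraph V) (hr : 1 ≤ r) :
    ContinuousOn (Lam F r) (Set.Ici 0) := by
  have : Nonempty (V ≃ Fin (Fintype.card V)) := ⟨Fintype.equivFin V⟩
  have h1 : Continuous fun θ => ⨆ π : V ≃ Fin (Fintype.card V), minCost F r θ π := by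
    simp only [← Finset.sup'_univ_eq_ciSup]
    exact Continuous.finset_sup'_apply _ fun π _ => continuous_minCost F r π
  exact h1.continuousOn.congr fun θ hθ => Lam_eq hr hθ

theorem exists_Lam_eq_zero (hr : 2 ≤ r) (hF : F.edgeSet.Nonempty) :
    ∃ θ : ℝ, 0 < θ ∧ θ ≤ 2 ∧ Lam F r θ = 0 ∧
      ∀ θ', 0 ≤ θ' → θ' ≤ 2 → Lam F r θ' = 0 → θ' = θ := by
  have hne : Nonempty V := by
    obtain ⟨e, _⟩ := hF
    induction e using Sym2.ind with
    | _ x y => exact ⟨x⟩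
  have h0 : 0 < Lam F r 0 := by
    refine lt_of_lt_of_le ?_ (le_Lam (by omega) le_rfl (Fintype.equivFin V))
    obtain ⟨X, hX, hcost⟩ := exists_cost_eq_minCost (F := F) (r := r) (θ := 0)
      (Fintype.equivFin V)
    rw [← hcost, cost, Finset.sum_congr rfl fun u _ => weight_zero u]
    simpa using hX
  have h2 : Lam F r 2 < 0 := by
    obtain ⟨π, hπ⟩ := exists_eq_Lam (F := F) (r := r) (θ := 2) (by omega) (by norm_num)
    obtain ⟨X, hX, hneg⟩ := exists_cost_two_neg hr hF π
    rw [← hπ]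
    exact (minCost_le hX).trans_lt hneg
  have hcont : ContinuousOn (Lam F r) (Set.Icc 0 2) :=
    (continuousOn_Lam F (by omega)).mono Set.Icc_subset_Ici_self
  obtain ⟨θ, hθ, hzero⟩ := intermediate_value_Icc' (by norm_num) hcont ⟨h2.le, h0.le⟩
  refine ⟨θ, lt_of_le_of_ne hθ.1 ?_, hθ.2, hzero, fun θ' h0' h2' hzero' => ?_⟩
  · rintro rfl
    exact h0.ne' hzero
  · rcases lt_trichotomy θ θ' with h | h | h
    · exact absurd hzero' (Lam_lt_zero hr hθ.1 h hzero.le).ne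
    · exact h.symm
    · exact absurd hzero (Lam_lt_zero hr h0' h hzero'.le).ne

theorem exists_forall_cost_nonneg [Nonempty V] (hr : 1 ≤ r) (hθ : 0 ≤ θ) (h : Lam F r θ = 0) :
    ∃ π, ∀ X : Finset V, X.Nonempty → 0 ≤ cost F r θ π X := by
  obtain ⟨π, hπ⟩ := exists_eq_Lam (F := F) (r := r) hr hθ
  exact ⟨π, fun X hX => by rw [← h, ← hπ]; exact minCost_le hX⟩

theorem forall_exists_cost_nonpos [Nonempty V] (hr : 1 ≤ r) (hθ : 0 ≤ θ) (h : Lam F r θ = 0)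
    (π : V ≃ Fin (Fintype.card V)) : ∃ X : Finset V, X.Nonempty ∧ cost F r θ π X ≤ 0 := by
  obtain ⟨X, hX, hcost⟩ := exists_cost_eq_minCost (F := F) (r := r) (θ := θ) π
  exact ⟨X, hX, by rw [hcost, ← h]; exact le_Lam hr hθ π⟩

theorem mStar_eq [Nonempty V] (hr : 2 ≤ r) (hθ : 0 < θ) (h : Lam F r θ = 0) :
    mStar F r = 1 / θ := by
  have hlow : ∀ θ', θ < θ' → 1 / θ' ≤ mStar F r := fun θ' hθ' => by
    refine le_mStar (by omega) (hθ.trans hθ') fun π => ?_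
    obtain ⟨X, hX, hcost⟩ := forall_exists_cost_nonpos (by omega) hθ.le h π
    exact ⟨X, hX, (cost_lt_cost hr hθ' hX hcost).trans_le hcost⟩
  refine le_antisymm
    (mStar_le (by omega) hθ (exists_forall_cost_nonneg (by omega) hθ.le h)) ?_
  by_contra! hlt
  have hpos : 0 < mStar F r := lt_of_lt_of_le (by positivity) (hlow (θ + 1) (by linarith))
  obtain ⟨θ', h1, h2⟩ := exists_between ((lt_one_div hpos hθ).1 hlt)
  exact absurd (hlow θ' h1) (not_le.2 ((lt_one_div hpos (hθ.trans h1)).2 h2))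

end Theta

/-! ### Trees of rounds that force a copy -/

/-- The nodes of the complete `r`-ary tree with `k` levels. A node stands for a round. -/
inductive Node (r : ℕ) : ℕ → Type
  | root {k : ℕ} : Node r (k + 1)
  | child {k : ℕ} (j : Fin r) (ν : Node r k) : Node r (k + 1)

/-- The edges of the structure that forces a copy of the ordered graph with vertices `0, 1, …`
(from oldest to youngest) and adjacency `A`. The `j`-th vertex of the round at the root is joined
to the copy that was forced in the `j`-th subtree. The index of an edge does not depend on the
choices of the player, but its older endpoint does. -/
inductive Link (r : ℕ) (A : ℕ → ℕ → Prop) : ℕ → Type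
  | top {k : ℕ} (j : Fin r) (i : Fin k) (h : A i k) : Link r A (k + 1)
  | sub {k : ℕ} (j : Fin r) (e : Link r A k) : Link r A (k + 1)

section Tree

variable {r : ℕ} {A : ℕ → ℕ → Prop}

/-- A node is the root or a node of one of the `r` subtrees. -/
def nodeEquiv (r k : ℕ) : Node r (k + 1) ≃ Option (Fin r × Node r k) where
  toFun
    | .root => none
    | .child j ν => some (j, ν)
  invFun
    | none => .root
    | some (j, ν) => .child j ν
  left_inv := by rintro (_ | _) <;> rfl
  right_inv := by rintro (_ | _) <;> rfl

/-- An edge has its younger endpoint at the root or lies in one of the `r` subtrees. -/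
def linkEquiv (r : ℕ) (A : ℕ → ℕ → Prop) (k : ℕ) :
    Link r A (k + 1) ≃ (Fin r × {i : Fin k // A i k}) ⊕ (Fin r × Link r A k) where
  toFun
    | .top j i h => .inl (j, ⟨i, h⟩)
    | .sub j e => .inr (j, e)
  invFun
    | .inl (j, i) => .top j i.1 i.2
    | .inr (j, e) => .sub j e
  left_inv := by rintro (_ | _) <;> rfl
  right_inv := by rintro (_ | _) <;> rfl

instance finite_node (k : ℕ) : Finite (Node r k) := by
  induction k with
  | zero => exact @Finite.of_subsingleton _ ⟨fun ν => nomatch ν⟩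
  | succ k ih => exact Finite.of_equiv _ (nodeEquiv r k).symm

instance finite_link (k : ℕ) : Finite (Link r A k) := by
  induction k with
  | zero => exact @Finite.of_subsingleton _ ⟨fun e => nomatch e⟩
  | succ k ih => exact Finite.of_equiv _ (linkEquiv r A k).symm

instance (k : ℕ) : Fintype (Node r k) := Fintype.ofFinite _

instance (k : ℕ) : Fintype (Link r A k) := Fintype.ofFinite _

/-- The number of nodes of the complete `r`-ary tree with `k` levels. -/
def treeSize (r : ℕ) : ℕ → ℕ
  | 0 => 0
  | k + 1 => r * treeSize r k + 1

/-- The position of a node in postorder: all descendants of a node come before it. -/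
def Node.pos : {k : ℕ} → Node r k → ℕ
  | k + 1, .root => r * treeSize r k
  | k + 1, .child j ν => j * treeSize r k + ν.pos

theorem Node.pos_lt {k : ℕ} (ν : Node r k) : ν.pos < treeSize r k := by
  induction ν with
  | root => simp [Node.pos, treeSize]
  | @child k j ν ih =>
    have h1 : (j.val + 1) * treeSize r k ≤ r * treeSize r k := Nat.mul_le_mul_right _ j.isLt
    rw [Node.pos, treeSize]
    nlinarith

theorem Node.pos_child_lt {k : ℕ} (j : Fin r) (ν : Node r k) :
    (Node.child j ν).pos < (Node.root : Node r (k + 1)).pos := by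
  have h1 : (j.val + 1) * treeSize r k ≤ r * treeSize r k := Nat.mul_le_mul_right _ j.isLt
  have h2 := ν.pos_lt
  rw [Node.pos, Node.pos]
  nlinarith

theorem Node.pos_injective {k : ℕ} : Function.Injective (Node.pos : Node r k → ℕ) := by
  intro ν
  induction ν with
  | root =>
    intro ν' h
    cases ν' with
    | root => rfl
    | child j ν' => exact absurd h (Node.pos_child_lt j ν').ne'
  | @child k j ν ih =>
    intro ν' h
    cases ν' with
    | root => exact absurd h (Node.pos_child_lt j ν).ne
    | child j' ν' =>
      simp only [Node.pos] at h
      have h1 := ν.pos_lt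
      have h2 := ν'.pos_lt
      have hj : j.val = j'.val := by
        rcases lt_trichotomy j.val j'.val with hlt | heq | hlt
        · have : (j.val + 1) * treeSize r k ≤ j'.val * treeSize r k :=
            Nat.mul_le_mul_right _ hlt
          nlinarith
        · exact heq
        · have : (j'.val + 1) * treeSize r k ≤ j.val * treeSize r k :=
            Nat.mul_le_mul_right _ hlt
          nlinarith
      rw [hj] at h
      rw [Fin.ext hj, ih (Nat.add_left_cancel h)]

/-- The restriction to the `j`-th subtree of an assignment of choices to the nodes. -/
def below {k : ℕ} (c : Node r (k + 1) → Fin r) (j : Fin r) : Node r k → Fin r :=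
  fun ν => c (.child j ν)

/-- The rounds of the copy that is forced if the player makes the choices `c`: the `i`-th vertex of
this copy is the vertex chosen in the round `centre c i`. -/
def centre : {k : ℕ} → (Node r k → Fin r) → Fin k → Node r k
  | 0, _, i => i.elim0
  | _ + 1, c, i =>
    Fin.lastCases .root (fun i => .child (c .root) (centre (below c (c .root)) i)) i

@[simp] theorem centre_last {k : ℕ} (c : Node r (k + 1) → Fin r) :
    centre c (Fin.last k) = .root := by
  rw [centre, Fin.lastCases_last]

@[simp] theorem centre_castSucc {k : ℕ} (c : Node r (k + 1) → Fin r) (i : Fin k) :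
    centre c i.castSucc = .child (c .root) (centre (below c (c .root)) i) := by
  rw [centre, Fin.lastCases_castSucc]

theorem centre_injective {k : ℕ} (c : Node r k → Fin r) : Function.Injective (centre c) := by
  induction k with
  | zero => exact fun i => i.elim0
  | succ k ih =>
    intro i i'
    induction i using Fin.lastCases with
    | last =>
      induction i' using Fin.lastCases with
      | last => simp
      | cast i' => simp
    | cast i =>
      induction i' using Fin.lastCases with
      | last => simp
      | cast i' =>
        intro h
        simp only [centre_castSucc, Node.child.injEq, true_and] at h
        rw [ih _ h]

/-- The younger endpoint of an edge. -/
def Link.src : {k : ℕ} → Link r A k → Node r k × Fin r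
  | _ + 1, .top j _ _ => (.root, j)
  | _ + 1, .sub j e => (.child j e.src.1, e.src.2)

/-- The older endpoint of an edge, given the choices `c`. -/
def Link.tgt : {k : ℕ} → (Node r k → Fin r) → Link r A k → Node r k × Fin r
  | _ + 1, c, .top j i _ => (.child j (centre (below c j) i), c (.child j (centre (below c j) i)))
  | _ + 1, c, .sub j e => (.child j (e.tgt (below c j)).1, (e.tgt (below c j)).2)

theorem Link.pos_tgt_lt {k : ℕ} (c : Node r k → Fin r) (e : Link r A k) :
    (e.tgt c).1.pos < e.src.1.pos := by
  induction e with
  | top j i h => exact Node.pos_child_lt _ _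
  | sub j e ih => simpa [Link.tgt, Link.src, Node.pos] using ih (below c j)

/-- The older endpoint only depends on the choices made before the round of the younger one. -/
theorem Link.tgt_congr {k : ℕ} {c c' : Node r k → Fin r} (e : Link r A k)
    (h : ∀ ν : Node r k, ν.pos < e.src.1.pos → c ν = c' ν) : e.tgt c = e.tgt c' := by
  induction e with
  | top j i _ =>
    have h1 : below c j = below c' j := funext fun ν => h _ (Node.pos_child_lt j ν)
    rw [Link.tgt, Link.tgt, h1, h _ (Node.pos_child_lt _ _)]
  | sub j e ih =>
    have h1 := ih (c := below c j) (c' := below c' j) fun ν hν => h _ (by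
      simpa [Link.src, Node.pos] using hν)
    rw [Link.tgt, Link.tgt, h1]

theorem Link.src_tgt_injective {k : ℕ} (c : Node r k → Fin r) :
    Function.Injective fun e : Link r A k => (e.src, e.tgt c) := by
  intro e
  induction e with
  | top j i h =>
    intro e' he
    cases e' with
    | top j' i' h' =>
      simp only [Link.src, Link.tgt, Prod.mk.injEq, true_and, Node.child.injEq] at he
      obtain ⟨rfl, ⟨-, he⟩, -⟩ := he
      obtain rfl := centre_injective _ he
      rfl
    | sub j' e' => simp [Link.src] at he
  | sub j e ih =>
    intro e' he
    cases e' with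
    | top j' i' h' => simp [Link.src] at he
    | sub j' e' =>
      simp only [Link.src, Link.tgt, Prod.mk.injEq, Node.child.injEq] at he
      obtain ⟨⟨⟨rfl, h1⟩, h2⟩, ⟨-, h3⟩, h4⟩ := he
      rw [ih (below c j) (a₂ := e') (Prod.ext (Prod.ext h1 h2) (Prod.ext h3 h4))]

/-- The edges of the forced copy are present. -/
theorem exists_link {k : ℕ} (c : Node r k → Fin r) {i j : Fin k} (hij : i < j) (h : A i j) :
    ∃ e : Link r A k, e.src = (centre c j, c (centre c j)) ∧
      e.tgt c = (centre c i, c (centre c i)) := by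
  induction k with
  | zero => exact i.elim0
  | succ k ih =>
    induction i using Fin.lastCases with
    | last => exact absurd hij (not_lt.2 (Fin.le_last j))
    | cast i =>
      induction j using Fin.lastCases with
      | last => exact ⟨.top (c .root) i h, by simp [Link.src], by simp [Link.tgt]⟩
      | cast j =>
        obtain ⟨e, h1, h2⟩ := ih (below c (c .root)) (i := i) (j := j) hij h
        exact ⟨.sub (c .root) e, by simp [Link.src, h1, below], by simp [Link.tgt, h2, below]⟩

/-- The edges with both endpoints in rounds of `S`. -/
def linksIn {k : ℕ} (A : ℕ → ℕ → Prop) (c : Node r k → Fin r) (S : Finset (Node r k)) :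
    Finset (Link r A k) :=
  Finset.univ.filter fun e => e.src.1 ∈ S ∧ (e.tgt c).1 ∈ S

/-- The part of `S` in the `j`-th subtree. -/
def subtree {k : ℕ} (S : Finset (Node r (k + 1))) (j : Fin r) : Finset (Node r k) :=
  Finset.univ.filter fun ν => .child j ν ∈ S

theorem card_eq_sum_subtree {k : ℕ} (S : Finset (Node r (k + 1))) :
    S.card = (if .root ∈ S then 1 else 0) + ∑ j, (subtree S j).card := by
  have h1 : S.card = ∑ ν : Node r (k + 1), if ν ∈ S then 1 else 0 := by simp
  rw [h1, ← (nodeEquiv r k).symm.sum_comp, Fintype.sum_option, Fintype.sum_prod_type]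
  congr 1
  refine Finset.sum_congr rfl fun j _ => ?_
  rw [subtree, Finset.card_filter]
  rfl

theorem card_linksIn_succ {k : ℕ} (c : Node r (k + 1) → Fin r) (S : Finset (Node r (k + 1))) :
    (linksIn A c S).card = ∑ j, ((linksIn A (below c j) (subtree S j)).card +
      if .root ∈ S then
        (Finset.univ.filter fun i : Fin k => A i k ∧ centre (below c j) i ∈ subtree S j).card
      else 0) := by
  rw [linksIn, Finset.card_filter, ← (linkEquiv r A k).symm.sum_comp, Fintype.sum_sum_type,
    Fintype.sum_prod_type, Fintype.sum_prod_type, ← Finset.sum_add_distrib]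
  refine Finset.sum_congr rfl fun j _ => ?_
  rw [add_comm]
  congr 1
  · rw [linksIn, Finset.card_filter]
    refine Finset.sum_congr rfl fun e _ => ?_
    simp [linkEquiv, Link.src, Link.tgt, subtree]
  · split_ifs with h
    · rw [← Finset.filter_filter, Finset.card_filter, Finset.sum_subtype _ (p := fun i : Fin k =>
        A i k) (fun i => by simp)]
      refine Finset.sum_congr rfl fun i _ => ?_
      simp [linkEquiv, Link.src, Link.tgt, subtree, h]
    · refine Finset.sum_eq_zero fun i _ => ?_
      simp [linkEquiv, Link.src, h]

end Tree

section TreeCost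

variable {V : Type*} [Fintype V] {F : SimpleGraph V} {r : ℕ} {θ : ℝ}
  {π : V ≃ Fin (Fintype.card V)}

/-- The vertices of the forced copy whose rounds belong to `S`. -/
def centreIn {k : ℕ} (q : ℕ → V) (c : Node r k → Fin r) (S : Finset (Node r k)) : Finset V :=
  (Finset.univ.filter fun i : Fin k => centre c i ∈ S).image fun i : Fin k => q i

/-- If no set of vertices has negative cost, then every substructure of the forcing structure has
nonnegative exponent. -/
theorem cost_centreIn_le (hr : 1 ≤ r) (q : ℕ → V)
    (hq : ∀ i j, i < j → j < Fintype.card V → π (q j) < π (q i))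
    (hcost : ∀ X : Finset V, 0 ≤ cost F r θ π X) {k : ℕ} (hk : k ≤ Fintype.card V)
    (c : Node r k → Fin r) (S : Finset (Node r k)) :
    cost F r θ π (centreIn q c S) +
      θ * ((linksIn (fun i j => F.Adj (q i) (q j)) c S).card : ℝ) ≤ S.card := by
  induction k with
  | zero =>
    have h1 : centreIn q c S = ∅ := by simp [centreIn]
    have h2 : linksIn (fun i j => F.Adj (q i) (q j)) c S = ∅ := by
      ext e
      exact nomatch e
    simp [h1, h2]
  | succ k ih =>
    have hsub : ∀ j, centreIn q (below c j) (subtree S j) ⊆ older π (q k) := by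
      intro j v hv
      obtain ⟨i, -, rfl⟩ := Finset.mem_image.1 hv
      exact (mem_older π).2 (hq i k i.isLt (by omega))
    rw [card_linksIn_succ, card_eq_sum_subtree]
    by_cases hroot : Node.root ∈ S
    · have h1 : centreIn q c S =
          insert (q k) (centreIn q (below c (c .root)) (subtree S (c .root))) := by
        ext v
        simp only [centreIn, Finset.mem_image, Finset.mem_filter, Finset.mem_univ, true_and,
          Finset.mem_insert, subtree]
        constructor
        · rintro ⟨i, hi, rfl⟩
          induction i using Fin.lastCases with
          | last => left; simp
          | cast i => right; exact ⟨i, by simpa using hi, rfl⟩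
        · rintro (rfl | ⟨i, hi, rfl⟩)
          · exact ⟨Fin.last k, by simpa using hroot, by simp⟩
          · exact ⟨i.castSucc, by simpa using hi, rfl⟩
      have hdeg : ∀ j, (Finset.univ.filter fun i : Fin k => F.Adj (q i) (q k) ∧
          centre (below c j) i ∈ subtree S j).card =
            degIn F (q k) (centreIn q (below c j) (subtree S j)) := by
        intro j
        rw [degIn, centreIn, Finset.filter_image, Finset.filter_filter, Finset.card_image_of_injOn]
        · congr 1
          ext i
          simp [and_comm, F.adj_comm]
        · intro i _ i' _ h
          by_contra hne
          rcases lt_or_gt_of_ne hne with hlt | hlt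
          · exact (hq i i' hlt (by omega)).ne (congrArg π h.symm)
          · exact (hq i' i hlt (by omega)).ne (congrArg π h)
      have hj : ∀ j, threat F r θ π (q k) (centreIn q (below c j) (subtree S j)) +
          θ * (((linksIn (fun i j => F.Adj (q i) (q j)) (below c j) (subtree S j)).card +
            (Finset.univ.filter fun i : Fin k => F.Adj (q i) (q k) ∧
              centre (below c j) i ∈ subtree S j).card : ℕ) : ℝ) ≤ (subtree S j).card := by
        intro j
        have := ih (by omega) (below c j) (subtree S j)
        rw [hdeg, threat]
        push_cast
        linarith
      rw [h1, cost_insert F r θ π (hsub _), weight_eq]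
      simp only [hroot, if_true]
      push_cast
      have h2 := Finset.sum_le_sum fun j (_ : j ∈ Finset.univ) => hj j
      rw [Finset.sum_add_distrib, ← Finset.mul_sum] at h2
      push_cast at h2
      have h3 : ((r : ℝ) - 1) * minThreat F r θ π (q k) +
          threat F r θ π (q k) (centreIn q (below c (c .root)) (subtree S (c .root))) ≤
            ∑ j, threat F r θ π (q k) (centreIn q (below c j) (subtree S j)) := by
        rw [← Finset.add_sum_erase _ _ (Finset.mem_univ (c .root)), add_comm]
        refine add_le_add_right ?_ _
        have h4 := Finset.card_nsmul_le_sum (Finset.univ.erase (c .root))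
          (fun j => threat F r θ π (q k) (centreIn q (below c j) (subtree S j)))
          (minThreat F r θ π (q k)) (fun j _ => minThreat_le F r θ π (hsub j))
        rw [Finset.card_erase_of_mem (Finset.mem_univ _), Finset.card_univ, Fintype.card_fin,
          nsmul_eq_mul, Nat.cast_sub hr] at h4
        simpa using h4
      linarith
    · have h1 : centreIn q c S = centreIn q (below c (c .root)) (subtree S (c .root)) := by
        ext v
        simp only [centreIn, Finset.mem_image, Finset.mem_filter, Finset.mem_univ, true_and,
          subtree]
        constructor
        · rintro ⟨i, hi, rfl⟩
          induction i using Fin.lastCases with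
          | last => exact absurd (by simpa using hi) hroot
          | cast i => exact ⟨i, by simpa using hi, rfl⟩
        · rintro ⟨i, hi, rfl⟩
          exact ⟨i.castSucc, by simpa using hi, rfl⟩
      rw [h1]
      simp only [hroot, if_false, add_zero, zero_add]
      push_cast
      have h2 := Finset.sum_le_sum fun j (_ : j ∈ Finset.univ) =>
        ih (by omega) (below c j) (subtree S j)
      rw [Finset.sum_add_distrib, ← Finset.mul_sum] at h2
      have h3 := Finset.single_le_sum
        (f := fun j => cost F r θ π (centreIn q (below c j) (subtree S j)))
        (fun j _ => hcost _) (Finset.mem_univ (c .root))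
      linarith

end TreeCost

/-! ### Every strategy fails above the threshold -/

section SecondMoment

variable {Ω : Type*} [Fintype Ω] [MeasurableSpace Ω] [MeasurableSingletonClass Ω]
  (μ : Measure Ω) [IsFiniteMeasure μ]

theorem measureReal_eq_sum_ite (B : Set Ω) :
    μ.real B = ∑ ω, if ω ∈ B then μ.real {ω} else 0 := by
  rw [← Finset.sum_filter, sum_measureReal_singleton]
  congr 1
  ext ω
  simp

/-- The second moment method, relative to an event `Q`. -/
theorem real_le_mul_real_inter_iUnion {ι : Type*} [Fintype ι] (Q : Set Ω) (A : ι → Set Ω)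
    {C a : ℝ} (ha : 0 < Fintype.card ι * a) (h1 : ∀ x, μ.real (Q ∩ A x) = a * μ.real Q)
    (h2 : ∑ x, ∑ y, μ.real (Q ∩ (A x ∩ A y)) ≤ C * (Fintype.card ι * a) ^ 2 * μ.real Q) :
    μ.real Q ≤ C * μ.real (Q ∩ ⋃ x, A x) := by
  set X : Ω → ℝ := fun ω => ∑ x, if ω ∈ A x then 1 else 0 with hX
  have hfirst : ∑ ω, (if ω ∈ Q then μ.real {ω} else 0) * X ω =
      Fintype.card ι * a * μ.real Q := by
    simp only [hX, Finset.mul_sum]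
    rw [Finset.sum_comm]
    have : ∀ x, ∑ ω, (if ω ∈ Q then μ.real {ω} else 0) * (if ω ∈ A x then 1 else 0) =
        a * μ.real Q := by
      intro x
      rw [← h1 x, measureReal_eq_sum_ite]
      refine Finset.sum_congr rfl fun ω _ => ?_
      by_cases hQ : ω ∈ Q <;> by_cases hA : ω ∈ A x <;> simp [hQ, hA]
    rw [Finset.sum_congr rfl fun x _ => this x]
    simp [mul_assoc]
  have hsecond : ∑ ω, (if ω ∈ Q then μ.real {ω} else 0) * X ω ^ 2 =
      ∑ x, ∑ y, μ.real (Q ∩ (A x ∩ A y)) := by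
    have hsq : ∀ ω, X ω ^ 2 =
        ∑ x, ∑ y, (if ω ∈ A x then (1 : ℝ) else 0) * (if ω ∈ A y then 1 else 0) := fun ω => by
      rw [sq, Finset.sum_mul_sum]
    simp only [hsq, Finset.mul_sum]
    rw [Finset.sum_comm]
    refine Finset.sum_congr rfl fun x _ => ?_
    rw [Finset.sum_comm]
    refine Finset.sum_congr rfl fun y _ => ?_
    rw [measureReal_eq_sum_ite]
    refine Finset.sum_congr rfl fun ω _ => ?_
    by_cases hQ : ω ∈ Q <;> by_cases hA : ω ∈ A x <;> by_cases hB : ω ∈ A y <;>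
      simp [hQ, hA, hB]
  have hcs : (∑ ω, (if ω ∈ Q then μ.real {ω} else 0) * X ω) ^ 2 ≤
      μ.real (Q ∩ ⋃ x, A x) * ∑ ω, (if ω ∈ Q then μ.real {ω} else 0) * X ω ^ 2 := by
    rw [measureReal_eq_sum_ite μ (Q ∩ ⋃ x, A x)]
    refine Finset.sum_sq_le_sum_mul_sum_of_sq_le_mul _ (fun ω _ => ?_) (fun ω _ => ?_)
      fun ω _ => le_of_eq ?_
    · split_ifs <;> simp
    · split_ifs
      · positivity
      · simp
    · by_cases hQ : ω ∈ Q
      · by_cases hA : ω ∈ ⋃ x, A x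
        · simp only [hQ, hA, Set.mem_inter_iff, and_self, if_true]
          ring
        · have hX0 : X ω = 0 := by
            simp only [Set.mem_iUnion, not_exists] at hA
            simp [hX, hA]
          simp [hX0]
      · simp [hQ]
  rw [hfirst, hsecond] at hcs
  rcases (measureReal_nonneg (μ := μ) (s := Q)).eq_or_lt with h0 | h0
  · have : μ.real (Q ∩ ⋃ x, A x) = 0 := by
      refine le_antisymm ?_ measureReal_nonneg
      rw [h0]
      exact measureReal_mono Set.inter_subset_left
    rw [this, ← h0]
    simp
  · have h3 := hcs.trans (mul_le_mul_of_nonneg_left h2 measureReal_nonneg)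
    have h4 : 0 < (Fintype.card ι * a) ^ 2 * μ.real Q := by positivity
    refine le_of_mul_le_mul_left ?_ h4
    linarith

end SecondMoment

section Embedding

variable {N r : ℕ} {A : ℕ → ℕ → Prop} {h m T : ℕ}

theorem move_congr {M : Type} (s : Strategy N r M) {G G' : SimpleGraph (Fin N × Fin r)}
    {i : Fin N} (hG : ∀ x y : Fin N × Fin r, x.1 ≤ i → y.1 ≤ i → (G.Adj x y ↔ G'.Adj x y)) :
    move s G i = move s G' i := by
  unfold move
  congr 1
  ext x y
  exact hG x y x.2 y.2

theorem label_lt (hT : T + treeSize r h * m ≤ N) (x : Node r h → Fin m) (ν : Node r h) :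
    T + (ν.pos * m + (x ν).val) < N := by
  have h1 : (ν.pos + 1) * m ≤ treeSize r h * m := Nat.mul_le_mul_right _ ν.pos_lt
  have h2 := (x ν).isLt
  nlinarith

/-- The round that is assigned to the node `ν`: the rounds from `T` on are divided into intervals
of length `m`, one for every node in postorder, and `x` selects one round from each interval. -/
def label (hT : T + treeSize r h * m ≤ N) (x : Node r h → Fin m) (ν : Node r h) : Fin N :=
  ⟨T + (ν.pos * m + (x ν).val), label_lt hT x ν⟩

theorem label_eq (hT : T + treeSize r h * m ≤ N) {x x' : Node r h → Fin m} {ν ν' : Node r h}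
    (hl : label hT x ν = label hT x' ν') : ν = ν' ∧ x ν = x' ν' := by
  have h1 : T + (ν.pos * m + (x ν).val) = T + (ν'.pos * m + (x' ν').val) := Fin.val_eq_of_eq hl
  have h2 := Nat.add_left_cancel h1
  have hm : 0 < m := (Nat.zero_le _).trans_lt (x ν).isLt
  have h3 : ν.pos = ν'.pos := by
    have := congrArg (· / m) h2
    simpa [Nat.add_div_of_dvd_right, Nat.mul_div_cancel _ hm, Nat.div_eq_of_lt] using this
  obtain rfl := Node.pos_injective h3
  exact ⟨rfl, Fin.ext (Nat.add_left_cancel h2)⟩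

theorem label_lt_label (hT : T + treeSize r h * m ≤ N) (x : Node r h → Fin m) {ν ν' : Node r h}
    (hpos : ν.pos < ν'.pos) : label hT x ν < label hT x ν' := by
  rw [Fin.lt_def]
  have h1 : (ν.pos + 1) * m ≤ ν'.pos * m := Nat.mul_le_mul_right _ hpos
  have h2 := (x ν).isLt
  simp only [label]
  nlinarith

/-- The pair of vertices of the board that corresponds to an edge of the forcing structure, given
the rounds of its nodes and the choices of the player. -/
def linkPair (hT : T + treeSize r h * m ≤ N) (x : Node r h → Fin m) (c : Node r h → Fin r)
    (e : Link r A h) : (Fin N × Fin r) × (Fin N × Fin r) :=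
  ((label hT x e.src.1, e.src.2), (label hT x (e.tgt c).1, (e.tgt c).2))

theorem linkPair_eq (hT : T + treeSize r h * m ≤ N) {x x' : Node r h → Fin m}
    {c c' : Node r h → Fin r} {e e' : Link r A h}
    (hl : linkPair hT x c e = linkPair hT x' c' e') :
    e.src = e'.src ∧ e.tgt c = e'.tgt c' ∧ x e.src.1 = x' e'.src.1 ∧
      x (e.tgt c).1 = x' (e'.tgt c').1 := by
  simp only [linkPair, Prod.mk.injEq] at hl
  obtain ⟨⟨h1, h2⟩, h3, h4⟩ := hl
  exact ⟨Prod.ext (label_eq hT h1).1 h2, Prod.ext (label_eq hT h3).1 h4, (label_eq hT h1).2,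
    (label_eq hT h3).2⟩

theorem linkPair_injective (hT : T + treeSize r h * m ≤ N) (x : Node r h → Fin m)
    (c : Node r h → Fin r) :
    Function.Injective (linkPair hT x c : Link r A h → (Fin N × Fin r) × (Fin N × Fin r)) :=
  fun _ _ he => Link.src_tgt_injective c
    (Prod.ext (linkPair_eq hT he).1 (linkPair_eq hT he).2.1)

theorem linkPair_later (hT : T + treeSize r h * m ≤ N) (x : Node r h → Fin m)
    (c : Node r h → Fin r) (e : Link r A h) :
    T ≤ (linkPair hT x c e).1.1.val ∧ (linkPair hT x c e).2.1 < (linkPair hT x c e).1.1 :=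
  ⟨Nat.le_add_right _ _, label_lt_label hT x (e.pos_tgt_lt c)⟩

/-- The choices that the strategy `s` makes in the rounds assigned to the nodes. -/
def choices (s : Strategy N r (Fin r)) (G : SimpleGraph (Fin N × Fin r))
    (hT : T + treeSize r h * m ≤ N) (x : Node r h → Fin m) : Node r h → Fin r :=
  fun ν => move s G (label hT x ν)

/-- The forcing structure for the actual choices of the player is present at the rounds given by
`x`. -/
def forced (A : ℕ → ℕ → Prop) (s : Strategy N r (Fin r)) (hT : T + treeSize r h * m ≤ N)
    (x : Node r h → Fin m) : Set (SimpleGraph (Fin N × Fin r)) :=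
  {G | ∀ e : Link r A h, G.Adj (linkPair hT x (choices s G hT x) e).1
    (linkPair hT x (choices s G hT x) e).2}

theorem forced_dependsBelow (s : Strategy N r (Fin r)) (hT : T + treeSize r h * m ≤ N)
    (x : Node r h → Fin m) : DependsBelow (T + treeSize r h * m) (forced A s hT x) := by
  intro G G' hG
  have hlt : ∀ ν, (label hT x ν).val < T + treeSize r h * m := fun ν => by
    have h1 : (ν.pos + 1) * m ≤ treeSize r h * m := Nat.mul_le_mul_right _ ν.pos_lt
    have h2 := (x ν).isLt
    simp only [label]
    nlinarith
  have hc : choices s G hT x = choices s G' hT x := funext fun ν =>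
    move_congr s fun a b ha hb => hG a b (lt_of_le_of_lt ha (hlt ν)) (lt_of_le_of_lt hb (hlt ν))
  refine forall_congr' fun e => ?_
  rw [hc]
  exact hG _ _ (hlt _) (hlt _)

/-- Each placement of the forcing structure is present with the same probability, whatever the
strategy, and independently of the past. -/
theorem real_inter_forced (p : unitInterval) {Q : Set (SimpleGraph (Fin N × Fin r))}
    (hQ : DependsBelow T Q) (s : Strategy N r (Fin r)) (hT : T + treeSize r h * m ≤ N)
    (x : Node r h → Fin m) :
    (SimpleGraph.binomialRandom (Fin N × Fin r) p).real (Q ∩ forced A s hT x) =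
      (p : ℝ) ^ Fintype.card (Link r A h) *
        (SimpleGraph.binomialRandom (Fin N × Fin r) p).real Q := by
  set L : Fin N → Finset (Link r A h) := fun i =>
    Finset.univ.filter fun e => label hT x e.src.1 = i with hL
  set D : Fin N → SimpleGraph (Fin N × Fin r) → Finset ((Fin N × Fin r) × (Fin N × Fin r)) :=
    fun i G => (L i).image (linkPair hT x (choices s G hT x)) with hD
  have hset : forced A s hT x = {G | ∀ i, G ∈ present (D i G)} := by
    ext G
    simp only [forced, present, hD, hL, Set.mem_ofPred_eq, Finset.mem_image, Finset.mem_filter,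
      Finset.mem_univ, true_and]
    constructor
    · rintro hG i _ ⟨e, -, rfl⟩
      exact hG e
    · intro hG e
      exact hG _ _ ⟨e, rfl, rfl⟩
  have hcard : ∑ i, (L i).card = Fintype.card (Link r A h) := by
    rw [← Finset.card_univ, Finset.card_eq_sum_card_fiberwise
      (f := fun e : Link r A h => label hT x e.src.1) (t := Finset.univ) (by simp [Set.MapsTo])]
  rw [hset, real_inter_adaptive p hQ D (fun i => (L i).card), hcard]
  · intro i G
    exact Finset.card_image_of_injective _ (linkPair_injective hT x _)
  · intro i G e he
    obtain ⟨e, he', rfl⟩ := Finset.mem_image.1 he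
    have h1 : label hT x e.src.1 = i := (Finset.mem_filter.1 he').2
    rw [← h1]
    exact ⟨rfl, (linkPair_later hT x _ e).2⟩
  · intro i S G G' hG
    have h1 : D i G = D i G' := by
      refine Finset.image_congr fun e he => ?_
      have h1 : label hT x e.src.1 = i := (Finset.mem_filter.1 he).2
      have h2 : e.tgt (choices s G hT x) = e.tgt (choices s G' hT x) := by
        refine e.tgt_congr fun ν hν => move_congr s fun a b ha hb => ?_
        have h3 := label_lt_label hT x hν
        rw [h1] at h3
        exact hG a b (lt_of_le_of_lt ha h3) (lt_of_le_of_lt hb h3)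
      simp only [linkPair, h2]
    simp only [Set.mem_ofPred_eq, h1]
  · intro i hi
    rw [Finset.card_eq_zero, Finset.filter_eq_empty_iff]
    rintro e - rfl
    exact absurd (linkPair_later hT x (fun _ => e.src.2) e).1 (not_le.2 hi)

/-- Two placements share at most the edges between rounds in which they agree. -/
theorem real_inter_forced_inter_le (p : unitInterval) {Q : Set (SimpleGraph (Fin N × Fin r))}
    (hQ : DependsBelow T Q) (s : Strategy N r (Fin r)) (hT : T + treeSize r h * m ≤ N)
    (x y : Node r h → Fin m) :
    (SimpleGraph.binomialRandom (Fin N × Fin r) p).real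
        (Q ∩ (forced A s hT x ∩ forced A s hT y)) ≤
      ∑ c : Node r h → Fin r, ∑ _c' : Node r h → Fin r,
        (p : ℝ) ^ (2 * Fintype.card (Link r A h) -
          (linksIn A c (Finset.univ.filter fun ν => x ν = y ν)).card) *
        (SimpleGraph.binomialRandom (Fin N × Fin r) p).real Q := by
  set μ := SimpleGraph.binomialRandom (Fin N × Fin r) p
  set D : (Node r h → Fin m) → (Node r h → Fin r) →
      Finset ((Fin N × Fin r) × (Fin N × Fin r)) := fun x c =>
    (Finset.univ : Finset (Link r A h)).image (linkPair hT x c) with hD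
  have hsub : Q ∩ (forced A s hT x ∩ forced A s hT y) ⊆
      ⋃ c ∈ (Finset.univ : Finset (Node r h → Fin r)),
        ⋃ c' ∈ (Finset.univ : Finset (Node r h → Fin r)), (Q ∩ present (D x c ∪ D y c')) := by
    rintro G ⟨hGQ, hGx, hGy⟩
    simp only [Set.mem_iUnion, Finset.mem_univ, exists_true_left]
    refine ⟨choices s G hT x, choices s G hT y, hGQ, fun e he => ?_⟩
    rcases Finset.mem_union.1 he with he | he
    · obtain ⟨e, -, rfl⟩ := Finset.mem_image.1 he
      exact hGx e
    · obtain ⟨e, -, rfl⟩ := Finset.mem_image.1 he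
      exact hGy e
  refine (measureReal_mono hsub (measure_ne_top _ _)).trans ((measureReal_biUnion_finset_le _ _).trans
    (Finset.sum_le_sum fun c _ => (measureReal_biUnion_finset_le _ _).trans
      (Finset.sum_le_sum fun c' _ => ?_)))
  rw [real_inter_present p hQ]
  · refine mul_le_mul_of_nonneg_right ?_ measureReal_nonneg
    refine pow_le_pow_of_le_one p.2.1 p.2.2 ?_
    have h1 : ∀ x c, (D x c).card = Fintype.card (Link r A h) := fun x c =>
      Finset.card_image_of_injective _ (linkPair_injective hT x c)
    have h2 : (D x c ∩ D y c').card ≤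
        (linksIn A c (Finset.univ.filter fun ν => x ν = y ν)).card := by
      rw [← Finset.card_image_of_injective _ (linkPair_injective hT x c)]
      refine Finset.card_le_card fun e he => ?_
      rw [Finset.mem_inter] at he
      obtain ⟨e₁, -, rfl⟩ := Finset.mem_image.1 he.1
      obtain ⟨e₂, -, h3⟩ := Finset.mem_image.1 he.2
      obtain ⟨h4, h5, h6, h7⟩ := linkPair_eq hT h3
      refine Finset.mem_image_of_mem _ (Finset.mem_filter.2 ⟨Finset.mem_univ _, ?_, ?_⟩)
      · simp [← h6, h4]
      · simp [← h7, h5]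
    have h3 := Finset.card_union_add_card_inter (D x c) (D y c')
    rw [h1, h1] at h3
    omega
  · intro e he
    rcases Finset.mem_union.1 he with he | he
    · obtain ⟨e, -, rfl⟩ := Finset.mem_image.1 he
      exact linkPair_later hT x c e
    · obtain ⟨e, -, rfl⟩ := Finset.mem_image.1 he
      exact linkPair_later hT y c' e

/-- The number of assignments that agree with a given one on `S`. -/
theorem card_agree_le (x : Node r h → Fin m) (S : Finset (Node r h)) :
    (Finset.univ.filter fun y : Node r h → Fin m =>
      (Finset.univ.filter fun ν => x ν = y ν) = S).card * m ^ S.card ≤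
        Fintype.card (Node r h → Fin m) := by
  have h1 : (Finset.univ.filter fun y : Node r h → Fin m =>
      (Finset.univ.filter fun ν => x ν = y ν) = S) ⊆
        Fintype.piFinset fun ν => if ν ∈ S then {x ν} else Finset.univ := by
    intro y hy
    rw [Finset.mem_filter] at hy
    rw [Fintype.mem_piFinset]
    intro ν
    split_ifs with hν
    · rw [← hy.2] at hν
      simpa [eq_comm] using hν
    · exact Finset.mem_univ _
  have h2 := Finset.card_le_card h1
  rw [Fintype.card_piFinset] at h2
  have h3 : ∏ ν, (if ν ∈ S then ({x ν} : Finset (Fin m)) else Finset.univ).card =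
      m ^ (Sᶜ).card := by
    have : ∀ ν, (if ν ∈ S then ({x ν} : Finset (Fin m)) else Finset.univ).card =
        if ν ∈ Sᶜ then m else 1 := fun ν => by
      by_cases hν : ν ∈ S <;> simp [hν]
    rw [Finset.prod_congr rfl fun ν _ => this ν, Finset.prod_ite_mem, Finset.univ_inter,
      Finset.prod_const]
  rw [h3] at h2
  calc _ ≤ m ^ (Sᶜ).card * m ^ S.card := Nat.mul_le_mul_right _ h2
    _ = Fintype.card (Node r h → Fin m) := by
      rw [← pow_add, add_comm, Finset.card_add_card_compl]
      simp

/-- If all substructures of the forcing structure have nonnegative exponent, then it is present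
with probability bounded away from zero. -/
theorem real_le_mul_real_inter_forced (p : unitInterval) {θ : ℝ} (hm : 1 ≤ m)
    (hp : 1 ≤ (p : ℝ) * (m : ℝ) ^ θ)
    (hA : ∀ (c : Node r h → Fin r) (S : Finset (Node r h)),
      θ * ((linksIn A c S).card : ℝ) ≤ S.card)
    {Q : Set (SimpleGraph (Fin N × Fin r))} (hQ : DependsBelow T Q)
    (s : Strategy N r (Fin r)) (hT : T + treeSize r h * m ≤ N) :
    (SimpleGraph.binomialRandom (Fin N × Fin r) p).real Q ≤
      (Fintype.card (Node r h → Fin r) ^ 2 * 2 ^ Fintype.card (Node r h) : ℝ) *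
        (SimpleGraph.binomialRandom (Fin N × Fin r) p).real (Q ∩ ⋃ x, forced A s hT x) := by
  have := Fintype.ofFinite (SimpleGraph (Fin N × Fin r))
  have hm0 : (0 : ℝ) < m := by exact_mod_cast hm
  have hp0 : 0 < (p : ℝ) := by
    by_contra! hcon
    have : (p : ℝ) * (m : ℝ) ^ θ ≤ 0 :=
      mul_nonpos_of_nonpos_of_nonneg hcon (by positivity)
    linarith
  have : Nonempty (Fin m) := ⟨⟨0, hm⟩⟩
  have hM : (0 : ℝ) < Fintype.card (Node r h → Fin m) := by
    exact_mod_cast Fintype.card_pos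
  set ℓ := Fintype.card (Link r A h) with hℓ
  set μ := SimpleGraph.binomialRandom (Fin N × Fin r) p with hμ
  refine real_le_mul_real_inter_iUnion μ Q (fun x => forced A s hT x) (a := (p : ℝ) ^ ℓ)
    (by positivity) (fun x => real_inter_forced p hQ s hT x) ?_
  have hterm : ∀ (c : Node r h → Fin r) (x : Node r h → Fin m),
      ∑ y : Node r h → Fin m, (p : ℝ) ^ (2 * ℓ -
        (linksIn A c (Finset.univ.filter fun ν => x ν = y ν)).card) ≤
      2 ^ Fintype.card (Node r h) * (Fintype.card (Node r h → Fin m) * (p : ℝ) ^ (2 * ℓ)) := by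
    intro c x
    rw [← Finset.sum_fiberwise' Finset.univ (fun y : Node r h → Fin m => Finset.univ.filter fun ν => x ν = y ν)
      (fun S => (p : ℝ) ^ (2 * ℓ - (linksIn A c S).card))]
    have hS : ∀ S ∈ (Finset.univ : Finset (Finset (Node r h))),
        ∑ _y : Node r h → Fin m with (Finset.univ.filter fun ν => x ν = _y ν) = S,
          (p : ℝ) ^ (2 * ℓ - (linksIn A c S).card) ≤
        Fintype.card (Node r h → Fin m) * (p : ℝ) ^ (2 * ℓ) := by
      intro S _
      rw [Finset.sum_const, nsmul_eq_mul]
      have h1 : ((Finset.univ.filter fun y : Node r h → Fin m =>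
          (Finset.univ.filter fun ν => x ν = y ν) = S).card : ℝ) * (m : ℝ) ^ S.card ≤
            Fintype.card (Node r h → Fin m) := by
        exact_mod_cast card_agree_le x S
      have h2 : (linksIn A c S).card ≤ 2 * ℓ := by
        have := Finset.card_le_univ (linksIn A c S)
        omega
      have h3 : 1 ≤ (m : ℝ) ^ S.card * (p : ℝ) ^ (linksIn A c S).card := by
        calc (1 : ℝ) ≤ ((p : ℝ) * (m : ℝ) ^ θ) ^ (linksIn A c S).card := one_le_pow₀ hp
          _ = (m : ℝ) ^ (θ * ((linksIn A c S).card : ℝ)) * (p : ℝ) ^ (linksIn A c S).card := by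
            rw [mul_pow, mul_comm, Real.rpow_mul hm0.le, Real.rpow_natCast]
          _ ≤ (m : ℝ) ^ (S.card : ℝ) * (p : ℝ) ^ (linksIn A c S).card := by
            refine mul_le_mul_of_nonneg_right ?_ (by positivity)
            exact Real.rpow_le_rpow_of_exponent_le (by exact_mod_cast hm) (hA c S)
          _ = _ := by rw [Real.rpow_natCast]
      have h4 : (p : ℝ) ^ (2 * ℓ) = (p : ℝ) ^ (2 * ℓ - (linksIn A c S).card) *
          (p : ℝ) ^ (linksIn A c S).card := by
        rw [← pow_add, Nat.sub_add_cancel h2]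
      rw [h4]
      set n₀ := ((Finset.univ.filter fun y : Node r h → Fin m =>
          (Finset.univ.filter fun ν => x ν = y ν) = S).card : ℝ)
      set P := (p : ℝ) ^ (2 * ℓ - (linksIn A c S).card)
      have hP : 0 ≤ P := by positivity
      have hn₀ : 0 ≤ n₀ := Nat.cast_nonneg _
      calc n₀ * P ≤ n₀ * P * ((m : ℝ) ^ S.card * (p : ℝ) ^ (linksIn A c S).card) :=
            le_mul_of_one_le_right (by positivity) h3
        _ = (n₀ * (m : ℝ) ^ S.card) * (P * (p : ℝ) ^ (linksIn A c S).card) := by ring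
        _ ≤ _ := mul_le_mul_of_nonneg_right h1 (by positivity)
    refine (Finset.sum_le_sum hS).trans ?_
    simp [Fintype.card_finset]
  calc ∑ x, ∑ y, μ.real (Q ∩ (forced A s hT x ∩ forced A s hT y))
      ≤ ∑ x : Node r h → Fin m, ∑ y : Node r h → Fin m, ∑ c : Node r h → Fin r,
          ∑ _c' : Node r h → Fin r, (p : ℝ) ^ (2 * ℓ -
          (linksIn A c (Finset.univ.filter fun ν => x ν = y ν)).card) * μ.real Q :=
        Finset.sum_le_sum fun x _ => Finset.sum_le_sum fun y _ =>
          real_inter_forced_inter_le p hQ s hT x y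
    _ = ∑ x : Node r h → Fin m, ∑ c : Node r h → Fin r,
          (∑ y : Node r h → Fin m, (p : ℝ) ^ (2 * ℓ -
          (linksIn A c (Finset.univ.filter fun ν => x ν = y ν)).card)) *
            (Fintype.card (Node r h → Fin r) * μ.real Q) := by
        refine Finset.sum_congr rfl fun x _ => ?_
        rw [Finset.sum_comm]
        refine Finset.sum_congr rfl fun c _ => ?_
        rw [Finset.sum_mul]
        refine Finset.sum_congr rfl fun y _ => ?_
        rw [Finset.sum_const, Finset.card_univ, nsmul_eq_mul]
        ring
    _ ≤ ∑ _x : Node r h → Fin m, ∑ _c : Node r h → Fin r,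
          (2 ^ Fintype.card (Node r h) * (Fintype.card (Node r h → Fin m) *
            (p : ℝ) ^ (2 * ℓ))) * (Fintype.card (Node r h → Fin r) * μ.real Q) :=
        Finset.sum_le_sum fun x _ => Finset.sum_le_sum fun c _ =>
          mul_le_mul_of_nonneg_right (hterm c x)
            (mul_nonneg (Nat.cast_nonneg _) measureReal_nonneg)
    _ = _ := by
        simp only [Finset.sum_const, Finset.card_univ, nsmul_eq_mul]
        ring

end Embedding

section UpperBound

variable {V : Type*} [Fintype V] {F : SimpleGraph V} {r : ℕ} {θ : ℝ}
  {π : V ≃ Fin (Fintype.card V)}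

/-- The vertices of `V` from oldest to youngest. -/
def oldest [Nonempty V] (π : V ≃ Fin (Fintype.card V)) (i : ℕ) : V :=
  if hi : i < Fintype.card V then π.symm (Fin.rev ⟨i, hi⟩) else Classical.arbitrary V

theorem oldest_rev [Nonempty V] (v : V) : oldest π (π v).rev = v := by
  rw [oldest, dif_pos (π v).rev.isLt, Fin.eta, Fin.rev_rev, Equiv.symm_apply_apply]

theorem oldest_lt [Nonempty V] (i j : ℕ) (hij : i < j) (hj : j < Fintype.card V) :
    π (oldest π j) < π (oldest π i) := by
  simp [oldest, hj, hij.trans hj, hij]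

theorem isContained_of_forced [Nonempty V] {N m T : ℕ} (s : Strategy N r (Fin r))
    (hT : T + treeSize r (Fintype.card V) * m ≤ N) (x : Node r (Fintype.card V) → Fin m)
    {G : SimpleGraph (Fin N × Fin r)}
    (hG : G ∈ forced (fun i j => F.Adj (oldest π i) (oldest π j)) s hT x) :
    F.IsContained (G.induce (chosen s G)) := by
  set c := choices s G hT x with hc
  set f : V → Fin N × Fin r := fun v =>
    (label hT x (centre c (π v).rev), c (centre c (π v).rev)) with hf
  have hadj : ∀ v w, F.Adj v w → (π v).rev < (π w).rev → G.Adj (f v) (f w) := by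
    intro v w hvw hlt
    obtain ⟨e, h1, h2⟩ := exists_link (A := fun i j => F.Adj (oldest π i) (oldest π j)) c hlt
      (by simpa only [oldest_rev] using hvw)
    have h3 := (hG e).symm
    rw [← hc] at h3
    simpa only [linkPair, h1, h2] using h3
  refine ⟨⟨⟨fun v => ⟨f v, rfl⟩, fun {v w} hvw => ?_⟩, fun v w hvw => ?_⟩⟩
  · change G.Adj (f v) (f w)
    rcases lt_or_gt_of_ne (fun h => hvw.ne (π.injective (Fin.rev_injective h)) :
      (π v).rev ≠ (π w).rev) with h | h
    · exact hadj v w hvw h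
    · exact (hadj w v hvw.symm h).symm
  · have h1 : f v = f w := congrArg Subtype.val hvw
    have h2 := (label_eq hT (congrArg Prod.fst h1)).1
    exact π.injective (Fin.rev_injective (centre_injective c h2))

/-- The constant in the second moment bound for the forcing structure. -/
def forcingConst (r h : ℕ) : ℝ :=
  Fintype.card (Node r h → Fin r) ^ 2 * 2 ^ Fintype.card (Node r h)

theorem one_le_forcingConst (hr : 1 ≤ r) (h : ℕ) : 1 ≤ forcingConst r h := by
  have : Nonempty (Fin r) := ⟨⟨0, hr⟩⟩
  have h1 : (1 : ℝ) ≤ Fintype.card (Node r h → Fin r) := by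
    exact_mod_cast Fintype.card_pos (α := Node r h → Fin r)
  exact one_le_mul_of_one_le_of_one_le (one_le_pow₀ h1) (one_le_pow₀ (by norm_num))

/-- Dividing the rounds into `K` intervals amplifies the second moment bound. -/
theorem real_achlioptasWin_le [Nonempty V] (hr : 1 ≤ r)
    (hcost : ∀ X : Finset V, X.Nonempty → 0 ≤ cost F r θ π X) (p : unitInterval) {N m K : ℕ}
    (hm : 1 ≤ m) (hp : 1 ≤ (p : ℝ) * (m : ℝ) ^ θ)
    (hK : K * (treeSize r (Fintype.card V) * m) ≤ N) (s : Strategy N r (Fin r)) :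
    (SimpleGraph.binomialRandom (Fin N × Fin r) p).real {G | AchlioptasWin F s G} ≤
      (1 - (forcingConst r (Fintype.card V))⁻¹) ^ K := by
  set μ := SimpleGraph.binomialRandom (Fin N × Fin r) p with hμ
  set B := treeSize r (Fintype.card V) with hB
  set C := forcingConst r (Fintype.card V) with hC
  set A : ℕ → ℕ → Prop := fun i j => F.Adj (oldest π i) (oldest π j) with hA
  have hC1 : 1 ≤ C := one_le_forcingConst hr _
  have hcost' : ∀ X : Finset V, 0 ≤ cost F r θ π X := fun X => by
    rcases X.eq_empty_or_nonempty with rfl | hX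
    · simp
    · exact hcost X hX
  have key : ∀ j ≤ K, ∃ Q : Set (SimpleGraph (Fin N × Fin r)),
      DependsBelow (j * (B * m)) Q ∧ {G | AchlioptasWin F s G} ⊆ Q ∧
        μ.real Q ≤ (1 - C⁻¹) ^ j := by
    intro j hj
    induction j with
    | zero => exact ⟨Set.univ, fun _ _ _ => by simp, Set.subset_univ _, by simp [hμ]⟩
    | succ j ih =>
      obtain ⟨Q, hQ, hsub, hle⟩ := ih (by omega)
      have hT : j * (B * m) + B * m ≤ N := by
        have := Nat.mul_le_mul_right (B * m) hj
        rw [Nat.succ_mul] at this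
        omega
      have hbound := real_le_mul_real_inter_forced p (A := A) (θ := θ) hm hp
        (fun c S => by
          have h1 := cost_centreIn_le hr (oldest π) oldest_lt hcost' le_rfl c S
          have h2 := hcost' (centreIn (oldest π) c S)
          linarith) hQ s hT
      refine ⟨Q ∩ (⋃ x, forced A s hT x)ᶜ, ?_, ?_, ?_⟩
      · rw [Nat.succ_mul]
        refine (hQ.mono (Nat.le_add_right _ _)).inter fun G G' hG => not_congr ?_
        simp only [Set.mem_iUnion]
        exact exists_congr fun x => forced_dependsBelow s hT x G G' hG
      · refine Set.subset_inter hsub fun G hG hG' => ?_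
        obtain ⟨x, hx⟩ := Set.mem_iUnion.1 hG'
        exact hG (isContained_of_forced s hT x hx)
      · have h1 : μ.real (Q ∩ ⋃ x, forced A s hT x) +
            μ.real (Q ∩ (⋃ x, forced A s hT x)ᶜ) = μ.real Q :=
          measureReal_inter_add_sdiff (Set.toFinite _).measurableSet (measure_ne_top _ _)
        have h2 : C⁻¹ * μ.real Q ≤ μ.real (Q ∩ ⋃ x, forced A s hT x) := by
          rw [inv_mul_le_iff₀ (by linarith)]
          exact hbound
        have h3 : 0 ≤ 1 - C⁻¹ := sub_nonneg.2 (inv_le_one_of_one_le₀ hC1)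
        calc μ.real (Q ∩ (⋃ x, forced A s hT x)ᶜ) ≤ (1 - C⁻¹) * μ.real Q := by linarith
          _ ≤ (1 - C⁻¹) * (1 - C⁻¹) ^ j := mul_le_mul_of_nonneg_left hle h3
          _ = (1 - C⁻¹) ^ (j + 1) := by ring
  obtain ⟨Q, -, hsub, hle⟩ := key K le_rfl
  exact (measureReal_mono hsub (measure_ne_top _ _)).trans hle

/-- Above the threshold every strategy for the vertex Achlioptas game fails. -/
theorem tendsto_not_achlioptasWin [Nonempty V] (hr : 1 ≤ r) (hθ : 0 < θ)
    (hcost : ∀ X : Finset V, X.Nonempty → 0 ≤ cost F r θ π X) (p : ℕ → unitInterval)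
    (hp : (fun N : ℕ => ((N * r : ℕ) : ℝ) ^ (-θ)) =o[atTop] fun N : ℕ => (p (N * r) : ℝ))
    (s : ∀ N : ℕ, Strategy N r (Fin r)) :
    Tendsto (fun N : ℕ => (SimpleGraph.binomialRandom (Fin N × Fin r) (p (N * r))).real
      {G | ¬ AchlioptasWin F (s N) G}) atTop (𝓝 1) := by
  set C := forcingConst r (Fintype.card V) with hC
  have hC1 : 1 ≤ C := one_le_forcingConst hr _
  have hcompl : ∀ N : ℕ, (SimpleGraph.binomialRandom (Fin N × Fin r) (p (N * r))).real
      {G | ¬ AchlioptasWin F (s N) G} =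
      1 - (SimpleGraph.binomialRandom (Fin N × Fin r) (p (N * r))).real
        {G | AchlioptasWin F (s N) G} := fun N =>
    probReal_compl_eq_one_sub (Set.toFinite _).measurableSet
  have hzero : Tendsto (fun N : ℕ => (SimpleGraph.binomialRandom (Fin N × Fin r)
      (p (N * r))).real {G | AchlioptasWin F (s N) G}) atTop (𝓝 0) := by
    rw [tendsto_order]
    refine ⟨fun a ha => Eventually.of_forall fun N => ha.trans_le measureReal_nonneg,
      fun ε hε => ?_⟩
    have h0 : 0 ≤ 1 - C⁻¹ := sub_nonneg.2 (inv_le_one_of_one_le₀ hC1)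
    have h1 : 1 - C⁻¹ < 1 := by
      have : 0 < C⁻¹ := by positivity
      linarith
    obtain ⟨K, hK⟩ := exists_pow_lt_of_lt_one hε h1
    have hB : 1 ≤ treeSize r (Fintype.card V) := by
      obtain ⟨n, hn⟩ := Nat.exists_eq_succ_of_ne_zero (Fintype.card_ne_zero (α := V))
      rw [hn, treeSize]
      omega
    set D := (K + 1) * treeSize r (Fintype.card V) with hD
    have hD1 : 1 ≤ D := Nat.mul_pos (Nat.succ_pos _) hB
    have hr0 : (0 : ℝ) < r := by exact_mod_cast hr
    have hD0 : (0 : ℝ) < D := by exact_mod_cast hD1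
    have hc : (0 : ℝ) < (2 * D * r : ℝ) ^ (-θ) := Real.rpow_pos_of_pos (by positivity) _
    filter_upwards [hp.def hc, eventually_ge_atTop D] with N hN hND
    have hm : 1 ≤ N / D := (Nat.one_le_div_iff hD1).2 hND
    have hle : (K + 1) * (treeSize r (Fintype.card V) * (N / D)) ≤ N := by
      rw [← mul_assoc]
      exact Nat.mul_div_le N D
    refine lt_of_le_of_lt (real_achlioptasWin_le hr hcost _ hm ?_ hle (s N))
      (lt_of_le_of_lt (pow_le_pow_of_le_one h0 h1.le (Nat.le_succ K)) hK)
    have hN0 : (0 : ℝ) < N := by exact_mod_cast hD1.trans hND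
    have h2 : (N : ℝ) ≤ 2 * D * ((N / D : ℕ) : ℝ) := by
      have h3 := Nat.div_add_mod N D
      have h4 := Nat.mod_lt N hD1
      have h5 : N ≤ 2 * D * (N / D) := by nlinarith
      exact_mod_cast h5
    have hm0 : (0 : ℝ) < ((N / D : ℕ) : ℝ) := by exact_mod_cast hm
    rw [Real.norm_of_nonneg (by positivity), Real.norm_of_nonneg (p (N * r)).2.1] at hN
    have h3 : ((2 * D * r : ℝ) * ((N / D : ℕ) : ℝ)) ^ (-θ) ≤ ((N * r : ℕ) : ℝ) ^ (-θ) := by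
      refine Real.rpow_le_rpow_of_nonpos (by push_cast; positivity) ?_ (by linarith)
      push_cast
      nlinarith
    rw [Real.mul_rpow (by positivity) hm0.le] at h3
    have h4 := le_of_mul_le_mul_left (h3.trans hN) hc
    calc (1 : ℝ) = ((N / D : ℕ) : ℝ) ^ (-θ) * ((N / D : ℕ) : ℝ) ^ θ := by
          rw [← Real.rpow_add hm0]; simp
      _ ≤ _ := mul_le_mul_of_nonneg_right h4 (by positivity)
  simp only [hcompl]
  simpa using hzero.const_sub 1

end UpperBound

/-! ### The balanced Ramsey strategy -/

section Perm

/-- Smaller values of `d` are more dangerous. There is an assignment of colours such that, when two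
vertices exchange their colours, one of the two new pairs is at least as dangerous as the pair of
the first vertex: minimise a total weight that grows exponentially with the rank of the danger. -/
theorem exists_perm_swap {r : ℕ} (d : Fin r → Fin r → ℝ) :
    ∃ σ : Equiv.Perm (Fin r), ∀ v w, v ≠ w →
      d v (σ w) ≤ d v (σ v) ∨ d w (σ v) ≤ d v (σ v) := by
  set rank : Fin r → Fin r → ℕ := fun v c =>
    (Finset.univ.filter fun q : Fin r × Fin r => d v c < d q.1 q.2).card with hrank
  have hlt : ∀ v c v' c', d v c < d v' c' → rank v' c' < rank v c := by
    intro v c v' c' h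
    refine Finset.card_lt_card ((Finset.ssubset_iff_of_subset fun q hq => ?_).2
      ⟨(v', c'), by simpa using h, by simp⟩)
    simp only [Finset.mem_filter, Finset.mem_univ, true_and] at hq ⊢
    exact h.trans hq
  obtain ⟨σ, -, hσ⟩ := Finset.exists_min_image Finset.univ
    (fun σ : Equiv.Perm (Fin r) => ∑ v, 3 ^ rank v (σ v)) ⟨1, Finset.mem_univ _⟩
  refine ⟨σ, fun v w hvw => ?_⟩
  by_contra! hcon
  have h1 := hlt _ _ _ _ hcon.1
  have h2 := hlt _ _ _ _ hcon.2
  have h3 := hσ (σ * Equiv.swap v w) (Finset.mem_univ _)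
  have hsplit : ∀ f : Fin r → ℕ, ∑ z, f z = f v + f w + ∑ z ∈ (Finset.univ.erase v).erase w, f z := by
    intro f
    rw [← Finset.add_sum_erase _ f (Finset.mem_univ v),
      ← Finset.add_sum_erase _ f (Finset.mem_erase.2 ⟨hvw.symm, Finset.mem_univ w⟩), add_assoc]
  rw [hsplit, hsplit] at h3
  have h4 : ∑ z ∈ (Finset.univ.erase v).erase w, 3 ^ rank z ((σ * Equiv.swap v w) z) =
      ∑ z ∈ (Finset.univ.erase v).erase w, 3 ^ rank z (σ z) := by
    refine Finset.sum_congr rfl fun z hz => ?_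
    simp only [Finset.mem_erase, Finset.mem_univ, and_true] at hz
    rw [Equiv.Perm.mul_apply, Equiv.swap_apply_of_ne_of_ne hz.2 hz.1]
  rw [h4] at h3
  simp only [Equiv.Perm.mul_apply, Equiv.swap_apply_left, Equiv.swap_apply_right] at h3
  obtain ⟨k, hk⟩ := Nat.exists_eq_succ_of_ne_zero (Nat.ne_of_gt ((Nat.zero_le _).trans_lt h1))
  rw [hk] at h1 h2 h3
  have h5 : 3 ^ rank v (σ w) ≤ 3 ^ k := Nat.pow_le_pow_right (by norm_num) (Nat.le_of_lt_succ h1)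
  have h6 : 3 ^ rank w (σ v) ≤ 3 ^ k := Nat.pow_le_pow_right (by norm_num) (Nat.le_of_lt_succ h2)
  have h7 : 3 ^ (k + 1) = 3 * 3 ^ k := pow_succ' 3 k
  have h8 : 0 < 3 ^ k := by positivity
  rw [Nat.succ_eq_add_one, h7] at h3
  have h9 : 0 ≤ 3 ^ rank w (σ w) := Nat.zero_le _
  linarith

/-- An assignment of the colours to the vertices of a round as in `exists_perm_swap`. -/
def swapOptimal {r : ℕ} (d : Fin r → Fin r → ℝ) : Equiv.Perm (Fin r) :=
  (exists_perm_swap d).choose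

theorem swapOptimal_spec {r : ℕ} (d : Fin r → Fin r → ℝ) {v w : Fin r} (hvw : v ≠ w) :
    d v (swapOptimal d w) ≤ d v (swapOptimal d v) ∨
      d w (swapOptimal d v) ≤ d v (swapOptimal d v) :=
  (exists_perm_swap d).choose_spec v w hvw

end Perm

section Play

variable {N r : ℕ} (θ : ℝ) (D : ℕ) (G : SimpleGraph (Fin N × Fin r))

/-- The edges between vertices of different rounds in `S`, directed to the earlier endpoint. -/
def roundEdges (S : Finset (Fin N)) : Finset ((Fin N × Fin r) × (Fin N × Fin r)) :=
  Finset.univ.filter fun e => e.1.1 ∈ S ∧ e.2.1 ∈ S ∧ e.2.1 < e.1.1 ∧ G.Adj e.1 e.2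

/-- The exponent of the structure that `G` induces on the rounds in `S`. -/
def excess (S : Finset (Fin N)) : ℝ := S.card - θ * ((roundEdges G S).card : ℝ)

/-- The neighbours of the vertex `x` that have colour `c` and belong to rounds in `S`. -/
def colourNbrs (col : Fin N → Equiv.Perm (Fin r)) (x : Fin N × Fin r) (c : Fin r)
    (S : Finset (Fin N)) : Finset (Fin N × Fin r) :=
  Finset.univ.filter fun y => y.1 ∈ S ∧ col y.1 y.2 = c ∧ G.Adj x y

/-- The sets of at most `D` rounds before round `i`. -/
def earlierSets (D : ℕ) (i : Fin N) : Finset (Finset (Fin N)) :=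
  Finset.univ.filter fun S => (∀ j ∈ S, j < i) ∧ S.card ≤ D

theorem earlierSets_nonempty (D : ℕ) (i : Fin N) : (earlierSets D i).Nonempty :=
  ⟨∅, by simp [earlierSets]⟩

/-- How dangerous it is to give colour `c` to the `v`-th vertex of round `i`: the exponent of the
rarest bounded structure in the past to which this vertex is joined in colour `c`. Smaller values
are more dangerous. -/
def danger (col : Fin N → Equiv.Perm (Fin r)) (i : Fin N) (v c : Fin r) : ℝ :=
  (earlierSets D i).inf' (earlierSets_nonempty D i) fun S =>
    excess θ G S - θ * ((colourNbrs G col (i, v) c S).card : ℝ)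

/-- The colouring of the strategy: in every round the colours are assigned by `swapOptimal` with
respect to `danger`. -/
def play (i : Fin N) : Equiv.Perm (Fin r) :=
  swapOptimal (danger θ D G (fun j => if _h : j < i then play j else 1) i)
termination_by i.val
decreasing_by exact _h

variable {θ D G}

theorem danger_congr {G' : SimpleGraph (Fin N × Fin r)} {col col' : Fin N → Equiv.Perm (Fin r)}
    {i : Fin N} (hG : ∀ x y : Fin N × Fin r, x.1 ≤ i → y.1 ≤ i → (G.Adj x y ↔ G'.Adj x y))
    (hcol : ∀ j < i, col j = col' j) : danger θ D G col i = danger θ D G' col' i := by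
  ext v c
  refine Finset.inf'_congr _ rfl fun S hS => ?_
  have hS' : ∀ j ∈ S, j < i := (Finset.mem_filter.1 hS).2.1
  have h1 : roundEdges G S = roundEdges G' S := by
    refine Finset.filter_congr fun e _ => ?_
    refine and_congr_right fun he1 => and_congr_right fun he2 => and_congr_right fun _ => ?_
    exact hG _ _ (hS' _ he1).le (hS' _ he2).le
  have h2 : colourNbrs G col (i, v) c S = colourNbrs G' col' (i, v) c S := by
    refine Finset.filter_congr fun y _ => and_congr_right fun hy => ?_
    rw [hcol _ (hS' _ hy), hG _ _ le_rfl (hS' _ hy).le]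
  rw [excess, excess, h1, h2]

theorem play_eq (i : Fin N) :
    play θ D G i = swapOptimal (danger θ D G (play θ D G) i) := by
  rw [play]
  congr 1
  exact danger_congr (fun _ _ _ _ => Iff.rfl) fun j hj => by simp [hj]

theorem play_congr {G' : SimpleGraph (Fin N × Fin r)} {i : Fin N}
    (hG : ∀ x y : Fin N × Fin r, x.1 ≤ i → y.1 ≤ i → (G.Adj x y ↔ G'.Adj x y)) :
    play θ D G i = play θ D G' i := by
  induction hn : i.val using Nat.strong_induction_on generalizing i with
  | _ n ih =>
  rw [play_eq, play_eq]
  congr 1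
  refine danger_congr hG fun j hj => ih j.val (hn ▸ hj) (fun x y hx hy => ?_) rfl
  exact hG x y (hx.trans hj.le) (hy.trans hj.le)

/-- The strategy that plays by `play`. -/
def playStrategy (θ : ℝ) (D N r : ℕ) : Strategy N r (Equiv.Perm (Fin r)) :=
  fun i H => play θ D H.spanningCoe i

theorem move_playStrategy (i : Fin N) : move (playStrategy θ D N r) G i = play θ D G i := by
  refine play_congr fun x y hx hy => ?_
  simp only [SimpleGraph.map_adj, SimpleGraph.comap_adj, Function.Embedding.subtype_apply]
  constructor
  · rintro ⟨a, b, h, rfl, rfl⟩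
    exact h
  · intro h
    exact ⟨⟨x, hx⟩, ⟨y, hy⟩, h, rfl, rfl⟩

@[simp] theorem excess_empty : excess θ G ∅ = 0 := by simp [excess, roundEdges]

theorem excess_submodular (hθ : 0 ≤ θ) (S T : Finset (Fin N)) :
    excess θ G (S ∩ T) + excess θ G (S ∪ T) ≤ excess θ G S + excess θ G T := by
  have h1 : ((S ∪ T).card : ℝ) + (S ∩ T).card = S.card + T.card := by
    exact_mod_cast Finset.card_union_add_card_inter S T
  have h2 : (roundEdges G S).card + (roundEdges G T).card ≤
      (roundEdges G (S ∪ T)).card + (roundEdges G (S ∩ T)).card := by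
    rw [← Finset.card_union_add_card_inter]
    refine Nat.add_le_add (Finset.card_le_card ?_) (Finset.card_le_card ?_)
    · intro e
      simp only [roundEdges, Finset.mem_filter, Finset.mem_univ, true_and, Finset.mem_union]
      tauto
    · intro e
      simp only [roundEdges, Finset.mem_filter, Finset.mem_univ, true_and, Finset.mem_inter]
      tauto
  have h3 : ((roundEdges G S).card : ℝ) + (roundEdges G T).card ≤
      (roundEdges G (S ∪ T)).card + (roundEdges G (S ∩ T)).card := by exact_mod_cast h2
  simp only [excess]
  nlinarith

/-- No nonempty set of at most `D` rounds has exponent at most zero. -/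
def Sparse (θ : ℝ) (D : ℕ) (G : SimpleGraph (Fin N × Fin r)) : Prop :=
  ∀ S : Finset (Fin N), S.Nonempty → S.card ≤ D → 0 < excess θ G S

/-- In a sparse graph, overlaps of structures do not increase the exponent of their union. -/
theorem excess_biUnion_le {ι : Type*} (hθ : 0 ≤ θ)
    (hG : ∀ S : Finset (Fin N), S.card ≤ D → 0 ≤ excess θ G S) (s : Finset ι)
    (S : ι → Finset (Fin N)) (hS : ∀ a ∈ s, (S a).card ≤ D) :
    excess θ G (s.biUnion S) ≤ ∑ a ∈ s, excess θ G (S a) := by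
  induction s using Finset.induction_on with
  | empty => simp
  | insert a s ha ih =>
    rw [Finset.biUnion_insert, Finset.sum_insert ha]
    have h1 := ih fun b hb => hS b (Finset.mem_insert_of_mem hb)
    have h2 := excess_submodular (G := G) hθ (S a) (s.biUnion S)
    have h3 := hG (S a ∩ s.biUnion S)
      ((Finset.card_le_card Finset.inter_subset_left).trans (hS a (Finset.mem_insert_self _ _)))
    linarith

/-- The exponent of a round together with structures in the past to which different
vertex-colour pairs of this round are joined. -/
theorem excess_insert_biUnion_le {ι : Type*} [Fintype ι] (hθ : 0 ≤ θ)
    (hG : ∀ S : Finset (Fin N), S.card ≤ D → 0 ≤ excess θ G S)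
    (col : Fin N → Equiv.Perm (Fin r)) (i : Fin N) (q : ι → Fin r × Fin r)
    (hq : Function.Injective q) (S : ι → Finset (Fin N)) (hS : ∀ a, S a ∈ earlierSets D i) :
    excess θ G (insert i (Finset.univ.biUnion S)) ≤
      1 + ∑ a, (excess θ G (S a) - θ * ((colourNbrs G col (i, (q a).1) (q a).2 (S a)).card : ℝ)) := by
  have hS' : ∀ a, (∀ j ∈ S a, j < i) ∧ (S a).card ≤ D := fun a => (Finset.mem_filter.1 (hS a)).2
  set U := Finset.univ.biUnion S with hU
  have hUi : ∀ j ∈ U, j < i := fun j hj => by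
    obtain ⟨a, -, ha⟩ := Finset.mem_biUnion.1 hj
    exact (hS' a).1 j ha
  set E : ι → Finset ((Fin N × Fin r) × (Fin N × Fin r)) := fun a =>
    (colourNbrs G col (i, (q a).1) (q a).2 (S a)).image fun y => ((i, (q a).1), y) with hE
  have hEcard : ∀ a, (E a).card = (colourNbrs G col (i, (q a).1) (q a).2 (S a)).card := fun a =>
    Finset.card_image_of_injective _ (Prod.mk_right_injective _)
  have hEdisj : Set.PairwiseDisjoint (↑(Finset.univ : Finset ι)) E := by
    intro a _ b _ hab
    refine Finset.disjoint_left.2 fun e ha hb => hab (hq ?_)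
    obtain ⟨y, hy, rfl⟩ := Finset.mem_image.1 ha
    obtain ⟨y', hy', h⟩ := Finset.mem_image.1 hb
    simp only [Prod.mk.injEq, true_and] at h
    obtain ⟨h1, rfl⟩ := h
    exact Prod.ext h1.symm
      ((Finset.mem_filter.1 hy).2.2.1.symm.trans (Finset.mem_filter.1 hy').2.2.1)
  have hsub : roundEdges G U ∪ Finset.univ.biUnion E ⊆ roundEdges G (insert i U) := by
    intro e he
    rcases Finset.mem_union.1 he with he | he
    · simp only [roundEdges, Finset.mem_filter, Finset.mem_univ, true_and,
        Finset.mem_insert] at he ⊢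
      tauto
    · obtain ⟨a, -, he⟩ := Finset.mem_biUnion.1 he
      obtain ⟨y, hy, rfl⟩ := Finset.mem_image.1 he
      simp only [colourNbrs, Finset.mem_filter, Finset.mem_univ, true_and] at hy
      simp only [roundEdges, Finset.mem_filter, Finset.mem_univ, true_and, Finset.mem_insert]
      exact ⟨Or.inl trivial, Or.inr (Finset.mem_biUnion.2 ⟨a, Finset.mem_univ _, hy.1⟩),
        (hS' a).1 _ hy.1, hy.2.2⟩
  have hdisj : Disjoint (roundEdges G U) (Finset.univ.biUnion E) := by
    refine Finset.disjoint_left.2 fun e h1 h2 => ?_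
    obtain ⟨a, -, he⟩ := Finset.mem_biUnion.1 h2
    obtain ⟨y, -, rfl⟩ := Finset.mem_image.1 he
    exact lt_irrefl _ (hUi i (Finset.mem_filter.1 h1).2.1)
  have hcard : (roundEdges G U).card +
      ∑ a, (colourNbrs G col (i, (q a).1) (q a).2 (S a)).card ≤
        (roundEdges G (insert i U)).card := by
    have := Finset.card_le_card hsub
    rwa [Finset.card_union_of_disjoint hdisj, Finset.card_biUnion (fun a _ b _ hab => hEdisj
      (Finset.mem_coe.2 (Finset.mem_univ a)) (Finset.mem_coe.2 (Finset.mem_univ b)) hab),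
      Finset.sum_congr rfl fun a _ => hEcard a] at this
  have hcard' : ((roundEdges G U).card : ℝ) +
      ∑ a, ((colourNbrs G col (i, (q a).1) (q a).2 (S a)).card : ℝ) ≤
        (roundEdges G (insert i U)).card := by exact_mod_cast hcard
  have h1 := excess_biUnion_le hθ hG Finset.univ S fun a _ => (hS' a).2
  have h2 : ((insert i U).card : ℝ) = U.card + 1 := by
    rw [Finset.card_insert_of_notMem fun h => lt_irrefl _ (hUi i h)]
    push_cast
    ring
  have h3 : excess θ G U = U.card - θ * ((roundEdges G U).card : ℝ) := rfl
  have h4 := mul_le_mul_of_nonneg_left hcard' hθ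
  rw [Finset.sum_sub_distrib, ← Finset.mul_sum, excess, h2]
  rw [← hU] at h1
  nlinarith

end Play

section Witness

variable {V : Type*} [Fintype V] {F : SimpleGraph V} {r N D : ℕ} {θ θ' : ℝ}
  {π : V ≃ Fin (Fintype.card V)} {G : SimpleGraph (Fin N × Fin r)}

theorem excess_eq (hθ : θ ≠ 0) (S : Finset (Fin N)) :
    excess θ' G S = (θ - θ') / θ * S.card + θ' / θ * excess θ G S := by
  rw [excess, excess]
  field_simp
  ring

theorem cost_le_card (hr : 1 ≤ r) (hθ : 0 ≤ θ) (X : Finset V) : cost F r θ π X ≤ X.card := by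
  have h1 : ∑ u ∈ X, weight F r θ π u ≤ ∑ _u ∈ X, (1 : ℝ) :=
    Finset.sum_le_sum fun u _ => weight_le_one F r θ π hr u
  have h2 : 0 ≤ θ * ((innerEdges F π X).card : ℝ) := by positivity
  rw [cost]
  simp only [Finset.sum_const, nsmul_eq_mul, mul_one] at h1
  linarith

/-- Suppose that the strategy creates the vertices `φ v` in one colour, in the time order given
by `π`. Then any set `X` of them is contained in a bounded structure whose exponent is at most the
cost of `X`. It is built by adding, from the oldest to the youngest vertex `u`, the round of `u`
and for each other vertex of this round a structure that makes a vertex-colour pair at least as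
dangerous as the one of `u`. -/
theorem exists_witness (hr : 1 ≤ r) (hθ' : 0 ≤ θ') (hθ : 0 < θ) (hlt : θ' < θ)
    (hD : Fintype.card V * θ ≤ D * (θ - θ')) (hG : Sparse θ (1 + r * D) G)
    (φ : V → Fin N × Fin r) (hφ : ∀ v w, F.Adj v w → G.Adj (φ v) (φ w))
    (hπ : ∀ v w, π v < π w ↔ (φ w).1 < (φ v).1) (c : Fin r)
    (hc : ∀ v, play θ' D G (φ v).1 (φ v).2 = c) (n : ℕ) (X : Finset V)
    (hX : ∀ v ∈ X, (φ v).1.val < n) :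
    ∃ S : Finset (Fin N), (∀ v ∈ X, (φ v).1 ∈ S) ∧ (∀ b ∈ S, b.val < n) ∧ S.card ≤ D ∧
      excess θ' G S ≤ cost F r θ' π X := by
  have hnonneg : ∀ S : Finset (Fin N), S.card ≤ 1 + r * D → 0 ≤ excess θ G S := fun S hS => by
    rcases S.eq_empty_or_nonempty with rfl | hne
    · simp
    · exact (hG S hne hS).le
  have hnonneg' : ∀ S : Finset (Fin N), S.card ≤ 1 + r * D → 0 ≤ excess θ' G S := fun S hS => by
    rw [excess_eq hθ.ne']
    have := hnonneg S hS
    have h1 : 0 ≤ (θ - θ') / θ := div_nonneg (by linarith) hθ.le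
    positivity
  have hDle : D ≤ 1 + r * D := by nlinarith
  -- Sparseness turns an upper bound on the exponent into an upper bound on the size.
  have hsize : ∀ (S : Finset (Fin N)) (X : Finset V), S.card ≤ 1 + r * D →
      excess θ' G S ≤ cost F r θ' π X → S.card ≤ D := by
    intro S X hS hle
    have h1 := hnonneg S hS
    rw [excess_eq hθ.ne'] at hle
    have h2 : 0 ≤ θ' / θ * excess θ G S := by positivity
    have h3 := cost_le_card (F := F) (π := π) hr hθ' X
    have h4 : ((X.card : ℕ) : ℝ) ≤ Fintype.card V := by exact_mod_cast Finset.card_le_univ X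
    have h5 : (θ - θ') / θ * S.card ≤ Fintype.card V := by linarith
    rw [div_mul_eq_mul_div, div_le_iff₀ hθ] at h5
    have h6 : (θ - θ') * (S.card : ℝ) ≤ (θ - θ') * D := by linarith
    exact_mod_cast le_of_mul_le_mul_left h6 (by linarith)
  have hinj : Function.Injective φ := fun v w h => by
    by_contra hne
    rcases lt_or_gt_of_ne (fun h => hne (π.injective h) : π v ≠ π w) with hlt' | hlt'
    · exact ((hπ _ _).1 hlt').ne (congrArg Prod.fst h.symm)
    · exact ((hπ _ _).1 hlt').ne (congrArg Prod.fst h)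
  induction n generalizing X with
  | zero =>
    refine ⟨∅, fun v hv => absurd (hX v hv) (Nat.not_lt_zero _), by simp, by simp, ?_⟩
    rcases X.eq_empty_or_nonempty with rfl | ⟨v, hv⟩
    · simp
    · exact absurd (hX v hv) (Nat.not_lt_zero _)
  | succ n ih =>
    by_cases hu : ∃ u ∈ X, (φ u).1.val = n
    swap
    · push Not at hu
      obtain ⟨S, h1, h2, h3, h4⟩ := ih X fun v hv =>
        lt_of_le_of_ne (Nat.le_of_lt_succ (hX v hv)) (hu v hv)
      exact ⟨S, h1, fun b hb => (h2 b hb).trans (Nat.lt_succ_self n), h3, h4⟩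
    obtain ⟨u, huX, hun⟩ := hu
    set i := (φ u).1 with hi
    have hXu : X.erase u ⊆ older π u := fun w hw => by
      rw [Finset.mem_erase] at hw
      rw [mem_older, hπ]
      refine lt_of_le_of_ne (Fin.le_def.2 ?_) fun h => hw.1 ?_
      · rw [← hi, hun]
        exact Nat.le_of_lt_succ (hX w hw.2)
      · by_contra hne
        rcases lt_or_gt_of_ne (fun h => hne (π.injective h) : π w ≠ π u) with hlt' | hlt'
        · exact ((hπ _ _).1 hlt').ne h.symm
        · exact ((hπ _ _).1 hlt').ne h
    have hold : ∀ J ⊆ older π u, ∀ v ∈ J, (φ v).1.val < n := fun J hJ v hv => by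
      have := (hπ _ _).1 ((mem_older π).1 (hJ hv))
      rw [← hun]
      exact this
    -- The structure of an older set is one of those considered by `danger` at the round of `u`.
    have hthreat : ∀ (J : Finset V) (S : Finset (Fin N)), J ⊆ older π u →
        (∀ v ∈ J, (φ v).1 ∈ S) → excess θ' G S ≤ cost F r θ' π J →
        excess θ' G S - θ' * ((colourNbrs G (play θ' D G) (i, (φ u).2) c S).card : ℝ) ≤
          threat F r θ' π u J := by
      intro J S hJ hJS hle
      have h1 : degIn F u J ≤ (colourNbrs G (play θ' D G) (i, (φ u).2) c S).card := by
        rw [degIn, ← Finset.card_image_of_injective _ hinj]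
        refine Finset.card_le_card fun y hy => ?_
        obtain ⟨w, hw, rfl⟩ := Finset.mem_image.1 hy
        rw [Finset.mem_filter] at hw
        exact Finset.mem_filter.2 ⟨Finset.mem_univ _, hJS w hw.1, hc w, hφ u w hw.2⟩
      have h2 : (degIn F u J : ℝ) ≤ (colourNbrs G (play θ' D G) (i, (φ u).2) c S).card := by
        exact_mod_cast h1
      rw [threat]
      nlinarith
    have hearlier : ∀ S : Finset (Fin N), (∀ b ∈ S, b.val < n) → S.card ≤ D →
        S ∈ earlierSets D i := fun S h1 h2 =>
      Finset.mem_filter.2 ⟨Finset.mem_univ _, fun b hb => by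
        rw [Fin.lt_def, hun]; exact h1 b hb, h2⟩
    obtain ⟨J, hJ, hJmin⟩ := exists_minThreat F r θ' π u
    obtain ⟨SJ, hSJ1, hSJ2, hSJ3, hSJ4⟩ := ih J (hold J hJ)
    obtain ⟨S', hS'1, hS'2, hS'3, hS'4⟩ := ih (X.erase u) (hold _ hXu)
    set d := danger θ' D G (play θ' D G) i with hd
    have hduc : d (φ u).2 c ≤ minThreat F r θ' π u := by
      rw [← hJmin]
      exact (Finset.inf'_le _ (hearlier SJ hSJ2 hSJ3)).trans (hthreat J SJ hJ hSJ1 hSJ4)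
    set σ := play θ' D G i with hσ
    have hσu : σ (φ u).2 = c := hc u
    have hswap : ∀ v, v ≠ (φ u).2 → d (φ u).2 (σ v) ≤ d (φ u).2 c ∨ d v c ≤ d (φ u).2 c := by
      intro v hv
      have := swapOptimal_spec d (v := (φ u).2) (w := v) hv.symm
      rw [hd, ← play_eq, ← hσ, hσu, ← hd] at this
      exact this
    -- One dangerous vertex-colour pair for every vertex of the round of `u`.
    set q : Fin r → Fin r × Fin r := fun v =>
      if v = (φ u).2 then ((φ u).2, c)
      else if d (φ u).2 (σ v) ≤ d (φ u).2 c then ((φ u).2, σ v) else (v, c) with hq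
    have hqu : q (φ u).2 = ((φ u).2, c) := by simp [hq]
    have hqd : ∀ v, v ≠ (φ u).2 → d (q v).1 (q v).2 ≤ minThreat F r θ' π u := by
      intro v hv
      refine le_trans ?_ hduc
      simp only [hq, if_neg hv]
      split_ifs with h
      · exact h
      · exact (hswap v hv).resolve_left h
    have hqinj : Function.Injective q := by
      have hσne : ∀ v, v ≠ (φ u).2 → σ v ≠ c := fun v hv h =>
        hv (σ.injective (h.trans hσu.symm))
      intro v w hvw
      simp only [hq] at hvw
      split_ifs at hvw with h1 h2 h3 h4 h5 h6 h7 h8 <;> simp only [Prod.mk.injEq] at hvw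
      · rw [h1, h2]
      · exact absurd hvw.2.symm (hσne w h2)
      · exact absurd hvw.1.symm h2
      · exact absurd hvw.2 (hσne v h1)
      · exact σ.injective hvw.2
      · exact absurd hvw.1.symm (by assumption)
      · exact absurd hvw.1 h1
      · exact absurd hvw.1 h1
      · exact hvw.1
    have hch : ∀ v, ∃ S ∈ earlierSets D i, excess θ' G S -
        θ' * ((colourNbrs G (play θ' D G) (i, (q v).1) (q v).2 S).card : ℝ) =
          d (q v).1 (q v).2 := fun v => by
      obtain ⟨S, hS, h⟩ := Finset.exists_mem_eq_inf' (earlierSets_nonempty D i) (fun S =>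
        excess θ' G S - θ' * ((colourNbrs G (play θ' D G) (i, (q v).1) (q v).2 S).card : ℝ))
      exact ⟨S, hS, h.symm⟩
    choose S₀ hS₀ hS₀d using hch
    set S : Fin r → Finset (Fin N) := fun v => if v = (φ u).2 then S' else S₀ v with hS
    have hSe : ∀ v, S v ∈ earlierSets D i := fun v => by
      simp only [hS]
      split_ifs
      · exact hearlier S' hS'2 hS'3
      · exact hS₀ v
    have hbound := excess_insert_biUnion_le hθ' (fun S hS => hnonneg' S (hS.trans hDle))
      (play θ' D G) i q hqinj S hSe
    have hcost : excess θ' G (insert i (Finset.univ.biUnion S)) ≤ cost F r θ' π X := by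
      refine hbound.trans ?_
      rw [← Finset.add_sum_erase _ _ (Finset.mem_univ (φ u).2), ← Finset.insert_erase huX,
        cost_insert F r θ' π hXu, weight_eq]
      have h1 : excess θ' G (S (φ u).2) - θ' * ((colourNbrs G (play θ' D G)
          (i, (q (φ u).2).1) (q (φ u).2).2 (S (φ u).2)).card : ℝ) ≤
            threat F r θ' π u (X.erase u) := by
        rw [hqu]
        simp only [hS, if_true]
        exact hthreat _ S' hXu hS'1 hS'4
      have h2 : ∑ v ∈ Finset.univ.erase (φ u).2, (excess θ' G (S v) -
          θ' * ((colourNbrs G (play θ' D G) (i, (q v).1) (q v).2 (S v)).card : ℝ)) ≤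
            ((r : ℝ) - 1) * minThreat F r θ' π u := by
        have := Finset.sum_le_card_nsmul (Finset.univ.erase (φ u).2) (fun v =>
          excess θ' G (S v) - θ' * ((colourNbrs G (play θ' D G)
            (i, (q v).1) (q v).2 (S v)).card : ℝ)) (minThreat F r θ' π u) fun v hv => by
          have hv' := Finset.ne_of_mem_erase hv
          simp only [hS, if_neg hv']
          rw [hS₀d]
          exact hqd v hv'
        rwa [Finset.card_erase_of_mem (Finset.mem_univ _), Finset.card_univ, Fintype.card_fin,
          nsmul_eq_mul, Nat.cast_sub hr, Nat.cast_one] at this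
      linarith
    have hcard : (insert i (Finset.univ.biUnion S)).card ≤ 1 + r * D := by
      have h1 : (Finset.univ.biUnion S).card ≤ r * D := by
        have := Finset.card_biUnion_le_card_mul Finset.univ S D fun v _ =>
          (Finset.mem_filter.1 (hSe v)).2.2
        simpa using this
      have h2 := Finset.card_insert_le i (Finset.univ.biUnion S)
      omega
    refine ⟨insert i (Finset.univ.biUnion S), fun v hv => ?_, fun b hb => ?_,
      hsize _ X hcard hcost, hcost⟩
    · by_cases hvu : v = u
      · rw [hvu]
        exact Finset.mem_insert_self _ _
      · refine Finset.mem_insert_of_mem (Finset.mem_biUnion.2 ⟨(φ u).2, Finset.mem_univ _, ?_⟩)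
        simp only [hS, if_true]
        exact hS'1 v (Finset.mem_erase.2 ⟨hvu, hv⟩)
    · rcases Finset.mem_insert.1 hb with rfl | hb
      · rw [hun]
        exact Nat.lt_succ_self n
      · obtain ⟨v, -, hbv⟩ := Finset.mem_biUnion.1 hb
        have := (Finset.mem_filter.1 (hSe v)).2.1 b hbv
        rw [Fin.lt_def, hun] at this
        omega

/-- The values `b - θ e` with bounded `b` and `e` that are positive are bounded away from zero. -/
theorem exists_pos_le_sub_mul (θ : ℝ) (B E : ℕ) :
    ∃ η : ℝ, 0 < η ∧ ∀ b ≤ B, ∀ e ≤ E, 0 < (b : ℝ) - θ * e → η ≤ (b : ℝ) - θ * e := by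
  set s := (Finset.range (B + 1) ×ˢ Finset.range (E + 1)).filter
    fun q : ℕ × ℕ => 0 < (q.1 : ℝ) - θ * q.2 with hs
  have hmem : ∀ b ≤ B, ∀ e ≤ E, 0 < (b : ℝ) - θ * e → (b, e) ∈ s := by
    intro b hb e he h
    simp only [hs, Finset.mem_filter, Finset.mem_product, Finset.mem_range]
    exact ⟨⟨by omega, by omega⟩, h⟩
  rcases s.eq_empty_or_nonempty with h0 | h0
  · refine ⟨1, one_pos, fun b hb e he h => ?_⟩
    have := hmem b hb e he h
    rw [h0] at this
    exact absurd this (Finset.notMem_empty _)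
  · obtain ⟨q, hq, hmin⟩ := Finset.exists_min_image s (fun q : ℕ × ℕ => (q.1 : ℝ) - θ * q.2) h0
    exact ⟨_, (Finset.mem_filter.1 hq).2, fun b hb e he h => hmin (b, e) (hmem b hb e he h)⟩

/-- The strategy for a parameter `θ'` slightly smaller than `θ` wins on all sparse graphs. The
size of the structures that matter is bounded independently of `θ'`, so that `θ'` may be chosen
so close to `θ` that the difference has no effect on these structures. -/
theorem exists_forall_sparse_ramseyWin (hr : 1 ≤ r) (hθ : 0 < θ)
    (hcost : ∀ π, ∃ X : Finset V, X.Nonempty ∧ cost F r θ π X ≤ 0) :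
    ∃ (θ' : ℝ) (D D' : ℕ), ∀ (N : ℕ) (G : SimpleGraph (Fin N × Fin r)), Sparse θ D' G →
      RamseyWin F (playStrategy θ' D N r) G := by
  obtain ⟨L, hL, hLip⟩ := exists_abs_cost_sub_le F r
  obtain ⟨η, hη, hηle⟩ := exists_pos_le_sub_mul θ ⌊L * θ⌋₊ ⌊L⌋₊
  set ε := min (θ / 2) (η / (4 * L)) with hε
  have hε0 : 0 < ε := lt_min (by positivity) (by positivity)
  have hεθ : ε ≤ θ / 2 := min_le_left _ _
  have hεη : 2 * (L * ε) < η := by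
    have h1 : ε ≤ η / (4 * L) := min_le_right _ _
    rw [le_div_iff₀ (by positivity)] at h1
    nlinarith
  clear_value ε
  set D := ⌈Fintype.card V * θ / ε⌉₊ with hD
  have hDle : Fintype.card V * θ ≤ D * (θ - (θ - ε)) := by
    have h1 : Fintype.card V * θ / ε ≤ D := Nat.le_ceil _
    rw [div_le_iff₀ hε0] at h1
    linarith
  refine ⟨θ - ε, D, 1 + r * D, fun N G hG c ⟨f⟩ => ?_⟩
  set φ : V → Fin N × Fin r := fun v => (f v).1 with hφ
  have hφadj : ∀ v w, F.Adj v w → G.Adj (φ v) (φ w) := fun v w h => f.toHom.map_adj h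
  have hφc : ∀ v, play (θ - ε) D G (φ v).1 (φ v).2 = c := fun v => by
    have h1 : move (playStrategy (θ - ε) D N r) G (φ v).1 (φ v).2 = c := (f v).2
    rwa [move_playStrategy] at h1
  have hφinj : Function.Injective fun v => OrderDual.toDual (φ v).1 := by
    intro v w h
    have h1 : (φ v).1 = (φ w).1 := h
    have h2 : (φ v).2 = (φ w).2 := by
      refine (play (θ - ε) D G (φ v).1).injective ?_
      rw [hφc v, h1, hφc w]
    exact f.injective (Subtype.ext (Prod.ext h1 h2))
  -- Younger vertices are those that are revealed later.
  obtain ⟨π, hπ⟩ : ∃ π : V ≃ Fin (Fintype.card V),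
      ∀ v w, π v < π w ↔ (φ w).1 < (φ v).1 := by
    let _ : LinearOrder V := LinearOrder.lift' _ hφinj
    exact ⟨(Fintype.orderIsoFinOfCardEq V rfl).symm.toEquiv, fun v w =>
      (Fintype.orderIsoFinOfCardEq V rfl).symm.lt_iff_lt⟩
  obtain ⟨X, hX, hXcost⟩ := hcost π
  obtain ⟨S, hXS, -, hSD, hSX⟩ := exists_witness hr (by linarith) hθ (by linarith) hDle hG φ
    hφadj hπ c hφc N X fun v _ => (φ v).1.isLt
  have hSne : S.Nonempty := by
    obtain ⟨v, hv⟩ := hX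
    exact ⟨_, hXS v hv⟩
  have hpos : 0 < excess θ G S := hG S hSne (by nlinarith)
  have hSε : excess (θ - ε) G S ≤ L * ε := by
    have h1 := hLip π X (θ - ε) θ
    rw [sub_sub_cancel_left, abs_neg, abs_of_pos hε0] at h1
    have h2 := le_abs_self (cost F r (θ - ε) π X - cost F r θ π X)
    linarith
  rw [excess_eq hθ.ne', sub_sub_cancel] at hSε
  have hhalf : 1 / 2 ≤ (θ - ε) / θ := by
    rw [div_le_div_iff₀ two_pos hθ]
    linarith
  have hterm : 0 ≤ (θ - ε) / θ * excess θ G S := by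
    have : 0 ≤ (θ - ε) / θ := by linarith
    positivity
  have hcard : (S.card : ℝ) ≤ L * θ := by
    have h1 : ε / θ * (S.card : ℝ) ≤ L * ε := by linarith
    rw [div_mul_eq_mul_div, div_le_iff₀ hθ] at h1
    have h2 : ε * (S.card : ℝ) ≤ ε * (L * θ) := by linarith
    exact le_of_mul_le_mul_left h2 hε0
  have hedges : ((roundEdges G S).card : ℝ) ≤ L := by
    rw [excess] at hpos
    have h1 : θ * ((roundEdges G S).card : ℝ) ≤ θ * L := by linarith
    exact le_of_mul_le_mul_left h1 hθ
  have hη' : η ≤ excess θ G S :=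
    hηle _ (Nat.le_floor hcard) _ (Nat.le_floor hedges) hpos
  have h1 : 0 ≤ ε / θ * (S.card : ℝ) :=
    mul_nonneg (div_nonneg hε0.le hθ.le) (Nat.cast_nonneg _)
  have h2 : 1 / 2 * η ≤ (θ - ε) / θ * excess θ G S :=
    mul_le_mul hhalf hη' hη.le (by linarith)
  linarith

end Witness

section SparseProbability

variable {r : ℕ} {θ : ℝ}

theorem real_not_sparse_le {N : ℕ} (hN : 1 ≤ N) (D : ℕ) (p : unitInterval)
    (hp : (p : ℝ) * (N : ℝ) ^ θ ≤ 1) :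
    (SimpleGraph.binomialRandom (Fin N × Fin r) p).real {G | ¬ Sparse θ D G} ≤
      (D + 1) * 2 ^ (D * r * (D * r)) * ((p : ℝ) * (N : ℝ) ^ θ) := by
  set μ := SimpleGraph.binomialRandom (Fin N × Fin r) p with hμ
  set δ := (p : ℝ) * (N : ℝ) ^ θ with hδ
  have hN0 : (0 : ℝ) < N := by exact_mod_cast hN
  have hδ0 : 0 ≤ δ := mul_nonneg p.2.1 (by positivity)
  set P : Finset (Fin N) → Finset ((Fin N × Fin r) × (Fin N × Fin r)) := fun S =>
    (((S ×ˢ Finset.univ) ×ˢ (S ×ˢ Finset.univ)) :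
      Finset ((Fin N × Fin r) × (Fin N × Fin r))).filter fun e => e.2.1 < e.1.1 with hP
  set I : ℕ → Finset (Fin N) → Finset (Finset ((Fin N × Fin r) × (Fin N × Fin r))) := fun b S =>
    (P S).powerset.filter fun E => 1 ≤ b ∧ (b : ℝ) ≤ θ * E.card with hI
  have hsub : {G | ¬ Sparse θ D G} ⊆ ⋃ b ∈ Finset.range (D + 1),
      ⋃ S ∈ Finset.powersetCard b (Finset.univ : Finset (Fin N)), ⋃ E ∈ I b S, present E := by
    intro G hG
    simp only [Sparse, Set.mem_ofPred_eq, not_forall, not_lt] at hG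
    obtain ⟨S, hS, hSD, hle⟩ := hG
    simp only [Set.mem_iUnion]
    refine ⟨S.card, Finset.mem_range.2 (by omega), S,
      Finset.mem_powersetCard.2 ⟨Finset.subset_univ _, rfl⟩, roundEdges G S, ?_, fun e he => ?_⟩
    · refine Finset.mem_filter.2 ⟨Finset.mem_powerset.2 fun e he => ?_,
        Finset.card_pos.2 hS, ?_⟩
      · simp only [roundEdges, Finset.mem_filter, Finset.mem_univ, true_and] at he
        simp [hP, he]
      · rw [excess] at hle
        linarith
    · exact (Finset.mem_filter.1 he).2.2.2.2
  have hterm : ∀ b S, ∀ E ∈ I b S, μ.real (present E) ≤ δ * ((N : ℝ) ^ b)⁻¹ := by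
    intro b S E hE
    obtain ⟨hEP, hb, hbE⟩ := Finset.mem_filter.1 hE
    rw [Finset.mem_powerset] at hEP
    have h1 := real_inter_present p (T := 0) (Q := Set.univ) (fun _ _ _ => by simp) E
      fun e he => ⟨Nat.zero_le _, (Finset.mem_filter.1 (hEP he)).2⟩
    rw [Set.univ_inter, probReal_univ, mul_one] at h1
    rw [h1, ← div_eq_mul_inv, le_div_iff₀ (by positivity)]
    have hE1 : E.card ≠ 0 := by
      intro h0
      rw [h0] at hbE
      have : (1 : ℝ) ≤ b := by exact_mod_cast hb
      simp at hbE
      linarith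
    calc (p : ℝ) ^ E.card * (N : ℝ) ^ b
        ≤ (p : ℝ) ^ E.card * (N : ℝ) ^ (θ * E.card) := by
          refine mul_le_mul_of_nonneg_left ?_ (pow_nonneg p.2.1 _)
          rw [← Real.rpow_natCast]
          exact Real.rpow_le_rpow_of_exponent_le (by exact_mod_cast hN) hbE
      _ = δ ^ E.card := by
          rw [hδ, mul_pow, Real.rpow_mul hN0.le, Real.rpow_natCast]
      _ ≤ δ := pow_le_of_le_one hδ0 hp hE1
  have hIcard : ∀ b ∈ Finset.range (D + 1),
      ∀ S ∈ Finset.powersetCard b (Finset.univ : Finset (Fin N)),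
        ((I b S).card : ℝ) ≤ 2 ^ (D * r * (D * r)) := by
    intro b hb S hS
    rw [Finset.mem_range] at hb
    have hSb := (Finset.mem_powersetCard.1 hS).2
    have h1 : (P S).card ≤ D * r * (D * r) := by
      refine (Finset.card_filter_le _ _).trans ?_
      rw [Finset.card_product, Finset.card_product, Finset.card_univ, Fintype.card_fin, hSb]
      have : b * r ≤ D * r := Nat.mul_le_mul_right _ (by omega)
      exact Nat.mul_le_mul this this
    have h2 : (I b S).card ≤ 2 ^ (D * r * (D * r)) :=
      (Finset.card_filter_le _ _).trans (by
        rw [Finset.card_powerset]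
        exact Nat.pow_le_pow_right (by norm_num) h1)
    exact_mod_cast h2
  calc μ.real {G | ¬ Sparse θ D G}
      ≤ ∑ b ∈ Finset.range (D + 1), ∑ S ∈ Finset.powersetCard b (Finset.univ : Finset (Fin N)),
          ∑ E ∈ I b S, μ.real (present E) :=
        (measureReal_mono hsub (measure_ne_top _ _)).trans
          ((measureReal_biUnion_finset_le _ _).trans (Finset.sum_le_sum fun b _ =>
            (measureReal_biUnion_finset_le _ _).trans (Finset.sum_le_sum fun S _ =>
              measureReal_biUnion_finset_le _ _)))
    _ ≤ ∑ b ∈ Finset.range (D + 1), ∑ _S ∈ Finset.powersetCard b (Finset.univ : Finset (Fin N)),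
          2 ^ (D * r * (D * r)) * (δ * ((N : ℝ) ^ b)⁻¹) := by
        refine Finset.sum_le_sum fun b hb => Finset.sum_le_sum fun S hS => ?_
        refine (Finset.sum_le_card_nsmul _ _ _ (hterm b S)).trans ?_
        rw [nsmul_eq_mul]
        exact mul_le_mul_of_nonneg_right (hIcard b hb S hS) (by positivity)
    _ ≤ ∑ _b ∈ Finset.range (D + 1), 2 ^ (D * r * (D * r)) * δ := by
        refine Finset.sum_le_sum fun b _ => ?_
        rw [Finset.sum_const, nsmul_eq_mul, Finset.card_powersetCard, Finset.card_univ,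
          Fintype.card_fin]
        have h1 : ((N.choose b : ℕ) : ℝ) ≤ (N : ℝ) ^ b := by exact_mod_cast Nat.choose_le_pow N b
        calc ((N.choose b : ℕ) : ℝ) * (2 ^ (D * r * (D * r)) * (δ * ((N : ℝ) ^ b)⁻¹))
            ≤ (N : ℝ) ^ b * (2 ^ (D * r * (D * r)) * (δ * ((N : ℝ) ^ b)⁻¹)) :=
              mul_le_mul_of_nonneg_right h1 (by positivity)
          _ = 2 ^ (D * r * (D * r)) * δ := by
              have h2 : (N : ℝ) ^ b ≠ 0 := by positivity
              rw [mul_left_comm, mul_left_comm ((N : ℝ) ^ b), mul_inv_cancel₀ h2, mul_one]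
    _ = _ := by
        rw [Finset.sum_const, Finset.card_range, nsmul_eq_mul, Nat.cast_add, Nat.cast_one,
          ← mul_assoc]

/-- Below the threshold the random graph is asymptotically almost surely sparse. -/
theorem tendsto_sparse (hr : 1 ≤ r) (hθ : 0 < θ) (D : ℕ) (p : ℕ → unitInterval)
    (hp : (fun N : ℕ => (p (N * r) : ℝ)) =o[atTop] fun N : ℕ => ((N * r : ℕ) : ℝ) ^ (-θ)) :
    Tendsto (fun N : ℕ => (SimpleGraph.binomialRandom (Fin N × Fin r) (p (N * r))).real
      {G | Sparse θ D G}) atTop (𝓝 1) := by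
  have hδ : Tendsto (fun N : ℕ => (p (N * r) : ℝ) * (N : ℝ) ^ θ) atTop (𝓝 0) := by
    rw [tendsto_order]
    refine ⟨fun a ha => Eventually.of_forall fun N =>
      ha.trans_le (mul_nonneg (p (N * r)).2.1 (by positivity)), fun ε hε => ?_⟩
    filter_upwards [hp.def (half_pos hε), eventually_ge_atTop 1] with N hN hN1
    have hN0 : (0 : ℝ) < N := by exact_mod_cast hN1
    rw [Real.norm_of_nonneg (p (N * r)).2.1, Real.norm_of_nonneg (by positivity)] at hN
    have h1 : ((N * r : ℕ) : ℝ) ^ (-θ) ≤ (N : ℝ) ^ (-θ) := by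
      refine Real.rpow_le_rpow_of_nonpos hN0 ?_ (by linarith)
      exact_mod_cast Nat.le_mul_of_pos_right N hr
    calc (p (N * r) : ℝ) * (N : ℝ) ^ θ ≤ (ε / 2 * (N : ℝ) ^ (-θ)) * (N : ℝ) ^ θ := by
          refine mul_le_mul_of_nonneg_right (hN.trans ?_) (by positivity)
          exact mul_le_mul_of_nonneg_left h1 (by positivity)
      _ = ε / 2 := by
          rw [mul_assoc, ← Real.rpow_add hN0]
          simp
      _ < ε := half_lt_self hε
  have hzero : Tendsto (fun N : ℕ => (SimpleGraph.binomialRandom (Fin N × Fin r)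
      (p (N * r))).real {G | ¬ Sparse θ D G}) atTop (𝓝 0) := by
    have h1 := hδ.const_mul ((D + 1) * 2 ^ (D * r * (D * r)) : ℝ)
    rw [mul_zero] at h1
    refine squeeze_zero' (Eventually.of_forall fun N => measureReal_nonneg) ?_ h1
    filter_upwards [hδ.eventually_le_const one_pos, eventually_ge_atTop 1] with N hN hN1
    exact real_not_sparse_le hN1 D (p (N * r)) hN
  have hcompl : ∀ N : ℕ, (SimpleGraph.binomialRandom (Fin N × Fin r) (p (N * r))).real
      {G | Sparse θ D G} =
      1 - (SimpleGraph.binomialRandom (Fin N × Fin r) (p (N * r))).real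
        {G | ¬ Sparse θ D G} := fun N => by
    rw [← probReal_compl_eq_one_sub (Set.toFinite _).measurableSet]
    congr 1
    ext G
    simp
  simp only [hcompl]
  simpa using hzero.const_sub 1

end SparseProbability

/-! ### Thresholds -/

section Threshold

variable {r : ℕ} {M : Type} {Win : ∀ N : ℕ, Strategy N r M → SimpleGraph (Fin N × Fin r) → Prop}
  {t₁ t₂ : ℕ → ℝ}

/-- Two thresholds of the same game have the same order of magnitude. Otherwise there is a sequence
of rounds along which an edge probability between them would make the player win by the first and
lose by the second threshold. -/
theorem IsThreshold.isBigO (hr : 1 ≤ r) (h₁ : IsThreshold r M Win t₁)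
    (h₂ : IsThreshold r M Win t₂) (hzero : Tendsto (fun N : ℕ => t₂ (N * r)) atTop (𝓝 0)) :
    (fun N : ℕ => t₁ (N * r)) =O[atTop] fun N : ℕ => t₂ (N * r) := by
  by_contra hO
  have hfreq : ∀ k : ℕ, ∃ᶠ N : ℕ in atTop, 0 < t₂ (N * r) ∧
      ((k : ℝ) + 1) ^ 2 * t₂ (N * r) < t₁ (N * r) := by
    intro k
    have h3 : ∃ᶠ N : ℕ in atTop, ¬ ‖t₁ (N * r)‖ ≤ ((k : ℝ) + 1) ^ 2 * ‖t₂ (N * r)‖ := by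
      rw [Filter.frequently_iff_forall_eventually_exists_and]
      intro q hq
      by_contra! hcon
      refine hO (IsBigO.of_bound (((k : ℝ) + 1) ^ 2) ?_)
      filter_upwards [hq] with N hN
      exact not_lt.1 fun hc => hcon N hc hN
    refine (h3.and_eventually (h₁.1.and h₂.1)).mono fun N hN => ⟨hN.2.2, ?_⟩
    have h4 := not_le.1 hN.1
    rwa [Real.norm_of_nonneg hN.2.1.le, Real.norm_of_nonneg hN.2.2.le] at h4
  obtain ⟨φ, hφ, hφk⟩ := Filter.extraction_forall_of_frequently hfreq
  set q : (n : ℕ) → (∃ k, n = φ k * r) → unitInterval := fun n h =>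
    Set.projIcc 0 1 zero_le_one (((h.choose : ℝ) + 1) * t₂ n) with hq
  have hqk : ∀ k (h : ∃ k', φ k * r = φ k' * r),
      (q (φ k * r) h : ℝ) = min 1 (((k : ℝ) + 1) * t₂ (φ k * r)) := by
    intro k h
    have h3 : h.choose = k :=
      (hφ.injective (Nat.eq_of_mul_eq_mul_right hr h.choose_spec)).symm
    have h4 : 0 ≤ ((k : ℝ) + 1) * t₂ (φ k * r) := by
      have := (hφk k).1
      positivity
    simp only [hq, Set.coe_projIcc, h3]
    exact max_eq_right (le_min zero_le_one h4)
  set p₁ : ℕ → unitInterval := fun n => if h : ∃ k, n = φ k * r then q n h else 0 with hp₁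
  set p₂ : ℕ → unitInterval := fun n => if h : ∃ k, n = φ k * r then q n h else 1 with hp₂
  have hsmall : ∀ c : ℝ, 0 < c → ∃ k₀ : ℕ, ∀ k ≥ k₀, 1 ≤ c * ((k : ℝ) + 1) := by
    intro c hc
    obtain ⟨k₀, hk₀⟩ := exists_nat_ge (1 / c)
    refine ⟨k₀, fun k hk => ?_⟩
    rw [div_le_iff₀ hc] at hk₀
    have : (k₀ : ℝ) ≤ k := by exact_mod_cast hk
    nlinarith
  have hcase : ∀ (k₀ N : ℕ), φ k₀ ≤ N → (∃ k ≥ k₀, N = φ k) ∨ ¬ ∃ k, N * r = φ k * r := by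
    intro k₀ N hN
    by_cases h : ∃ k, N * r = φ k * r
    · obtain ⟨k, hk⟩ := h
      have hk' := Nat.eq_of_mul_eq_mul_right hr hk
      refine Or.inl ⟨k, ?_, hk'⟩
      rw [hk'] at hN
      exact hφ.le_iff_le.1 hN
    · exact Or.inr h
  have hlittle₁ : (fun N : ℕ => (p₁ (N * r) : ℝ)) =o[atTop] fun N : ℕ => t₁ (N * r) := by
    refine IsLittleO.of_bound fun c hc => ?_
    obtain ⟨k₀, hk₀⟩ := hsmall c hc
    filter_upwards [eventually_ge_atTop (φ k₀), h₁.1] with N hN hpos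
    rw [Real.norm_of_nonneg (p₁ _).2.1, Real.norm_of_nonneg hpos.le]
    rcases hcase k₀ N hN with ⟨k, hk, rfl⟩ | h
    · have hex : ∃ k', φ k * r = φ k' * r := ⟨k, rfl⟩
      simp only [hp₁, dif_pos hex, hqk]
      refine (min_le_right _ _).trans ?_
      have h5 := (hφk k).2
      have h6 := hk₀ k hk
      have h7 := (hφk k).1
      have h8 : 0 < ((k : ℝ) + 1) * t₂ (φ k * r) := by positivity
      nlinarith
    · simp only [hp₁, dif_neg h]
      simpa using mul_nonneg hc.le hpos.le
  have hlittle₂ : (fun N : ℕ => t₂ (N * r)) =o[atTop] fun N : ℕ => (p₂ (N * r) : ℝ) := by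
    refine IsLittleO.of_bound fun c hc => ?_
    obtain ⟨k₀, hk₀⟩ := hsmall c hc
    filter_upwards [eventually_ge_atTop (φ k₀), h₂.1, hzero.eventually_le_const hc]
      with N hN hpos hle
    rw [Real.norm_of_nonneg (p₂ _).2.1, Real.norm_of_nonneg hpos.le]
    rcases hcase k₀ N hN with ⟨k, hk, rfl⟩ | h
    · have hex : ∃ k', φ k * r = φ k' * r := ⟨k, rfl⟩
      simp only [hp₂, dif_pos hex, hqk]
      rcases min_choice 1 (((k : ℝ) + 1) * t₂ (φ k * r)) with h5 | h5
      · rw [h5, mul_one]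
        exact hle
      · rw [h5]
        have := hk₀ k hk
        nlinarith
    · simp only [hp₂, dif_neg h]
      simpa using hle
  obtain ⟨s, hs⟩ := h₁.2.1 p₁ hlittle₁
  have hlose := (h₂.2.2 p₂ hlittle₂ s).comp hφ.tendsto_atTop
  have hwin := hs.comp hφ.tendsto_atTop
  have hsum : Tendsto (fun _ : ℕ => (1 : ℝ)) atTop (𝓝 (1 + 1)) := by
    refine (hwin.add hlose).congr fun k => ?_
    have hex : ∃ k', φ k * r = φ k' * r := ⟨k, rfl⟩
    have heq : p₁ (φ k * r) = p₂ (φ k * r) := by simp only [hp₁, hp₂, dif_pos hex]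
    simp only [Function.comp_apply]
    rw [heq]
    have h3 := probReal_add_probReal_compl (μ := SimpleGraph.binomialRandom
      (Fin (φ k) × Fin r) (p₂ (φ k * r)))
      (s := {G | Win (φ k) (s (φ k)) G}) (Set.toFinite _).measurableSet
    exact h3
  have := tendsto_nhds_unique hsum tendsto_const_nhds
  norm_num at this

theorem IsThreshold.congr (h₁ : IsThreshold r M Win t₁)
    (hpos : ∀ᶠ N : ℕ in atTop, 0 < t₂ (N * r))
    (h12 : (fun N : ℕ => t₁ (N * r)) =O[atTop] fun N : ℕ => t₂ (N * r))
    (h21 : (fun N : ℕ => t₂ (N * r)) =O[atTop] fun N : ℕ => t₁ (N * r)) :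
    IsThreshold r M Win t₂ :=
  ⟨hpos, fun p hp => h₁.2.1 p (hp.trans_isBigO h21),
    fun p hp s => h₁.2.2 p (h12.trans_isLittleO hp) s⟩

theorem IsThreshold.iff (hr : 1 ≤ r) (h₁ : IsThreshold r M Win t₁)
    (hzero : Tendsto (fun N : ℕ => t₁ (N * r)) atTop (𝓝 0)) :
    IsThreshold r M Win t₂ ↔ (∀ᶠ N : ℕ in atTop, 0 < t₂ (N * r)) ∧
      ((fun N : ℕ => t₁ (N * r)) =O[atTop] fun N : ℕ => t₂ (N * r)) ∧
      ((fun N : ℕ => t₂ (N * r)) =O[atTop] fun N : ℕ => t₁ (N * r)) := by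
  refine ⟨fun h₂ => ?_, fun h => h₁.congr h.1 h.2.1 h.2.2⟩
  have h21 := h₂.isBigO hr h₁ hzero
  exact ⟨h₂.1, h₁.isBigO hr h₂ (h21.trans_tendsto hzero), h21⟩

theorem not_isThreshold_of_not_win (t : ℕ → ℝ)
    (h : ∀ᶠ N : ℕ in atTop, ∀ s G, ¬ Win N s G) : ¬ IsThreshold r M Win t := by
  intro ht
  obtain ⟨s, hs⟩ := ht.2.1 (fun _ => 0) (by simp)
  have h0 : Tendsto (fun N : ℕ => (SimpleGraph.binomialRandom (Fin N × Fin r) 0).real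
      {G | Win N (s N) G}) atTop (𝓝 0) := by
    refine tendsto_const_nhds.congr' ?_
    filter_upwards [h] with N hN
    have : {G | Win N (s N) G} = ∅ := Set.eq_empty_of_forall_notMem fun G => hN (s N) G
    simp [this]
  exact zero_ne_one (tendsto_nhds_unique h0 hs)

end Threshold

section Games

variable {V : Type*} {F : SimpleGraph V} {r N : ℕ}

/-- The Achlioptas strategy that selects the vertices that get colour `c`. -/
def selectColour (s : Strategy N r (Equiv.Perm (Fin r))) (c : Fin r) : Strategy N r (Fin r) :=
  fun i H => (s i H).symm c

theorem chosen_selectColour (s : Strategy N r (Equiv.Perm (Fin r))) (c : Fin r)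
    (G : SimpleGraph (Fin N × Fin r)) : chosen (selectColour s c) G = colorClass s G c := by
  ext v
  exact (Equiv.eq_symm_apply (move s G v.1))

theorem RamseyWin.achlioptasWin {s : Strategy N r (Equiv.Perm (Fin r))}
    {G : SimpleGraph (Fin N × Fin r)} (h : RamseyWin F s G) (c : Fin r) :
    AchlioptasWin F (selectColour s c) G := by
  rw [AchlioptasWin, chosen_selectColour]
  exact h c

variable [Fintype V]

/-- A graph without edges is contained in the graph of the selected vertices as soon as there are
enough rounds. -/
theorem not_achlioptasWin_of_edgeSet_empty (hF : ¬ F.edgeSet.Nonempty)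
    (hN : Fintype.card V ≤ N) (s : Strategy N r (Fin r)) (G : SimpleGraph (Fin N × Fin r)) :
    ¬ AchlioptasWin F s G := by
  refine not_not.2 ?_
  rw [Set.not_nonempty_iff_eq_empty, SimpleGraph.edgeSet_eq_empty] at hF
  subst hF
  let f : Fin N ↪ chosen s G :=
    ⟨fun i => ⟨(i, move s G i), rfl⟩, fun i j h => congrArg (fun x => x.1.1) h⟩
  exact ⟨SimpleGraph.Copy.bot
    ((Fintype.equivFin V).toEmbedding.trans ((Fin.castLEEmb hN).trans f))⟩

theorem isThreshold_rpow {θ : ℝ} (hr : 2 ≤ r) (hθ : 0 < θ) [Nonempty V] (h : Lam F r θ = 0) :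
    IsRamseyThreshold F r (fun n => (n : ℝ) ^ (-θ)) ∧
      IsAchlioptasThreshold F r (fun n => (n : ℝ) ^ (-θ)) := by
  have hpos : ∀ᶠ N : ℕ in atTop, 0 < ((N * r : ℕ) : ℝ) ^ (-θ) := by
    filter_upwards [eventually_ge_atTop 1] with N hN
    have : 0 < N * r := Nat.mul_pos hN (by omega)
    have : (0 : ℝ) < ((N * r : ℕ) : ℝ) := by exact_mod_cast this
    positivity
  have c₀ : Fin r := ⟨0, by omega⟩
  obtain ⟨θ', D, D', hwin⟩ := exists_forall_sparse_ramseyWin (F := F) (r := r) (by omega) hθ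
    (forall_exists_cost_nonpos (by omega) hθ.le h)
  obtain ⟨π, hcost⟩ := exists_forall_cost_nonneg (F := F) (r := r) (by omega) hθ.le h
  have hlow : ∀ p : ℕ → unitInterval, (fun N : ℕ => (p (N * r) : ℝ)) =o[atTop]
      (fun N : ℕ => ((N * r : ℕ) : ℝ) ^ (-θ)) → ∀ A : ∀ N, Set (SimpleGraph (Fin N × Fin r)),
      (∀ N, {G | RamseyWin F (playStrategy θ' D N r) G} ⊆ A N) →
      Tendsto (fun N : ℕ => (SimpleGraph.binomialRandom (Fin N × Fin r) (p (N * r))).real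
        (A N)) atTop (𝓝 1) := by
    intro p hp A hA
    refine tendsto_of_tendsto_of_tendsto_of_le_of_le
      (tendsto_sparse (by omega) hθ D' p hp) tendsto_const_nhds (fun N => ?_) fun N => ?_
    · exact measureReal_mono (fun G hG => hA N (hwin N G hG)) (measure_ne_top _ _)
    · exact measureReal_le_one
  refine ⟨⟨hpos, fun p hp => ⟨fun N => playStrategy θ' D N r, hlow p hp _ fun N => le_rfl⟩,
    fun p hp s => ?_⟩, ⟨hpos, fun p hp => ⟨fun N => selectColour (playStrategy θ' D N r) c₀,
      hlow p hp _ fun N G hG => RamseyWin.achlioptasWin hG c₀⟩, fun p hp s =>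
      tendsto_not_achlioptasWin (by omega) hθ hcost p hp s⟩⟩
  refine tendsto_of_tendsto_of_tendsto_of_le_of_le
    (tendsto_not_achlioptasWin (by omega) hθ hcost p hp fun N => selectColour (s N) c₀)
    tendsto_const_nhds (fun N => ?_) fun N => measureReal_le_one
  exact measureReal_mono (fun G hG hR => hG (RamseyWin.achlioptasWin hR c₀)) (measure_ne_top _ _)

end Games

end VertexGame

end

theorem theorem2 {V : Type*} [Fintype V] (F : SimpleGraph V) (r : ℕ) (hr : 2 ≤ r) :
    (∀ p₀ : ℕ → ℝ,
      VertexGame.IsRamseyThreshold F r p₀ ↔ VertexGame.IsAchlioptasThreshold F r p₀) ∧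
    (F.edgeSet.Nonempty →
      ∃ θ : ℝ, 0 < θ ∧ θ ≤ 2 ∧ VertexGame.Lam F r θ = 0 ∧
        (∀ θ' : ℝ, 0 ≤ θ' → θ' ≤ 2 → VertexGame.Lam F r θ' = 0 → θ' = θ) ∧
        VertexGame.mStar F r = 1 / θ ∧
        VertexGame.IsRamseyThreshold F r (fun n => (n : ℝ) ^ (-(1 / VertexGame.mStar F r))) ∧
        VertexGame.IsAchlioptasThreshold F r
          (fun n => (n : ℝ) ^ (-(1 / VertexGame.mStar F r))) ∧
        VertexGame.IsRamseyThreshold F r (fun n => (n : ℝ) ^ (-θ)) ∧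
        VertexGame.IsAchlioptasThreshold F r (fun n => (n : ℝ) ^ (-θ))) := by
  have hne : F.edgeSet.Nonempty → Nonempty V := by
    rintro ⟨e, _⟩
    induction e using Sym2.ind with
    | _ x y => exact ⟨x⟩
  refine ⟨fun p₀ => ?_, fun hF => ?_⟩
  · by_cases hF : F.edgeSet.Nonempty
    · have := hne hF
      obtain ⟨θ, hθ, -, h, -⟩ := VertexGame.exists_Lam_eq_zero hr hF
      obtain ⟨hR, hA⟩ := VertexGame.isThreshold_rpow hr hθ h
      have hzero : Tendsto (fun N : ℕ => ((N * r : ℕ) : ℝ) ^ (-θ)) atTop (𝓝 0) :=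
        (tendsto_rpow_neg_atTop hθ).comp (tendsto_natCast_atTop_atTop.comp
          (tendsto_id.atTop_mul_const' (by omega : 0 < r)))
      exact (hR.iff (by omega) hzero).trans (hA.iff (by omega) hzero).symm
    · refine iff_of_false (VertexGame.not_isThreshold_of_not_win _ ?_)
        (VertexGame.not_isThreshold_of_not_win _ ?_)
      · filter_upwards [eventually_ge_atTop (Fintype.card V)] with N hN s G hwin
        exact VertexGame.not_achlioptasWin_of_edgeSet_empty hF hN _ G
          (hwin.achlioptasWin ⟨0, by omega⟩)
      · filter_upwards [eventually_ge_atTop (Fintype.card V)] with N hN s G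
        exact VertexGame.not_achlioptasWin_of_edgeSet_empty hF hN s G
  · have := hne hF
    obtain ⟨θ, hθ, hθ2, h, huniq⟩ := VertexGame.exists_Lam_eq_zero hr hF
    have hm := VertexGame.mStar_eq hr hθ h
    obtain ⟨hR, hA⟩ := VertexGame.isThreshold_rpow hr hθ h
    refine ⟨θ, hθ, hθ2, h, huniq, hm, ?_, ?_, hR, hA⟩
    · rw [hm, one_div_one_div]
      exact hR
    · rw [hm, one_div_one_div]
      exact hA
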